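/- Let $(M^{2n},\omega)$ be a connected symplectic manifold and $F=(f_1,\check F)=(f_1,\dots,f_n):M\to\mathbb R^n$ a semi-toric integrable system: $F$ is smooth, its components Poisson-commute, $dF$ has rank $n$ on a dense set, every critical point is non-degenerate (the linearised system on the local symplectic quotient by the regular components spans a Cartan subalgebra) without hyperbolic components, and the flows of $f_2,\dots,f_n$ are $2\pi$-periodic and generate an effective Hamiltonian action of $\mathbb T^{n-1}=(\mathbb R/2\pi\mathbb Z)^{n-1}$. Let $m$ be a critical point of Williamson type $\Bbbk$ with $k_{\mathrm f}=1$, i.e. with one focus-focus component, $k_{\mathrm e}$ elliptic components and rank $k_{\mathrm x}$, so that $n=2+k_{\mathrm e}+k_{\mathrm x}$. Let $$L_\Bbbk=\mathbb R^4\times\mathbb R^{2k_{\mathrm e}}\times T^*\mathbb T^{k_{\mathrm x}}\ni(x^1,x^2,\xi^1,\xi^2,x^{\mathrm e},\xi^{\mathrm e},\theta,I),\qquad \omega_\Bbbk=\sum_i dx^i\wedge d\xi^i+\sum_j dx^{\mathrm e}_j\wedge d\xi^{\mathrm e}_j+\sum_j d\theta_j\wedge dI_j,$$ be the linear model, with momentum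 map $Q_\Bbbk=(q_1,\check Q_\Bbbk)$, $\check Q_\Bbbk=(q_2,q^{\mathrm e}_1,\dots,q^{\mathrm e}_{k_{\mathrm e}},I_1,\dots,I_{k_{\mathrm x}})$, where $q_1=x^1\xi^1+x^2\xi^2$, $q_2=x^1\xi^2-x^2\xi^1$, $q^{\mathrm e}_j=\tfrac12\big((x^{\mathrm e}_j)^2+(\xi^{\mathrm e}_j)^2\big)$, and let $\mathcal T=\{x=\xi=0,\ x^{\mathrm e}=\xi^{\mathrm e}=0,\ I=0\}$ be its zero-torus. Let $\mathcal U_m$ be an open neighbourhood of $m$ containing the orbit $\mathcal O_m$ of $m$ under the local Poisson $\mathbb R^n$-action of $F$, and let $\varphi$ be a symplectomorphism from $(\mathcal U_m,\omega)$ onto an open subset of $(L_\Bbbk,\omega_\Bbbk)$ such that $\varphi(\mathcal O_m)=\mathcal T$ and such that $\varphi$ maps each leaf of $F$ on $\mathcal U_m$ (connected component of a fibre of $F|_{\mathcal U_m}$) onto a leaf of $Q_\Bbbk$ on $\varphi(\mathcal U_m)$. Then there are an open neighbourhood $W\subseteq\varphi(\mathcal U_m)$ of $\mathcal T$, a smooth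 diffeomorphism $G$ from an open subset of $\mathbb R^n$ containing $Q_\Bbbk(W)$ onto an open subset of $\mathbb R^n$, and a matrix $A\in GL_{n-1}(\mathbb Z)$ such that on $W$ 1. $F\circ\varphi^{-1}=G\circ Q_\Bbbk$, 2. $\check F\circ\varphi^{-1}=A\cdot\check Q_\Bbbk+\check F(m)$. -/

import Mathlib

open scoped Manifold ContDiff Matrix

noncomputable section

namespace SemitoricModel

section Symplectic

variable {n : ℕ} {M : Type*} [TopologicalSpace M]
  [ChartedSpace (EuclideanSpace ℝ (Fin (2 * n))) M]

/-- The derivative at `y` of the inverse of the chart at `x`, as an endomorphism of the model space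
(by which every tangent space is represented). -/
def chartFrame (x : M) (y : EuclideanSpace ℝ (Fin (2 * n))) :
    EuclideanSpace ℝ (Fin (2 * n)) →L[ℝ] EuclideanSpace ℝ (Fin (2 * n)) :=
  mfderiv (𝓡 (2 * n)) (𝓡 (2 * n)) (chartAt (EuclideanSpace ℝ (Fin (2 * n))) x).symm y

/-- The expression, in the coordinates of the chart at `x`, of a field of bilinear forms on `M`:
its pull-back under the inverse chart. -/
def chartRep
    (Ω : ∀ p : M, TangentSpace (𝓡 (2 * n)) p →L[ℝ] TangentSpace (𝓡 (2 * n)) p →L[ℝ] ℝ)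
    (x : M) (y : EuclideanSpace ℝ (Fin (2 * n))) :
    EuclideanSpace ℝ (Fin (2 * n)) →L[ℝ] EuclideanSpace ℝ (Fin (2 * n)) →L[ℝ] ℝ :=
  ContinuousLinearMap.bilinearComp (E := EuclideanSpace ℝ (Fin (2 * n)))
    (F := EuclideanSpace ℝ (Fin (2 * n)))
    (Ω ((chartAt (EuclideanSpace ℝ (Fin (2 * n))) x).symm y)) (chartFrame x y) (chartFrame x y)

variable (n M) in
/-- A symplectic form on a manifold of dimension `2n`: a smooth, closed, nondegenerate
alternating 2-form. Smoothness and closedness are expressed in charts; closedness is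
`dΩ (u, v, w) = 0` for constant vector fields `u, v, w` of the chart. -/
structure SymplecticForm where
  form : ∀ p : M, TangentSpace (𝓡 (2 * n)) p →L[ℝ] TangentSpace (𝓡 (2 * n)) p →L[ℝ] ℝ
  alternating : ∀ p u, form p u u = 0
  nondegenerate : ∀ p u, (∀ v, form p u v = 0) → u = 0
  smooth : ∀ x : M, ContDiffOn ℝ ∞ (chartRep form x)
    (chartAt (EuclideanSpace ℝ (Fin (2 * n))) x).target
  closed : ∀ x : M, ∀ y ∈ (chartAt (EuclideanSpace ℝ (Fin (2 * n))) x).target,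
    ∀ u v w : EuclideanSpace ℝ (Fin (2 * n)),
      fderiv ℝ (chartRep form x) y u v w + fderiv ℝ (chartRep form x) y v w u
        + fderiv ℝ (chartRep form x) y w u v = 0

variable (n) in
/-- The differential at `p` of a real function on `M`. -/
def diff (f : M → ℝ) (p : M) : TangentSpace (𝓡 (2 * n)) p →L[ℝ] ℝ :=
  mfderiv (𝓡 (2 * n)) 𝓘(ℝ, ℝ) f p

/-- The Hamiltonian vector field `X_f`, determined by `Ω (X_f, ·) = df`
(see `hamVF_spec` below). -/
def hamVF (Ω : SymplecticForm n M) (f : M → ℝ) (p : M) : TangentSpace (𝓡 (2 * n)) p :=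
  Classical.epsilon fun X => ∀ v, Ω.form p X v = diff n f p v

theorem hamVF_spec (Ω : SymplecticForm n M) (f : M → ℝ) (p : M)
    (v : TangentSpace (𝓡 (2 * n)) p) : Ω.form p (hamVF Ω f p) v = diff n f p v := by
  have : FiniteDimensional ℝ (TangentSpace (𝓡 (2 * n)) p) :=
    inferInstanceAs (FiniteDimensional ℝ (EuclideanSpace ℝ (Fin (2 * n))))
  let B : TangentSpace (𝓡 (2 * n)) p →ₗ[ℝ] Module.Dual ℝ (TangentSpace (𝓡 (2 * n)) p) :=
    { toFun := fun u => (Ω.form p u : TangentSpace (𝓡 (2 * n)) p →ₗ[ℝ] ℝ)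
      map_add' := fun u u' => by ext v; simp
      map_smul' := fun c u => by ext v; simp }
  have hinj : Function.Injective B := by
    rw [← LinearMap.ker_eq_bot, LinearMap.ker_eq_bot']
    intro u hu
    exact Ω.nondegenerate p u fun v => LinearMap.congr_fun hu v
  have hsurj : Function.Surjective B :=
    (LinearMap.injective_iff_surjective_of_finrank_eq_finrank
      (Subspace.dual_finrank_eq).symm).1 hinj
  have hex : ∃ X : TangentSpace (𝓡 (2 * n)) p, ∀ v, Ω.form p X v = diff n f p v := by
    obtain ⟨X, hX⟩ := hsurj (diff n f p : TangentSpace (𝓡 (2 * n)) p →ₗ[ℝ] ℝ)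
    exact ⟨X, fun v => LinearMap.congr_fun hX v⟩
  exact Classical.epsilon_spec hex v

/-- The rank of `F` is maximal at `p`. -/
def IsRegularPoint (F : M → Fin n → ℝ) (p : M) : Prop :=
  Function.Surjective (mfderiv (𝓡 (2 * n)) 𝓘(ℝ, Fin n → ℝ) F p)

/-- Integrable Hamiltonian systems: smooth, with pairwise Poisson-commuting components, and
regular on a dense set (which is then automatically open). -/
structure IsIntegrable (Ω : SymplecticForm n M) (F : M → Fin n → ℝ) : Prop where
  smooth : ContMDiff (𝓡 (2 * n)) 𝓘(ℝ, Fin n → ℝ) ∞ F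
  commute : ∀ i j p, Ω.form p (hamVF Ω (fun q => F q i) p) (hamVF Ω (fun q => F q j) p) = 0
  dense_regular : Dense {p | IsRegularPoint F p}

/-- The linear combination `∑ aᵢ fᵢ` of the components of `F`. -/
def comb (F : M → Fin n → ℝ) (a : Fin n → ℝ) (p : M) : ℝ := ∑ i, a i * F p i

variable (n) in
/-- The Hessian at `p`, computed in the chart at `p` (through which Mathlib identifies the tangent
space at `p` with the model space). It is only used where `df` vanishes at `p`, where the Hessian
is intrinsic. -/
def hess (f : M → ℝ) (p : M) (u v : TangentSpace (𝓡 (2 * n)) p) : ℝ :=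
  fderiv ℝ (fderiv ℝ (f ∘ (chartAt (EuclideanSpace ℝ (Fin (2 * n))) p).symm))
    (chartAt (EuclideanSpace ℝ (Fin (2 * n))) p p) u v

/-- `W` is a symplectic slice of `F` at `p`: a complement, inside `ker dF(p)`, of the span of the
Hamiltonian vector fields of the components. It is canonically the tangent space of the local
symplectic quotient by the regular components of `F`. -/
def IsSlice (Ω : SymplecticForm n M) (F : M → Fin n → ℝ) (p : M)
    (W : Submodule ℝ (TangentSpace (𝓡 (2 * n)) p)) : Prop :=
  Submodule.span ℝ (Set.range fun i => hamVF Ω (fun q => F q i) p) ⊓ W = ⊥ ∧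
  Submodule.span ℝ (Set.range fun i => hamVF Ω (fun q => F q i) p) ⊔ W =
    LinearMap.ker (mfderiv (𝓡 (2 * n)) 𝓘(ℝ, Fin n → ℝ) F p).toLinearMap

/-- The restriction of the symplectic form to a subspace of the tangent space at `p`. -/
def sliceForm (Ω : SymplecticForm n M) (p : M)
    (W : Submodule ℝ (TangentSpace (𝓡 (2 * n)) p)) : LinearMap.BilinForm ℝ W :=
  LinearMap.mk₂ ℝ (fun u v => Ω.form p u v) (by intros; simp) (by intros; simp)
    (by intros; simp) (by intros; simp)

/-- The linearised Hamiltonian vector fields, on the slice `W`, of the combinations of the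
components of `F` that are critical at `p`. -/
def linearisedFields (Ω : SymplecticForm n M) (F : M → Fin n → ℝ) (p : M)
    (W : Submodule ℝ (TangentSpace (𝓡 (2 * n)) p)) : Set (Module.End ℝ W) :=
  {A | ∃ a : Fin n → ℝ, diff n (comb F a) p = 0 ∧
    ∀ u v : W, Ω.form p (A u) v = hess n (comb F a) p u v}

/-- Non-degeneracy of a point: on the symplectic slice, the linearised fields form a Cartan
subalgebra of the symplectic Lie algebra. -/
def IsNondegenerate (Ω : SymplecticForm n M) (F : M → Fin n → ℝ) (p : M) : Prop :=
  ∃ W, IsSlice Ω F p W ∧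
    ∃ H : LieSubalgebra ℝ (skewAdjointLieSubalgebra (sliceForm Ω p W)),
      H.IsCartanSubalgebra ∧ {A : Module.End ℝ W | ∃ B ∈ H, (B : Module.End ℝ W) = A} =
        linearisedFields Ω F p W

end Symplectic

/-- The standard symplectic form `∑ dxᵢ ∧ dξᵢ`. -/
def stdForm {ι : Type*} [Fintype ι] (u v : (ι → ℝ) × (ι → ℝ)) : ℝ :=
  ∑ i, (u.1 i * v.2 i - u.2 i * v.1 i)

/-- Degrees of freedom of the Williamson normal form: `ke` elliptic ones, `kf` focus-focus pairs,
`kh` hyperbolic ones. -/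
abbrev WIndex (ke kf kh : ℕ) : Type := Fin ke ⊕ (Fin kf × Fin 2) ⊕ Fin kh

/-- The elementary quadratic Hamiltonians: `x² + ξ²` (elliptic), `x¹ξ¹ + x²ξ²` and `x¹ξ² - x²ξ¹`
(focus-focus), `xξ` (hyperbolic). -/
def elementaryForm {ke kf kh : ℕ} :
    WIndex ke kf kh → (WIndex ke kf kh → ℝ) × (WIndex ke kf kh → ℝ) → ℝ
  | Sum.inl i, z => z.1 (.inl i) ^ 2 + z.2 (.inl i) ^ 2
  | Sum.inr (Sum.inl (i, 0)), z =>
      z.1 (.inr (.inl (i, 0))) * z.2 (.inr (.inl (i, 0))) +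
        z.1 (.inr (.inl (i, 1))) * z.2 (.inr (.inl (i, 1)))
  | Sum.inr (Sum.inl (i, 1)), z =>
      z.1 (.inr (.inl (i, 0))) * z.2 (.inr (.inl (i, 1))) -
        z.1 (.inr (.inl (i, 1))) * z.2 (.inr (.inl (i, 0)))
  | Sum.inr (Sum.inr i), z => z.1 (.inr (.inr i)) * z.2 (.inr (.inr i))

section System

variable {n : ℕ} {M : Type*} [TopologicalSpace M]
  [ChartedSpace (EuclideanSpace ℝ (Fin (2 * n))) M]

/-- `p` has Williamson type `(ke, kf, kh, kx)`: the rank of `F` at `p` is `kx`, and in suitable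
symplectic linear coordinates on the symplectic slice the Hessians of the combinations of
components that are critical at `p` are exactly the linear combinations of the elementary
quadratic forms. (By dimension count `ke + 2 kf + kh + kx = n`.) -/
def HasWilliamsonType (Ω : SymplecticForm n M) (F : M → Fin n → ℝ) (p : M)
    (ke kf kh kx : ℕ) : Prop :=
  Module.finrank ℝ
      (LinearMap.range (mfderiv (𝓡 (2 * n)) 𝓘(ℝ, Fin n → ℝ) F p).toLinearMap) = kx ∧
  ∃ W, IsSlice Ω F p W ∧
    ∃ S : W ≃ₗ[ℝ] (WIndex ke kf kh → ℝ) × (WIndex ke kf kh → ℝ),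
      (∀ u v : W, Ω.form p u v = stdForm (S u) (S v)) ∧
      {g : W → ℝ | ∃ a : Fin n → ℝ, diff n (comb F a) p = 0 ∧
          ∀ w, g w = hess n (comb F a) p w w} =
        {g : W → ℝ | ∃ h ∈ Submodule.span ℝ
            (Set.range (elementaryForm (ke := ke) (kf := kf) (kh := kh))),
          ∀ w, g w = h (S w)}

/-- The orbit of `m` under the local Poisson action of `F`: the points reached from `m` along
finitely many trajectories of the Hamiltonian vector fields of the components, each followed
forward or backward. -/
def poissonOrbit (Ω : SymplecticForm n M) (F : M → Fin n → ℝ) (m : M) : Set M :=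
  {q | Relation.ReflTransGen (fun p p' => ∃ (i : Fin n) (γ : ℝ → M) (a b : ℝ),
    IsMIntegralCurveOn (I := 𝓡 (2 * n)) γ (hamVF Ω fun q => F q i) (Set.uIcc a b) ∧
      γ a = p ∧ γ b = p') m q}

/-- The leaf through `p` of the foliation of a set `U` by the connected components of the fibres
of a map `F` on `U`. -/
def leaf {X Y : Type*} [TopologicalSpace X] (F : X → Y) (U : Set X) (p : X) : Set X :=
  connectedComponentIn (U ∩ F ⁻¹' {F p}) p

end System

/-- Semi-toric systems `F = (f₁, F̌)` with `d + 1` degrees of freedom: integrable systems all of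
whose critical points are non-degenerate without hyperbolic components, and whose last `d`
components `F̌` have `2π`-periodic flows that together form an effective (smooth) action of the
torus `(ℝ/2πℤ)ᵈ`. -/
structure IsSemitoric {d : ℕ} {M : Type*} [TopologicalSpace M]
    [ChartedSpace (EuclideanSpace ℝ (Fin (2 * (d + 1)))) M]
    (Ω : SymplecticForm (d + 1) M) (F : M → Fin (d + 1) → ℝ) : Prop
    extends IsIntegrable Ω F where
  critical : ∀ p, ¬ IsRegularPoint F p →
    IsNondegenerate Ω F p ∧ ∃ ke kf kx, HasWilliamsonType Ω F p ke kf 0 kx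
  torus_action : ∃ ρ : (Fin d → AddCircle (2 * Real.pi)) → M → M,
    (∀ p, ρ 0 p = p) ∧
    (∀ s t p, ρ (s + t) p = ρ s (ρ t p)) ∧
    ContMDiff (𝓘(ℝ, Fin d → ℝ).prod (𝓡 (2 * (d + 1)))) (𝓡 (2 * (d + 1))) ∞
      (fun z : (Fin d → ℝ) × M => ρ (fun i => (z.1 i : AddCircle (2 * Real.pi))) z.2) ∧
    (∀ (i : Fin d) (p : M), IsMIntegralCurve (I := 𝓡 (2 * (d + 1)))
      (fun t : ℝ => ρ (Pi.single i (t : AddCircle (2 * Real.pi))) p)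
      (hamVF Ω fun q => F q i.succ)) ∧
    (∀ t, (∀ p, ρ t p = p) → t = 0)

section LinearModel

variable {ke kx : ℕ}

/-- Indices of the two focus-focus coordinates and the `ke` elliptic ones. -/
abbrev FEIndex (ke : ℕ) : Type := Fin 2 ⊕ Fin ke

variable (ke kx) in
/-- The linear model with one focus-focus and `ke` elliptic components and `kx` transverse ones:
points `(x, ξ, θ, I)`, where `(x, ξ)` are the focus-focus and elliptic coordinates and
`(θ, I)` lies in the cotangent bundle of the torus `(ℝ/2πℤ)^kx`. -/
abbrev LinearModel : Type :=
  (FEIndex ke → ℝ) × (FEIndex ke → ℝ) × (Fin kx → AddCircle (2 * Real.pi)) × (Fin kx → ℝ)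

variable (ke kx) in
/-- The universal cover of the linear model, with `θ` a real vector. -/
abbrev ModelCover : Type :=
  (FEIndex ke → ℝ) × (FEIndex ke → ℝ) × (Fin kx → ℝ) × (Fin kx → ℝ)

/-- The covering map. The smooth structure and the symplectic form of the linear model are those
for which it is a local symplectomorphism. -/
def coverMap (z : ModelCover ke kx) : LinearModel ke kx :=
  (z.1, z.2.1, fun j => (z.2.2.1 j : AddCircle (2 * Real.pi)), z.2.2.2)

/-- The symplectic form `dx ∧ dξ + dθ ∧ dI` of the linear model, on its cover. -/
def modelForm (u v : ModelCover ke kx) : ℝ :=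
  stdForm (u.1, u.2.1) (v.1, v.2.1) + stdForm u.2.2 v.2.2

/-- The momentum map `(q₁, q₂, e₁, …, I₁, …)` of the linear model. -/
def modelMap (y : LinearModel ke kx) : Fin (ke + kx + 2) → ℝ :=
  Matrix.vecCons
    (y.1 (.inl 0) * y.2.1 (.inl 0) + y.1 (.inl 1) * y.2.1 (.inl 1))
    (Matrix.vecCons
      (y.1 (.inl 0) * y.2.1 (.inl 1) - y.1 (.inl 1) * y.2.1 (.inl 0))
      (Fin.append (fun j => (y.1 (.inr j) ^ 2 + y.2.1 (.inr j) ^ 2) / 2) y.2.2.2))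

variable (ke kx) in
/-- The zero-torus `x = ξ = 0, I = 0`. -/
def zeroTorus : Set (LinearModel ke kx) :=
  {y | y.1 = 0 ∧ y.2.1 = 0 ∧ y.2.2.2 = 0}

variable {n : ℕ} {M : Type*} [TopologicalSpace M]
  [ChartedSpace (EuclideanSpace ℝ (Fin (2 * n))) M]

/-- The homeomorphism `φ` from an open subset of `M` onto an open subset of the linear model is a
symplectomorphism: its inverse, read on the cover, is smooth and pulls `Ω` back to the model form.
(The derivative of the inverse is then bijective, so that `φ` is smooth too.) -/
def IsSymplecto (Ω : SymplecticForm n M)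
    (φ : OpenPartialHomeomorph M (LinearModel ke kx)) : Prop :=
  ContMDiffOn 𝓘(ℝ, ModelCover ke kx) (𝓡 (2 * n)) ∞ (φ.symm ∘ coverMap)
    (coverMap ⁻¹' φ.target) ∧
  ∀ z ∈ coverMap ⁻¹' φ.target, ∀ u v : ModelCover ke kx,
    Ω.form (φ.symm (coverMap z))
      (mfderiv 𝓘(ℝ, ModelCover ke kx) (𝓡 (2 * n)) (φ.symm ∘ coverMap) z u)
      (mfderiv 𝓘(ℝ, ModelCover ke kx) (𝓡 (2 * n)) (φ.symm ∘ coverMap) z v) = modelForm u v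

end LinearModel

end SemitoricModel

end

/-!
The linear model enters through three facts. Its fibres near the zero-torus are connected, its
torus action (generated by all components of the momentum map `Q` but the first) is explicit, and
the flow of `q₁` is hyperbolic.

*Existence and smoothness of `G`.* As `φ` maps leaves to leaves, `F ∘ φ⁻¹` is constant on the
connected subsets of the fibres of `Q` (`constOnFibrePaths_of_leaf`). Every point near the
zero-torus can be joined, in its fibre, to a point of a smooth transversal that avoids the
focus-focus singularity; the transversal is parametrized by the values of `q₁`, `q₂`, `I` and by the
radii of the elliptic planes (`ConstOnFibrePaths.eq_radialSection`). So `F ∘ φ⁻¹` is a smooth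
function of these coordinates, and it is even in the radii. Whitney's theorem on even functions,
`exists_contDiff_comp_sq_of_even`, turns it into a smooth function `G` of `Q`
(`ConstOnFibrePaths.exists_contDiff`). Whitney's theorem is proved with the Fourier transform: the
even part of a test function is a superposition of cosines, and a cosine is a function of the square
whose derivatives are all bounded on the half-line, so one may differentiate under the integral.

*The matrix `A`.* The flow of the `i`-th component of `F̌` is read in the model as the flow of
`∑ₖ ∂ₖGᵢ(Q) qₖ`, with constant coefficients on each orbit. By `2π`-periodicity, at generic
points the coefficient of `q₁` vanishes and the others are integers; by continuity they are constant
near the zero-torus (`IsLocalModel.grad_int_of_generic`, `IsLocalModel.exists_int_matrix`). Hence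
`F̌ ∘ φ⁻¹` is affine with an integer matrix `A` (`IsLocalModel.eq_affine`).

*Invertibility of `dG(0)`.* If `a · dG(0) = 0` then `∑ aᵢ fᵢ` is critical at `m` and its Hessian
vanishes on `ker dF(m)`. But the critical combinations form a space of dimension `ke + 2`, and on
the slice their Hessians must fill the span of the `ke + 2` independent elementary forms, so `a = 0`
(`HasWilliamsonType.eq_zero_of_hess`, `IsLocalModel.eq_zero_of_dot_fderiv`). The inverse function
theorem makes `G` a local diffeomorphism, and `det A ≠ 0`.

*`A` is invertible over the integers.* A torus element whose angles, divided by `2π`, form a row of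
`A⁻¹` acts trivially near `m` and has finite order. A map of finite order on a connected manifold
which is the identity near a point is the identity (`eq_id_of_iterate_eq_id`), so that effectiveness
makes the row integral (`IsLocalModel.isUnit_matrix`).
-/

noncomputable section

namespace SemitoricModel

/-! ### The cosine as a smooth function of the square -/

/-- The entire function `∑ (-s)ᵏ / (2k)!`, which is `cos √s` for `s ≥ 0`. -/
def cosSqrt (s : ℝ) : ℝ :=
  FormalMultilinearSeries.ofScalarsSum (fun k : ℕ => ((-1) ^ k / (2 * k).factorial : ℝ)) s

theorem contDiff_cosSqrt : ContDiff ℝ ∞ cosSqrt := by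
  have hr : (FormalMultilinearSeries.ofScalars ℝ
      (fun k : ℕ => ((-1) ^ k / (2 * k).factorial : ℝ))).radius = ⊤ := by
    refine FormalMultilinearSeries.ofScalars_radius_eq_top_of_tendsto _ _
      (Filter.Eventually.of_forall fun k => ?_) ?_
    · positivity
    · have h : ∀ k : ℕ, ‖((-1) ^ k.succ / (2 * k.succ).factorial : ℝ)‖ /
          ‖((-1) ^ k / (2 * k).factorial : ℝ)‖ =
              1 / (((2 * k + 1 : ℕ) : ℝ) * ((2 * k + 2 : ℕ) : ℝ)) := by
        intro k
        have : (2 * k.succ).factorial = (2 * k + 2) * ((2 * k + 1) * (2 * k).factorial) := by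
          rw [show 2 * k.succ = 2 * k + 1 + 1 by omega, Nat.factorial_succ, Nat.factorial_succ]
        rw [this]
        have h0 : ((2 * k).factorial : ℝ) ≠ 0 := by positivity
        simp only [norm_div, norm_pow, norm_neg, norm_one, one_pow, RCLike.norm_natCast]
        push_cast
        field_simp
      simp_rw [h]
      refine squeeze_zero (fun k => by positivity) (fun k => ?_)
        (tendsto_one_div_add_atTop_nhds_zero_nat (𝕜 := ℝ))
      refine one_div_le_one_div_of_le (by positivity) ?_
      push_cast
      nlinarith [(Nat.cast_nonneg k : (0 : ℝ) ≤ k)]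
  have h := FormalMultilinearSeries.hasFPowerSeriesOnBall (𝕜 := ℝ) _
      (by rw [hr]; exact ENNReal.coe_lt_top)
  have hA : AnalyticOnNhd ℝ cosSqrt Set.univ := by
    have := h.analyticOnNhd
    rwa [hr, Metric.eball_top] at this
  exact contDiffOn_univ.1 (hA.contDiffOn uniqueDiffOn_univ)

theorem cosSqrt_sq (x : ℝ) : cosSqrt (x ^ 2) = Real.cos x := by
  rw [cosSqrt, FormalMultilinearSeries.ofScalars_sum_eq, Real.cos_eq_tsum]
  refine tsum_congr fun k => ?_
  rw [smul_eq_mul, ← pow_mul]; ring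

/-- The equation `4 s u'' + 2 u' + u = 0`, satisfied by `u = cosSqrt`, differentiated `k` times. -/
theorem iteratedDeriv_cosSqrt_ode (k : ℕ) {s : ℝ} (hs : 0 < s) :
    4 * s * iteratedDeriv (k + 2) cosSqrt s + (4 * k + 2) * iteratedDeriv (k + 1) cosSqrt s
      + iteratedDeriv k cosSqrt s = 0 := by
  have hd : ∀ j s, HasDerivAt (iteratedDeriv j cosSqrt) (iteratedDeriv (j + 1) cosSqrt s) s := by
    intro j s
    rw [iteratedDeriv_succ]
    exact ((contDiff_cosSqrt.differentiable_iteratedDeriv j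
      (by exact_mod_cast WithTop.coe_lt_top _)) s).hasDerivAt
  induction k generalizing s with
  | zero =>
    have h1 : ∀ x : ℝ, iteratedDeriv 1 cosSqrt (x ^ 2) * (2 * x) = -Real.sin x := by
      intro x
      have a := (hd 0 (x ^ 2)).comp x (hasDerivAt_pow 2 x)
      have e : iteratedDeriv 0 cosSqrt ∘ (fun x : ℝ => x ^ 2) = Real.cos := by
        funext y; simp [cosSqrt_sq]
      rw [e] at a
      have := a.unique (Real.hasDerivAt_cos x)
      simpa using this
    have h2 : ∀ x : ℝ, iteratedDeriv 2 cosSqrt (x ^ 2) * (2 * x) * (2 * x) +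
        iteratedDeriv 1 cosSqrt (x ^ 2) * 2 = -Real.cos x := by
      intro x
      have a := ((hd 1 (x ^ 2)).comp x (hasDerivAt_pow 2 x)).mul ((hasDerivAt_id x).const_mul 2)
      have e : (iteratedDeriv 1 cosSqrt ∘ (fun x : ℝ => x ^ 2)) * (fun x => 2 * id x) =
          fun x => -Real.sin x := by
        funext y; simpa using h1 y
      rw [e] at a
      have := a.unique (Real.hasDerivAt_sin x).neg
      simpa using this
    have := h2 (Real.sqrt s)
    rw [← cosSqrt_sq, Real.sq_sqrt hs.le] at this
    have hq := Real.mul_self_sqrt hs.le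
    simp only [iteratedDeriv_zero, zero_add]
    push_cast
    linear_combination this - 4 * iteratedDeriv 2 cosSqrt s * hq
  | succ k ih =>
    have a := ((((hasDerivAt_id s).const_mul 4).mul (hd (k + 2) s)).add
      ((hd (k + 1) s).const_mul (4 * (k : ℝ) + 2))).add (hd k s)
    have b := (hasDerivAt_const s (0 : ℝ)).congr_of_eventuallyEq
      (Filter.eventuallyEq_of_mem (Ioi_mem_nhds hs) fun t ht => ih ht)
    have := a.unique b
    simp only [id_eq] at this
    push_cast
    linear_combination this

/-- Every derivative `u` of `cosSqrt` is bounded on `[0, ∞)`: by the differential equation, the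
energy `4 s (u')² + u²` is nonincreasing there. -/
theorem abs_iteratedDeriv_cosSqrt_le (k : ℕ) {s : ℝ} (hs : 0 ≤ s) :
    |iteratedDeriv k cosSqrt s| ≤ |iteratedDeriv k cosSqrt 0| := by
  have hd : ∀ j s, HasDerivAt (iteratedDeriv j cosSqrt) (iteratedDeriv (j + 1) cosSqrt s) s := by
    intro j s
    rw [iteratedDeriv_succ]
    exact ((contDiff_cosSqrt.differentiable_iteratedDeriv j
      (by exact_mod_cast WithTop.coe_lt_top _)) s).hasDerivAt
  let V : ℝ → ℝ := fun s => 4 * s * iteratedDeriv (k + 1) cosSqrt s ^ 2 +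
      iteratedDeriv k cosSqrt s ^ 2
  have hV : ∀ s, HasDerivAt V (4 * iteratedDeriv (k + 1) cosSqrt s ^ 2 +
      8 * s * iteratedDeriv (k + 1) cosSqrt s * iteratedDeriv (k + 2) cosSqrt s +
      2 * iteratedDeriv k cosSqrt s * iteratedDeriv (k + 1) cosSqrt s) s := by
    intro s
    have a := (((hasDerivAt_id s).const_mul 4).mul ((hd (k + 1) s).pow 2)).add ((hd k s).pow 2)
    refine a.congr_deriv ?_
    simp only [id_eq, Nat.cast_ofNat, Nat.add_one_sub_one, pow_one, Pi.pow_apply]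
    ring
  have hanti : AntitoneOn V (Set.Ici 0) := by
    refine antitoneOn_of_deriv_nonpos (convex_Ici 0)
      (fun s _ => (hV s).continuousAt.continuousWithinAt)
      (fun s _ => (hV s).differentiableAt.differentiableWithinAt) fun s hs => ?_
    rw [interior_Ici, Set.mem_Ioi] at hs
    rw [(hV s).deriv]
    have e := iteratedDeriv_cosSqrt_ode k hs
    have : 4 * iteratedDeriv (k + 1) cosSqrt s ^ 2 +
      8 * s * iteratedDeriv (k + 1) cosSqrt s * iteratedDeriv (k + 2) cosSqrt s +
      2 * iteratedDeriv k cosSqrt s * iteratedDeriv (k + 1) cosSqrt s =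
        -(8 * k * iteratedDeriv (k + 1) cosSqrt s ^ 2) := by
      linear_combination (2 * iteratedDeriv (k + 1) cosSqrt s) * e
    rw [this]
    have : 0 ≤ 8 * (k : ℝ) * iteratedDeriv (k + 1) cosSqrt s ^ 2 := by positivity
    linarith
  have h := hanti (Set.mem_Ici.2 le_rfl) (Set.mem_Ici.2 hs) hs
  refine sq_le_sq.1 ?_
  have : 0 ≤ 4 * s * iteratedDeriv (k + 1) cosSqrt s ^ 2 := by positivity
  simp only [V] at h
  linarith

/-- The cosine is a function of temperate growth of the square: `cosSqrt` has bounded derivatives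
on `[0, ∞)`, and its exponential growth on the negative axis can be cut off. -/
theorem exists_temperate_cosSqrt :
    ∃ C : ℝ → ℝ, C.HasTemperateGrowth ∧ ∀ x, C (x ^ 2) = Real.cos x := by
  let C : ℝ → ℝ := fun s => Real.smoothTransition (s + 1) * cosSqrt s
  have hC : ContDiff ℝ ∞ C :=
    (Real.smoothTransition.contDiff.comp (contDiff_id.add contDiff_const)).mul contDiff_cosSqrt
  have hpos : ∀ s, 0 ≤ s → C s = cosSqrt s := fun s hs => by
    simp [C, Real.smoothTransition.one_of_one_le (by linarith : 1 ≤ s + 1)]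
  refine ⟨C, ⟨hC, fun n => ?_⟩, fun x => by rw [hpos _ (sq_nonneg x), cosSqrt_sq]⟩
  have hc : Continuous (iteratedDeriv n C) :=
    hC.continuous_iteratedDeriv n (by exact_mod_cast le_top)
  obtain ⟨B, hB⟩ := isCompact_Icc.exists_bound_of_continuousOn (s := Set.Icc (-1 : ℝ) 0)
      hc.continuousOn
  refine ⟨0, max (max B 0) |iteratedDeriv n cosSqrt 0|, fun s => ?_⟩
  rw [norm_iteratedFDeriv_eq_norm_iteratedDeriv, pow_zero, mul_one]
  rcases lt_or_ge s (-1) with h | h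
  · have : iteratedDeriv n C s = 0 := by
      have e : C =ᶠ[nhds s] fun _ => 0 := by
        filter_upwards [Iio_mem_nhds h] with t ht
        simp [C, Real.smoothTransition.zero_of_nonpos (by linarith [Set.mem_Iio.1 ht] : t + 1 ≤ 0)]
      rw [e.iteratedDeriv_eq]
      simp
    rw [this, norm_zero]
    exact le_max_of_le_right (abs_nonneg _)
  · rcases le_or_gt s 0 with h0 | h0
    · exact (hB s ⟨h, h0⟩).trans ((le_max_left _ _).trans (le_max_left _ _))
    · have e : C =ᶠ[nhds s] cosSqrt := by
        filter_upwards [Ioi_mem_nhds h0] with t ht using hpos t (le_of_lt ht)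
      rw [e.iteratedDeriv_eq]
      exact (abs_iteratedDeriv_cosSqrt_le n h0.le).trans (le_max_right _ _)

/-! ### Superpositions of functions of temperate growth -/

section Parametric

theorem hasTemperateGrowth_fderiv {E F : Type*} [NormedAddCommGroup E] [NormedSpace ℝ E]
    [NormedAddCommGroup F] [NormedSpace ℝ F] {f : E → F} (hf : f.HasTemperateGrowth) :
    (fderiv ℝ f).HasTemperateGrowth := by
  refine ⟨hf.1.fderiv_right (by simp), fun n => ?_⟩
  obtain ⟨k, C, h⟩ := hf.2 (n + 1)
  exact ⟨k, C, fun x => by rw [norm_iteratedFDeriv_fderiv]; exact h x⟩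

open MeasureTheory in
theorem integrable_schwartz_smul {V F : Type} [NormedAddCommGroup V] [InnerProductSpace ℝ V]
    [FiniteDimensional ℝ V] [MeasurableSpace V] [BorelSpace V]
    [NormedAddCommGroup F] [NormedSpace ℂ F]
    (S : SchwartzMap V ℂ) {K : V → F} (hK : Continuous K) {C : ℝ} {m : ℕ}
    (hb : ∀ w, ‖K w‖ ≤ C * (1 + ‖w‖) ^ m) : Integrable (fun w => S w • K w) := by
  have h1 : Integrable fun w => C * ((1 + ‖w‖) ^ m * ‖S w‖) := by
    refine Integrable.const_mul ?_ C
    have : (fun w => (1 + ‖w‖) ^ m * ‖S w‖) =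
        fun w => ∑ i ∈ Finset.range (m + 1), (m.choose i : ℝ) * (‖w‖ ^ i * ‖S w‖) := by
      funext w
      rw [add_comm, add_pow, Finset.sum_mul]
      exact Finset.sum_congr rfl fun i _ => by ring
    rw [this]
    exact integrable_finsetSum _ fun i _ => (S.integrable_pow_mul volume i).const_mul _
  refine h1.mono' (S.continuous.smul hK).aestronglyMeasurable
      (Filter.Eventually.of_forall fun w => ?_)
  rw [norm_smul]
  have := mul_le_mul_of_nonneg_left (hb w) (norm_nonneg (S w))
  linarith

open MeasureTheory in
/-- Differentiation under the integral sign, for a kernel of temperate growth integrated against a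
Schwartz function. -/
theorem contDiff_integral_schwartz_smul {V : Type} [NormedAddCommGroup V] [InnerProductSpace ℝ V]
    [FiniteDimensional ℝ V] [MeasurableSpace V] [BorelSpace V] (S : SchwartzMap V ℂ) (n : ℕ) :
    ∀ {F : Type} [NormedAddCommGroup F] [NormedSpace ℝ F] [NormedSpace ℂ F]
      [IsScalarTower ℝ ℂ F] {K : V × V → F} (_ : K.HasTemperateGrowth),
      ContDiff ℝ n fun v => ∫ w, S w • K (w, v) := by
  induction n with
  | zero =>
    intro F _ _ _ _ K hK
    rw [Nat.cast_zero, contDiff_zero]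
    obtain ⟨k, C, hC0, hC⟩ := hK.norm_iteratedFDeriv_le_uniform 0
    have hC' : ∀ x, ‖K x‖ ≤ C * (1 + ‖x‖) ^ k := fun x => by simpa using hC 0 le_rfl x
    rw [continuous_iff_continuousAt]
    intro v₀
    have hle : ∀ w : V, ∀ v ∈ Metric.ball v₀ 1, ‖K (w, v)‖ ≤
        C * (1 + (‖v₀‖ + 1)) ^ k * (1 + ‖w‖) ^ k := by
      intro w v hv
      refine (hC' (w, v)).trans ?_
      rw [mul_assoc, ← mul_pow]
      have h1 : ‖v‖ ≤ ‖v₀‖ + 1 := by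
        have := norm_lt_of_mem_ball hv
        linarith
      have h2 : ‖(w, v)‖ ≤ ‖w‖ + ‖v‖ := by
        rw [Prod.norm_def]; exact max_le (by linarith [norm_nonneg v]) (by linarith [norm_nonneg w])
      gcongr
      nlinarith [norm_nonneg w, norm_nonneg v₀]
    have hbound : Integrable fun w => ‖S w • ((C * (1 + (‖v₀‖ + 1)) ^ k * (1 + ‖w‖) ^ k : ℝ)
        : ℂ)‖ := by
      refine (integrable_schwartz_smul S (K := fun w : V =>
        ((C * (1 + (‖v₀‖ + 1)) ^ k * (1 + ‖w‖) ^ k : ℝ) : ℂ)) (by fun_prop)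
        (C := C * (1 + (‖v₀‖ + 1)) ^ k) (m := k) fun w => ?_).norm
      rw [Complex.norm_real, Real.norm_of_nonneg (by positivity)]
    refine continuousAt_of_dominated (Filter.Eventually.of_forall fun v => ?_) ?_ hbound
      (Filter.Eventually.of_forall fun w => ?_)
    · exact (S.continuous.smul (hK.1.continuous.comp (by fun_prop))).aestronglyMeasurable
    · filter_upwards [Metric.ball_mem_nhds v₀ one_pos] with v hv
      refine Filter.Eventually.of_forall fun w => ?_
      rw [norm_smul, norm_smul, Complex.norm_real, Real.norm_of_nonneg (by positivity)]
      exact mul_le_mul_of_nonneg_left (hle w v hv) (norm_nonneg _)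
    · exact (continuous_const.smul (hK.1.continuous.comp (by fun_prop))).continuousAt
  | succ n ih =>
    intro F _ _ _ _ K hK
    let K' : V × V → (V →L[ℝ] F) := fun x => (fderiv ℝ K x).comp (ContinuousLinearMap.inr ℝ V V)
    have hK' : K'.HasTemperateGrowth :=
      ((ContinuousLinearMap.compL ℝ V (V × V) F).flip
        (ContinuousLinearMap.inr ℝ V V)).hasTemperateGrowth.comp (hasTemperateGrowth_fderiv hK)
    have hpart : ∀ w v, HasFDerivAt (fun v => S w • K (w, v)) (S w • K' (w, v)) v := by
      intro w v
      have h1 : HasFDerivAt K (fderiv ℝ K (w, v)) (w, v) :=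
        ((hK.1.differentiable (by simp)) (w, v)).hasFDerivAt
      exact (h1.comp v (hasFDerivAt_prodMk_right w v)).const_smul (S w)
    obtain ⟨k, C, hC0, hC⟩ := hK'.norm_iteratedFDeriv_le_uniform 0
    have hC' : ∀ x, ‖K' x‖ ≤ C * (1 + ‖x‖) ^ k := fun x => by simpa using hC 0 le_rfl x
    obtain ⟨k₀, C₀, hC₀0, hC₀⟩ := hK.norm_iteratedFDeriv_le_uniform 0
    have hC₀' : ∀ x, ‖K x‖ ≤ C₀ * (1 + ‖x‖) ^ k₀ := fun x => by simpa using hC₀ 0 le_rfl x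
    have hprod : ∀ (w v : V) (r : ℝ), ‖v‖ ≤ r → 1 + ‖(w, v)‖ ≤ (1 + r) * (1 + ‖w‖) := by
      intro w v r hr
      have h2 : ‖(w, v)‖ ≤ ‖w‖ + ‖v‖ := by
        rw [Prod.norm_def]; exact max_le (by linarith [norm_nonneg v]) (by linarith [norm_nonneg w])
      nlinarith [norm_nonneg w, norm_nonneg v]
    have hder : ∀ v₀, HasFDerivAt (fun v => ∫ w, S w • K (w, v)) (∫ w, S w • K' (w, v₀)) v₀ := by
      intro v₀
      have hle : ∀ w : V, ∀ v ∈ Metric.ball v₀ 1, ‖K' (w, v)‖ ≤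
          C * (1 + (‖v₀‖ + 1)) ^ k * (1 + ‖w‖) ^ k := by
        intro w v hv
        refine (hC' (w, v)).trans ?_
        rw [mul_assoc, ← mul_pow]
        have h1 : ‖v‖ ≤ ‖v₀‖ + 1 := by
          have := norm_lt_of_mem_ball hv
          linarith
        gcongr
        exact hprod w v _ h1
      have hbound : Integrable fun w =>
          ‖S w • ((C * (1 + (‖v₀‖ + 1)) ^ k * (1 + ‖w‖) ^ k : ℝ) : ℂ)‖ := by
        refine (integrable_schwartz_smul S (K := fun w : V =>
          ((C * (1 + (‖v₀‖ + 1)) ^ k * (1 + ‖w‖) ^ k : ℝ) : ℂ)) (by fun_prop)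
          (C := C * (1 + (‖v₀‖ + 1)) ^ k) (m := k) fun w => ?_).norm
        rw [Complex.norm_real, Real.norm_of_nonneg (by positivity)]
      refine hasFDerivAt_integral_of_dominated_of_fderiv_le (𝕜 := ℝ)
        (F' := fun v w => S w • K' (w, v)) (Metric.ball_mem_nhds v₀ one_pos)
        (Filter.Eventually.of_forall fun v => ?_) ?_ ?_
            (Filter.Eventually.of_forall fun w v hv => ?_)
        hbound (Filter.Eventually.of_forall fun w v _ => hpart w v)
      · exact (S.continuous.smul (hK.1.continuous.comp (by fun_prop))).aestronglyMeasurable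
      · refine integrable_schwartz_smul S (hK.1.continuous.comp (by fun_prop))
          (C := C₀ * (1 + ‖v₀‖) ^ k₀) (m := k₀) fun w => (hC₀' _).trans ?_
        rw [mul_assoc, ← mul_pow]
        gcongr
        exact hprod w v₀ _ le_rfl
      · exact (S.continuous.smul (hK'.1.continuous.comp (by fun_prop))).aestronglyMeasurable
      · rw [norm_smul, norm_smul, Complex.norm_real, Real.norm_of_nonneg (by positivity)]
        exact mul_le_mul_of_nonneg_left (hle w v hv) (norm_nonneg _)
    rw [Nat.cast_succ, contDiff_succ_iff_hasFDerivAt]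
    exact ⟨_, ih hK', hder⟩

end Parametric

/-! ### Smooth functions that are even in some of the variables -/

theorem hasTemperateGrowth_cexp_mul_I :
    (fun x : ℝ => Complex.exp (x * Complex.I)).HasTemperateGrowth := by
  have hd : ∀ x : ℝ, HasDerivAt (fun x : ℝ => Complex.exp (x * Complex.I))
      (Complex.I * Complex.exp (x * Complex.I)) x := by
    intro x
    have := ((Complex.ofRealCLM.hasDerivAt (x := x)).mul_const Complex.I).cexp
    simpa [mul_comm] using this
  have hn : ∀ n : ℕ, iteratedDeriv n (fun x : ℝ => Complex.exp (x * Complex.I)) =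
      fun x : ℝ => Complex.I ^ n * Complex.exp (x * Complex.I) := by
    intro n
    induction n with
    | zero => simp
    | succ n ih =>
      rw [iteratedDeriv_succ, ih]
      funext x
      rw [((hd x).const_mul (Complex.I ^ n)).deriv]
      ring
  refine ⟨(Complex.ofRealCLM.contDiff.mul contDiff_const).cexp, fun n => ⟨0, 1, fun x => ?_⟩⟩
  rw [norm_iteratedFDeriv_eq_norm_iteratedDeriv, hn]
  simp [Complex.norm_exp]

open MeasureTheory FourierTransform in
/-- For a test function `g` and a unit vector `e`, the mean of `g` over the reflection in `e^⊥` is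
a smooth function of the point whose `e`-coordinate has been squared. By Fourier inversion this
mean is a superposition of the functions `cos (2π ⟪w, e⟫ t) exp (2π i ⟪w, u'⟫)` of the coordinates
`t` along `e` and `u'` along `e^⊥`, and `cos (p t) = C (p² t²)` with `C` of temperate growth. -/
theorem exists_contDiff_comp_sq_eq_mean {V : Type} [NormedAddCommGroup V] [InnerProductSpace ℝ V]
    [FiniteDimensional ℝ V] {e : V} (he : ‖e‖ = 1) {g : V → ℝ} (hg : ContDiff ℝ ∞ g)
    (hgc : HasCompactSupport g) :
    ∃ g' : V → ℝ, ContDiff ℝ ∞ g' ∧ ∀ u, g' (u - inner ℝ e u • e + inner ℝ e u ^ 2 • e) =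
      (g u + g (u - (2 * inner ℝ e u) • e)) / 2 := by
  let _ : MeasurableSpace V := borel V
  have : BorelSpace V := ⟨rfl⟩
  obtain ⟨C, hC, hCcos⟩ := exists_temperate_cosSqrt
  have hgc' : HasCompactSupport (fun u => (g u : ℂ)) := hgc.comp_left Complex.ofReal_zero
  have hg' : ContDiff ℝ ∞ (fun u => (g u : ℂ)) := Complex.ofRealCLM.contDiff.comp hg
  let f : SchwartzMap V ℂ := hgc'.toSchwartzMap hg'
  let S : SchwartzMap V ℂ := 𝓕 f
  have hinv : ∀ u, ∫ w, Complex.exp ((2 * Real.pi * inner ℝ w u : ℝ) * Complex.I) • S w = g u := by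
    intro u
    have h1 : (𝓕⁻ S) u = f u := by rw [FourierPair.fourierInv_fourier_eq]
    rw [SchwartzMap.fourierInv_coe, Real.fourierInv_eq'] at h1
    exact h1
  have hint : ∀ u, Integrable fun w => Complex.exp ((2 * Real.pi * inner ℝ w u : ℝ) * Complex.I)
      • S w := by
    intro u
    refine S.integrable.norm.mono' ?_ (Filter.Eventually.of_forall fun w => ?_)
    · have := S.continuous
      exact Continuous.aestronglyMeasurable (by fun_prop)
    · rw [norm_smul, Complex.norm_exp_ofReal_mul_I, one_mul]
  let K : V × V → ℂ := fun z => (C ((2 * Real.pi * inner ℝ z.1 e) ^ 2 * inner ℝ e z.2) : ℂ) *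
    Complex.exp ((2 * Real.pi * inner ℝ z.1 (z.2 - inner ℝ e z.2 • e) : ℝ) * Complex.I)
  have hK : K.HasTemperateGrowth := by
    have h1 : (fun z : V × V => z.1).HasTemperateGrowth :=
      (ContinuousLinearMap.fst ℝ V V).hasTemperateGrowth
    have h2 : (fun z : V × V => z.2).HasTemperateGrowth :=
      (ContinuousLinearMap.snd ℝ V V).hasTemperateGrowth
    have h3 : (fun z : V × V => inner ℝ z.1 e).HasTemperateGrowth :=
      (Function.hasTemperateGrowth_inner_left e).comp h1
    have h4 : (fun z : V × V => inner ℝ e z.2).HasTemperateGrowth :=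
      (Function.hasTemperateGrowth_inner_right e).comp h2
    have h5 : (fun z : V × V => z.2 - inner ℝ e z.2 • e).HasTemperateGrowth :=
      h2.sub (h4.smul (Function.HasTemperateGrowth.const e))
    have h6 : (fun z : V × V => inner ℝ z.1 (z.2 - inner ℝ e z.2 • e)).HasTemperateGrowth :=
      (innerSL ℝ).bilinear_hasTemperateGrowth h1 h5
    have h7 : (fun z : V × V => C ((2 * Real.pi * inner ℝ z.1 e) ^ 2 *
        inner ℝ e z.2)).HasTemperateGrowth :=
      hC.comp ((((Function.HasTemperateGrowth.const (2 * Real.pi)).mul h3).pow 2).mul h4)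
    have h8 : (fun z : V × V => 2 * Real.pi * inner ℝ z.1
        (z.2 - inner ℝ e z.2 • e)).HasTemperateGrowth :=
      (Function.HasTemperateGrowth.const (2 * Real.pi)).mul h6
    exact (Function.Complex.hasTemperateGrowth_ofReal.comp h7).mul
      (hasTemperateGrowth_cexp_mul_I.comp h8)
  refine ⟨fun v => (∫ w, S w • K (w, v)).re, ?_, fun u => ?_⟩
  · exact Complex.reCLM.contDiff.comp
      (contDiff_infty.2 fun n => contDiff_integral_schwartz_smul S n hK)
  · have hee : inner ℝ e e = (1 : ℝ) := by rw [real_inner_self_eq_norm_sq, he, one_pow]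
    have key : ∀ w, S w • K (w, u - inner ℝ e u • e + inner ℝ e u ^ 2 • e) =
        (1 / 2 : ℂ) * (Complex.exp ((2 * Real.pi * inner ℝ w u : ℝ) * Complex.I) • S w +
          Complex.exp ((2 * Real.pi * inner ℝ w (u - (2 * inner ℝ e u) • e) : ℝ) * Complex.I) •
              S w) := by
      intro w
      have e1 : inner ℝ e (u - inner ℝ e u • e + inner ℝ e u ^ 2 • e) = inner ℝ e u ^ 2 := by
        simp only [inner_add_right, inner_sub_right, inner_smul_right, hee]; ring
      simp only [K, e1]
      rw [← mul_pow, hCcos]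
      have e2 : u - inner ℝ e u • e + inner ℝ e u ^ 2 • e - inner ℝ e u ^ 2 • e =
        u - inner ℝ e u • e := by abel
      rw [e2, Complex.ofReal_cos, Complex.cos]
      simp only [inner_sub_right, inner_smul_right, smul_eq_mul]
      set p : ℝ := inner ℝ w e
      set t : ℝ := inner ℝ e u
      set q : ℝ := inner ℝ w u
      have a1 : Complex.exp (((2 * Real.pi * q : ℝ) : ℂ) * Complex.I) =
          Complex.exp (((2 * Real.pi * p * t : ℝ) : ℂ) * Complex.I) *
          Complex.exp (((2 * Real.pi * (q - t * p) : ℝ) : ℂ) * Complex.I) := by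
        rw [← Complex.exp_add]; congr 1; push_cast; ring
      have a2 : Complex.exp (((2 * Real.pi * (q - 2 * t * p) : ℝ) : ℂ) * Complex.I) =
          Complex.exp (-((2 * Real.pi * p * t : ℝ) : ℂ) * Complex.I) *
          Complex.exp (((2 * Real.pi * (q - t * p) : ℝ) : ℂ) * Complex.I) := by
        rw [← Complex.exp_add]; congr 1; push_cast; ring
      rw [a1, a2]
      ring
    simp_rw [key]
    rw [integral_const_mul, integral_add (hint _) (hint _), hinv, hinv, ← Complex.ofReal_add]
    have : (1 / 2 : ℂ) = ((1 / 2 : ℝ) : ℂ) := by push_cast; rfl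
    rw [this, ← Complex.ofReal_mul, Complex.ofReal_re]
    ring

/-- A smooth function of `x ∈ ℝⁿ`, defined near `0` and even in the coordinates with index in `s`,
is near `0` a smooth function of the squares of these coordinates and of the other coordinates
(Whitney's theorem on even functions). -/
theorem exists_contDiff_comp_sq_of_even {N : ℕ} (s : Finset (Fin N)) {h : (Fin N → ℝ) → ℝ} {r : ℝ}
    (hr : 0 < r) (hh : ContDiffOn ℝ ∞ h (Metric.ball 0 r))
    (heven : ∀ j ∈ s, ∀ x ∈ Metric.ball 0 r, h (Function.update x j (-x j)) = h x) :
    ∃ g : (Fin N → ℝ) → ℝ, ContDiff ℝ ∞ g ∧ ∃ r' > 0, ∀ x ∈ Metric.ball 0 r',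
      h x = g (fun i => if i ∈ s then x i ^ 2 else x i) := by
  induction s using Finset.induction_on with
  | empty =>
    let b : ContDiffBump (0 : Fin N → ℝ) := ⟨r / 3, r / 2, by positivity, by linarith⟩
    refine ⟨fun x => b x * h x, ?_, r / 3, by positivity, fun x hx => ?_⟩
    · refine contDiff_iff_contDiffAt.2 fun x => ?_
      by_cases hx : x ∈ Metric.ball (0 : Fin N → ℝ) r
      · exact (b.contDiff.contDiffAt).mul (hh.contDiffAt (Metric.isOpen_ball.mem_nhds hx))
      · have : (fun x => b x * h x) =ᶠ[nhds x] fun _ => 0 := by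
          have hx' : x ∈ (Metric.closedBall (0 : Fin N → ℝ) (r / 2))ᶜ := by
            intro h'
            exact hx (Metric.closedBall_subset_ball (by linarith) h')
          filter_upwards [Metric.isClosed_closedBall.isOpen_compl.mem_nhds hx'] with y hy
          rw [b.zero_of_le_dist, zero_mul]
          exact (not_le.1 fun h' => hy (Metric.mem_closedBall.2 h')).le
        exact contDiffAt_const.congr_of_eventuallyEq this
    · simp [b.one_of_mem_closedBall (Metric.ball_subset_closedBall hx)]
  | insert j s hj ih =>
    obtain ⟨g, hg, r', hr', hgh⟩ := ih fun i hi => heven i (Finset.mem_insert_of_mem hi)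
    let T : EuclideanSpace ℝ (Fin N) ≃L[ℝ] (Fin N → ℝ) := EuclideanSpace.equiv (Fin N) ℝ
    let b : ContDiffBump (0 : Fin N → ℝ) := ⟨1, 2, by norm_num, by norm_num⟩
    have hgb : ContDiff ℝ ∞ (fun x : Fin N → ℝ => b x * g x) := b.contDiff.mul hg
    have hgbc : HasCompactSupport (fun x : Fin N → ℝ => b x * g x) := b.hasCompactSupport.mul_right
    let e : EuclideanSpace ℝ (Fin N) := EuclideanSpace.single j 1
    have hT : ∀ u i, T u i = u i := fun _ _ => rfl
    have hTs : ∀ y i, (T.symm y) i = y i := fun _ _ => rfl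
    obtain ⟨g', hg', hmean⟩ := exists_contDiff_comp_sq_eq_mean (e := e) (by simp [e])
      (hgb.comp T.contDiff) (hgbc.comp_homeomorph T.toHomeomorph)
    refine ⟨g' ∘ T.symm, hg'.comp T.symm.contDiff, min (min r r') 1, by positivity, fun x hx => ?_⟩
    have hxr : x ∈ Metric.ball (0 : Fin N → ℝ) r :=
      Metric.ball_subset_ball ((min_le_left _ _).trans (min_le_left _ _)) hx
    have hxr' : x ∈ Metric.ball (0 : Fin N → ℝ) r' :=
      Metric.ball_subset_ball ((min_le_left _ _).trans (min_le_right _ _)) hx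
    have hx1 : ∀ i, |x i| < 1 := fun i => by
      have := Metric.ball_subset_ball (min_le_right _ _) hx
      rw [mem_ball_zero_iff] at this
      exact (norm_le_pi_norm x i).trans_lt this
    let y : Fin N → ℝ := fun i => if i ∈ s then x i ^ 2 else x i
    let x' := Function.update x j (-x j)
    let y' : Fin N → ℝ := fun i => if i ∈ s then x' i ^ 2 else x' i
    have hx'r' : x' ∈ Metric.ball (0 : Fin N → ℝ) r' := by
      rw [mem_ball_zero_iff, pi_norm_lt_iff hr'] at hxr' ⊢
      intro i
      by_cases hi : i = j
      · subst hi; simpa [x'] using hxr' i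
      · simpa [x', hi] using hxr' i
    have hb : ∀ z : Fin N → ℝ, (∀ i, |z i| < 1) →
        b (fun i => if i ∈ s then z i ^ 2 else z i) = 1 := by
      intro z hz
      refine b.one_of_mem_closedBall ?_
      rw [mem_closedBall_zero_iff, pi_norm_le_iff_of_nonneg zero_le_one]
      intro i
      split_ifs
      · rw [norm_pow, Real.norm_eq_abs]
        exact pow_le_one₀ (abs_nonneg _) (hz i).le
      · exact (hz i).le
    have hx'1 : ∀ i, |x' i| < 1 := by
      intro i
      by_cases hi : i = j
      · subst hi; simpa [x'] using hx1 i
      · simpa [x', hi] using hx1 i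
    have hin : inner ℝ e (T.symm y) = x j := by
      rw [EuclideanSpace.inner_single_left, hTs]
      simp [y, hj]
    have m := hmean (T.symm y)
    rw [hin] at m
    have hy : h x = g y := hgh x hxr'
    have hy' : h x' = g y' := hgh x' hx'r'
    have e1 : T.symm y - x j • e + x j ^ 2 • e =
        T.symm (fun i => if i ∈ insert j s then x i ^ 2 else x i) := by
      ext i
      by_cases hi : i = j
      · subst hi; simp [e, hTs, y, hj]
      · simp [e, hTs, y, hi]
    have e2 : T (T.symm y - (2 * x j) • e) = y' := by
      funext i
      by_cases hi : i = j
      · subst hi; simp [e, hT, hTs, y, y', x', hj]; ring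
      · simp [e, hT, hTs, y, y', x', hi]
    rw [e1] at m
    simp only [Function.comp_apply, e2, ContinuousLinearEquiv.apply_symm_apply] at m ⊢
    have hby : b y = 1 := hb x hx1
    have hby' : b y' = 1 := hb x' hx'1
    rw [m, hby, hby', one_mul, one_mul, ← hy, ← hy', heven j (Finset.mem_insert_self j s) x hxr]
    ring

/-! ### The fibres of the linear model near the zero-torus -/

section Model

variable {ke kx : ℕ}

/-- The index of the `j`-th elliptic component in the momentum map of the linear model. -/
def ellIdx (j : Fin ke) : Fin (ke + kx + 2) := (Fin.castAdd kx j).succ.succ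

/-- The index of the `j`-th action coordinate in the momentum map of the linear model. -/
def actIdx (j : Fin kx) : Fin (ke + kx + 2) := (Fin.natAdd ke j).succ.succ

theorem forall_idx {p : Fin (ke + kx + 2) → Prop} (h0 : p 0) (h1 : p 1)
    (he : ∀ j : Fin ke, p (ellIdx j)) (ha : ∀ j : Fin kx, p (actIdx j)) : ∀ i, p i := by
  refine Fin.cases h0 (Fin.cases h1 fun i => ?_)
  induction i using Fin.addCases with
  | left j => exact he j
  | right j => exact ha j

theorem forall_idx_succ {p : Fin (ke + kx + 1) → Prop} (h1 : p 0)
    (he : ∀ j : Fin ke, p (Fin.castAdd kx j).succ) (ha : ∀ j : Fin kx, p (Fin.natAdd ke j).succ) :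
    ∀ i, p i := by
  refine Fin.cases h1 fun i => ?_
  induction i using Fin.addCases with
  | left j => exact he j
  | right j => exact ha j

@[simp] theorem modelMap_zero (y : LinearModel ke kx) : modelMap y 0 =
    y.1 (.inl 0) * y.2.1 (.inl 0) + y.1 (.inl 1) * y.2.1 (.inl 1) := rfl

@[simp] theorem modelMap_one (y : LinearModel ke kx) : modelMap y 1 =
    y.1 (.inl 0) * y.2.1 (.inl 1) - y.1 (.inl 1) * y.2.1 (.inl 0) := rfl

@[simp] theorem modelMap_ellIdx (y : LinearModel ke kx) (j : Fin ke) : modelMap y (ellIdx j) =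
    (y.1 (.inr j) ^ 2 + y.2.1 (.inr j) ^ 2) / 2 := by
  simp [modelMap, ellIdx]

@[simp] theorem modelMap_actIdx (y : LinearModel ke kx) (j : Fin kx) : modelMap y (actIdx j) =
    y.2.2.2 j := by
  simp [modelMap, actIdx]

@[simp] theorem ellIdx_ne_zero (j : Fin ke) : (ellIdx j : Fin (ke + kx + 2)) ≠ 0 :=
  Fin.succ_ne_zero _

@[simp] theorem ellIdx_ne_one (j : Fin ke) : (ellIdx j : Fin (ke + kx + 2)) ≠ 1 := fun h =>
  Fin.succ_ne_zero _ (Fin.succ_injective _ (h : _ = Fin.succ 0))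

@[simp] theorem actIdx_ne_ellIdx (i : Fin kx) (j : Fin ke) :
    (actIdx i : Fin (ke + kx + 2)) ≠ ellIdx j := by
  intro h
  have := congrArg Fin.val h
  simp [actIdx, ellIdx] at this
  omega

theorem ellIdx_injective : Function.Injective (ellIdx : Fin ke → Fin (ke + kx + 2)) :=
  fun _ _ h => Fin.castAdd_injective _ _ (Fin.succ_injective _ (Fin.succ_injective _ h))

variable (ke kx) in
/-- A fundamental system of neighbourhoods of the zero-torus, invariant under `torusRot`. -/
def tube (r : ℝ) : Set (LinearModel ke kx) :=
  {y | y.1 (.inl 0) ^ 2 + y.1 (.inl 1) ^ 2 < r ^ 2 ∧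
    y.2.1 (.inl 0) ^ 2 + y.2.1 (.inl 1) ^ 2 < r ^ 2 ∧
    (∀ j, y.1 (.inr j) ^ 2 + y.2.1 (.inr j) ^ 2 < r ^ 2) ∧ ∀ j, |y.2.2.2 j| < r}

theorem isOpen_tube (r : ℝ) : IsOpen (tube ke kx r) := by
  have h1 : IsOpen {y : LinearModel ke kx | y.1 (.inl 0) ^ 2 + y.1 (.inl 1) ^ 2 < r ^ 2} :=
    isOpen_lt (by fun_prop) (by fun_prop)
  have h2 : IsOpen {y : LinearModel ke kx | y.2.1 (.inl 0) ^ 2 + y.2.1 (.inl 1) ^ 2 < r ^ 2} :=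
    isOpen_lt (by fun_prop) (by fun_prop)
  have h3 : IsOpen {y : LinearModel ke kx | ∀ j, y.1 (.inr j) ^ 2 +
      y.2.1 (.inr j) ^ 2 < r ^ 2} := by
    simp only [Set.ofPred_forall]
    exact isOpen_iInter_of_finite fun j => isOpen_lt (by fun_prop) (by fun_prop)
  have h4 : IsOpen {y : LinearModel ke kx | ∀ j, |y.2.2.2 j| < r} := by
    simp only [Set.ofPred_forall]
    exact isOpen_iInter_of_finite fun j => isOpen_lt (by fun_prop) (by fun_prop)
  exact h1.inter (h2.inter (h3.inter h4))

theorem zeroTorus_subset_tube {r : ℝ} (hr : 0 < r) : zeroTorus ke kx ⊆ tube ke kx r := by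
  rintro y ⟨h1, h2, h3⟩
  simp [tube, h1, h2, h3, hr]

theorem tube_mono {r s : ℝ} (hr : 0 < r) (h : r ≤ s) : tube ke kx r ⊆ tube ke kx s := by
  rintro y ⟨h1, h2, h3, h4⟩
  have : r ^ 2 ≤ s ^ 2 := by gcongr
  exact ⟨h1.trans_le this, h2.trans_le this, fun j => (h3 j).trans_le this, fun j =>
      (h4 j).trans_le h⟩

theorem exists_tube_subset {V : Set (LinearModel ke kx)} (hV : IsOpen V) (h : zeroTorus ke kx ⊆ V) :
    ∃ r > 0, tube ke kx r ⊆ V := by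
  have : Fact (0 < 2 * Real.pi) := ⟨by positivity⟩
  let f : ((FEIndex ke → ℝ) × (FEIndex ke → ℝ) × (Fin kx → ℝ)) ×
      (Fin kx → AddCircle (2 * Real.pi)) → LinearModel ke kx := fun z =>
          (z.1.1, z.1.2.1, z.2, z.1.2.2)
  have hf : Continuous f := by fun_prop
  have hcomp : IsCompact (Set.univ : Set (Fin kx → AddCircle (2 * Real.pi))) := isCompact_univ
  obtain ⟨u, v, hu, -, h0, hv, huv⟩ := generalized_tube_lemma
    (s := {(0 : (FEIndex ke → ℝ) × (FEIndex ke → ℝ) × (Fin kx → ℝ))}) isCompact_singleton hcomp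
    (hV.preimage hf) (by
      rintro ⟨a, θ⟩ ⟨ha, -⟩
      rw [Set.mem_singleton_iff] at ha
      subst ha
      exact h ⟨rfl, rfl, rfl⟩)
  obtain ⟨r, hr, hball⟩ := Metric.isOpen_iff.1 hu 0 (h0 rfl)
  refine ⟨r, hr, ?_⟩
  rintro y ⟨h1, h2, h3, h4⟩
  have habs : ∀ a b : ℝ, a ^ 2 + b ^ 2 < r ^ 2 → |a| < r ∧ |b| < r := fun a b hab =>
    ⟨abs_lt_of_sq_lt_sq (by nlinarith [sq_nonneg b]) hr.le,
      abs_lt_of_sq_lt_sq (by nlinarith [sq_nonneg a]) hr.le⟩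
  have : ((y.1, y.2.1, y.2.2.2) : (FEIndex ke → ℝ) × (FEIndex ke → ℝ) × (Fin kx → ℝ)) ∈
      Metric.ball 0 r := by
    rw [mem_ball_zero_iff]
    refine max_lt ((pi_norm_lt_iff hr).2 ?_) (max_lt ((pi_norm_lt_iff hr).2 ?_)
      ((pi_norm_lt_iff hr).2 h4))
    · rintro (i | j)
      · fin_cases i
        · exact (habs _ _ h1).1
        · exact (habs _ _ h1).2
      · exact (habs _ _ (h3 j)).1
    · rintro (i | j)
      · fin_cases i
        · exact (habs _ _ h2).1
        · exact (habs _ _ h2).2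
      · exact (habs _ _ (h3 j)).2
  exact huv (a := ((y.1, y.2.1, y.2.2.2), y.2.2.1)) ⟨hball this, hv trivial⟩

/-- The flow of `∑ aᵢ qᵢ₊₁` at time one: the Hamiltonian torus action generated by all components
of the momentum map of the linear model but the first. -/
def torusRot (a : Fin (ke + kx + 1) → ℝ) (y : LinearModel ke kx) : LinearModel ke kx :=
  (Sum.elim
    ![Real.cos (a 0) * y.1 (.inl 0) - Real.sin (a 0) * y.1 (.inl 1),
      Real.sin (a 0) * y.1 (.inl 0) + Real.cos (a 0) * y.1 (.inl 1)]
    (fun j => Real.cos (a (Fin.castAdd kx j).succ) * y.1 (.inr j) +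
      Real.sin (a (Fin.castAdd kx j).succ) * y.2.1 (.inr j)),
   Sum.elim
    ![Real.cos (a 0) * y.2.1 (.inl 0) - Real.sin (a 0) * y.2.1 (.inl 1),
      Real.sin (a 0) * y.2.1 (.inl 0) + Real.cos (a 0) * y.2.1 (.inl 1)]
    (fun j => Real.cos (a (Fin.castAdd kx j).succ) * y.2.1 (.inr j) -
      Real.sin (a (Fin.castAdd kx j).succ) * y.1 (.inr j)),
   fun j => y.2.2.1 j + (a (Fin.natAdd ke j).succ : ℝ),
   y.2.2.2)

theorem torusRot_zero (y : LinearModel ke kx) : torusRot 0 y = y := by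
  refine Prod.ext ?_ (Prod.ext ?_ (Prod.ext ?_ rfl))
  · funext i
    rcases i with i | j
    · fin_cases i <;> simp [torusRot]
    · simp [torusRot]
  · funext i
    rcases i with i | j
    · fin_cases i <;> simp [torusRot]
    · simp [torusRot]
  · funext j; simp [torusRot]

theorem modelMap_torusRot (a : Fin (ke + kx + 1) → ℝ) (y : LinearModel ke kx) :
    modelMap (torusRot a y) = modelMap y := by
  have hcs := Real.sin_sq_add_cos_sq
  refine funext (forall_idx ?_ ?_ (fun j => ?_) fun j => ?_)
  · simp [torusRot]
    linear_combination (y.1 (.inl 0) * y.2.1 (.inl 0) + y.1 (.inl 1) * y.2.1 (.inl 1)) * hcs (a 0)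
  · simp [torusRot]
    linear_combination (y.1 (.inl 0) * y.2.1 (.inl 1) - y.1 (.inl 1) * y.2.1 (.inl 0)) * hcs (a 0)
  · simp [torusRot]
    linear_combination (y.1 (.inr j) ^ 2 + y.2.1 (.inr j) ^ 2) * hcs (a (Fin.castAdd kx j).succ)
  · simp [torusRot]

theorem torusRot_mem_tube (a : Fin (ke + kx + 1) → ℝ) {y : LinearModel ke kx} {r : ℝ}
    (hy : y ∈ tube ke kx r) : torusRot a y ∈ tube ke kx r := by
  have hcs := Real.sin_sq_add_cos_sq
  obtain ⟨h1, h2, h3, h4⟩ := hy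
  refine ⟨lt_of_eq_of_lt ?_ h1, lt_of_eq_of_lt ?_ h2, fun j => lt_of_eq_of_lt ?_ (h3 j), h4⟩
  · simp [torusRot]
    linear_combination (y.1 (.inl 0) ^ 2 + y.1 (.inl 1) ^ 2) * hcs (a 0)
  · simp [torusRot]
    linear_combination (y.2.1 (.inl 0) ^ 2 + y.2.1 (.inl 1) ^ 2) * hcs (a 0)
  · simp [torusRot]
    linear_combination (y.1 (.inr j) ^ 2 + y.2.1 (.inr j) ^ 2) * hcs (a (Fin.castAdd kx j).succ)

/-- `H` is constant on the connected subsets of `V` that lie in a fibre of the momentum map. -/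
def ConstOnFibrePaths {Y : Type*} (V : Set (LinearModel ke kx)) (H : LinearModel ke kx →
    Y) : Prop :=
  ∀ S ⊆ V, IsPreconnected S → (∀ y ∈ S, ∀ y' ∈ S, modelMap y = modelMap y') →
    ∀ y ∈ S, ∀ y' ∈ S, H y = H y'

theorem ConstOnFibrePaths.eq_of_path {Y : Type*} {V : Set (LinearModel ke kx)}
    {H : LinearModel ke kx → Y} (hH : ConstOnFibrePaths V H) {s : Set ℝ} (hs : IsPreconnected s)
    {c : ℝ → LinearModel ke kx} (hc : ContinuousOn c s) (hV : ∀ t ∈ s, c t ∈ V)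
    (hQ : ∀ t ∈ s, ∀ t' ∈ s, modelMap (c t) = modelMap (c t')) {t t' : ℝ} (ht : t ∈ s)
    (ht' : t' ∈ s) : H (c t) = H (c t') := by
  refine hH (c '' s) ?_ (hs.image c hc) ?_ _ ⟨t, ht, rfl⟩ _ ⟨t', ht', rfl⟩
  · rintro _ ⟨u, hu, rfl⟩
    exact hV u hu
  · rintro _ ⟨u, hu, rfl⟩ _ ⟨u', hu', rfl⟩
    exact hQ u hu u' hu'

theorem ConstOnFibrePaths.torusRot_eq {Y : Type*} {V : Set (LinearModel ke kx)}
    {H : LinearModel ke kx → Y} (hH : ConstOnFibrePaths V H) {r : ℝ} (hr : tube ke kx r ⊆ V)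
    (a : Fin (ke + kx + 1) → ℝ) {y : LinearModel ke kx} (hy : y ∈ tube ke kx r) :
    H (torusRot a y) = H y := by
  have hc : Continuous fun t : ℝ => torusRot (t • a) y := by
    refine Continuous.prodMk ?_ (Continuous.prodMk ?_ (Continuous.prodMk ?_ continuous_const))
    · refine continuous_pi ?_
      rintro (i | j)
      · fin_cases i <;> · simp; fun_prop
      · simp; fun_prop
    · refine continuous_pi ?_
      rintro (i | j)
      · fin_cases i <;> · simp; fun_prop
      · simp; fun_prop
    · refine continuous_pi fun j => continuous_const.add ?_
      exact (AddCircle.continuous_mk' _).comp (by fun_prop)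
  have := hH.eq_of_path isPreconnected_univ hc.continuousOn
    (fun t _ => hr (torusRot_mem_tube _ hy)) (fun t _ t' _ =>
        by rw [modelMap_torusRot, modelMap_torusRot])
    (Set.mem_univ 1) (Set.mem_univ 0)
  simpa [torusRot_zero] using this

/-- A section over a neighbourhood of `0` of the momentum map of the linear model, except that the
elliptic components of `v` are mapped to the radii `x` in place of the energies `x² / 2`. It stays
at distance `δ` from the focus-focus singularity, which makes it smooth. It is written on the
cover. -/
def radialSection (δ : ℝ) (v : Fin (ke + kx + 2) → ℝ) : ModelCover ke kx :=
  (Sum.elim ![δ, 0] (fun j => v (ellIdx j)), Sum.elim ![v 0 / δ, v 1 / δ] (fun _ => 0),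
    0, fun j => v (actIdx j))

/-- The values of the momentum map, with the elliptic energies replaced by the radii. -/
def radialMap (y : LinearModel ke kx) : Fin (ke + kx + 2) → ℝ := fun i =>
  if i ∈ Finset.univ.image (ellIdx : Fin ke → Fin (ke + kx + 2)) then Real.sqrt (2 * modelMap y i)
  else modelMap y i

theorem contDiff_radialSection (δ : ℝ) :
    ContDiff ℝ ∞ (radialSection δ : (Fin (ke + kx + 2) → ℝ) → ModelCover ke kx) := by
  refine ContDiff.prodMk ?_ (ContDiff.prodMk ?_ (ContDiff.prodMk contDiff_const ?_))
  · refine contDiff_pi.2 ?_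
    rintro (i | j)
    · fin_cases i <;> · simp; fun_prop
    · simp; fun_prop
  · refine contDiff_pi.2 ?_
    rintro (i | j)
    · fin_cases i <;> · simp; fun_prop
    · simp; fun_prop
  · fun_prop

theorem radialMap_zero (y : LinearModel ke kx) : radialMap y 0 = modelMap y 0 := by
  rw [radialMap, if_neg]; simp

theorem radialMap_one (y : LinearModel ke kx) : radialMap y 1 = modelMap y 1 := by
  rw [radialMap, if_neg]; simp

theorem radialMap_ellIdx (y : LinearModel ke kx) (j : Fin ke) : radialMap y (ellIdx j) =
    Real.sqrt (y.1 (.inr j) ^ 2 + y.2.1 (.inr j) ^ 2) := by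
  rw [radialMap, if_pos (by simp), modelMap_ellIdx]
  congr 1; ring

theorem radialMap_actIdx (y : LinearModel ke kx) (j : Fin kx) :
    radialMap y (actIdx j) = y.2.2.2 j := by
  rw [radialMap, if_neg, modelMap_actIdx]
  simp [(actIdx_ne_ellIdx _ _).symm]

/-- A torus rotation brings a point to the normal form `x¹ ≥ 0`, `x² = 0` in the focus-focus plane,
`x ≥ 0`, `ξ = 0` in the elliptic planes, and `θ = 0`. -/
theorem exists_torusRot_normal (y : LinearModel ke kx) : ∃ a : Fin (ke + kx + 1) → ℝ,
    (torusRot a y).1 (.inl 0) = Real.sqrt (y.1 (.inl 0) ^ 2 + y.1 (.inl 1) ^ 2) ∧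
    (torusRot a y).1 (.inl 1) = 0 ∧
    (∀ j, (torusRot a y).1 (.inr j) = Real.sqrt (y.1 (.inr j) ^ 2 + y.2.1 (.inr j) ^ 2)) ∧
    (∀ j, (torusRot a y).2.1 (.inr j) = 0) ∧ (torusRot a y).2.2.1 = 0 := by
  have hpolar : ∀ u v : ℝ, ∃ t, Real.cos t * u + Real.sin t * v = Real.sqrt (u ^ 2 + v ^ 2) ∧
      Real.cos t * v - Real.sin t * u = 0 := by
    intro u v
    let z : ℂ := ⟨u, v⟩
    have h1 := Complex.norm_mul_cos_arg z
    have h2 := Complex.norm_mul_sin_arg z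
    have h3 : Real.sqrt (u ^ 2 + v ^ 2) = ‖z‖ := by
      rw [Complex.norm_def, Complex.normSq_apply]
      congr 1; simp [z]; ring
    have hcs := Real.sin_sq_add_cos_sq z.arg
    refine ⟨z.arg, ?_, ?_⟩
    · rw [h3, show u = z.re from rfl, show v = z.im from rfl, ← h1, ← h2]
      linear_combination ‖z‖ * hcs
    · rw [show u = z.re from rfl, show v = z.im from rfl, ← h1, ← h2]
      ring
  obtain ⟨α, hα1, hα2⟩ := hpolar (y.1 (.inl 0)) (y.1 (.inl 1))
  choose β hβ1 hβ2 using fun j => hpolar (y.1 (.inr j)) (y.2.1 (.inr j))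
  choose τ hτ using fun j => QuotientAddGroup.mk_surjective (y.2.2.1 j)
  refine ⟨Fin.cons (-α) (Fin.append β (-τ)), ?_, ?_, fun j => ?_, fun j => ?_, ?_⟩
  · simp [torusRot]; linarith
  · simp [torusRot]; linarith
  · simpa [torusRot] using hβ1 j
  · simpa [torusRot] using hβ2 j
  · funext j
    simp only [torusRot, Fin.cons_succ, Fin.append_right, Pi.neg_apply, Pi.zero_apply]
    rw [← hτ j]
    exact_mod_cast congrArg _ (add_neg_cancel (τ j))

/-- Every point of a small tube can be joined, inside a larger tube and inside its fibre, to the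
value of the radial section at its radial coordinates: first by the torus action, then by the flow
of `q₁`, or through the singular point of the focus-focus plane if `x = 0` there. -/
theorem ConstOnFibrePaths.eq_radialSection {Y : Type*} {V : Set (LinearModel ke kx)}
    {H : LinearModel ke kx → Y} (hH : ConstOnFibrePaths V H) {r : ℝ} (hr : 0 < r)
    (hrV : tube ke kx r ⊆ V) {y : LinearModel ke kx} (hy : y ∈ tube ke kx (r / 2)) :
    H y = H (coverMap (radialSection (r / 2) (radialMap y))) := by
  obtain ⟨a, ha0, ha1, hax, haξ, hθ⟩ := exists_torusRot_normal y
  have hyr : y ∈ tube ke kx r := tube_mono (by positivity) (by linarith) hy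
  rw [← hH.torusRot_eq hrV a hyr]
  have hQ := modelMap_torusRot a y
  have hy' := torusRot_mem_tube a hy
  set w := torusRot a y with hw
  set ρ := Real.sqrt (y.1 (.inl 0) ^ 2 + y.1 (.inl 1) ^ 2) with hρ
  have hρ0 : 0 ≤ ρ := Real.sqrt_nonneg _
  have hrad : radialMap y = radialMap w := by
    funext i; simp only [radialMap, hQ]
  rw [hrad]
  obtain ⟨t1, t2, t3, t4⟩ := hy'
  rw [ha0, ha1] at t1
  have hρr : ρ < r / 2 := by nlinarith
  have hwx : ∀ j, radialMap w (ellIdx j) = w.1 (.inr j) := fun j => by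
    rw [radialMap_ellIdx, haξ, hax, ← Real.sqrt_sq (Real.sqrt_nonneg _)]
    simp
  have hI : ∀ j, radialMap w (actIdx j) = w.2.2.2 j := radialMap_actIdx w
  have h0 : radialMap w 0 = ρ * w.2.1 (.inl 0) := by
    rw [radialMap_zero, modelMap_zero, ha0, ha1]; ring
  have h1 : radialMap w 1 = ρ * w.2.1 (.inl 1) := by
    rw [radialMap_one, modelMap_one, ha0, ha1]; ring
  have hr2 : (0 : ℝ) < r / 2 := by positivity
  -- `c (s, b₀, b₁)` has `x = (s, 0)` and `ξ = (b₀, b₁)` in the focus-focus plane, and the other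
  -- coordinates of `w`; along a path in the fibre, `s b₀` and `s b₁` are constant
  let c : ℝ × ℝ × ℝ → LinearModel ke kx := fun p =>
    (Sum.elim ![p.1, 0] (fun j => w.1 (.inr j)), Sum.elim ![p.2.1, p.2.2] (fun _ => 0), 0, w.2.2.2)
  have hcc : Continuous c := by
    refine Continuous.prodMk ?_ (Continuous.prodMk ?_ continuous_const)
    · refine continuous_pi ?_
      rintro (i | j)
      · fin_cases i <;> · simp; fun_prop
      · simp; fun_prop
    · refine continuous_pi ?_
      rintro (i | j)
      · fin_cases i <;> · simp; fun_prop
      · simp; fun_prop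
  have hcmem : ∀ p : ℝ × ℝ × ℝ, p.1 ^ 2 < r ^ 2 → p.2.1 ^ 2 + p.2.2 ^ 2 < r ^ 2 → c p ∈ V := by
    intro p hp1 hp2
    refine hrV ⟨by simpa [c] using hp1, by simpa [c] using hp2, fun j => ?_, fun j => ?_⟩
    · have := t3 j
      rw [haξ] at this
      simp only [c, Sum.elim_inr]
      nlinarith
    · exact (t4 j).trans (by linarith)
  have hcQ : ∀ p p' : ℝ × ℝ × ℝ, p.1 * p.2.1 = p'.1 * p'.2.1 → p.1 * p.2.2 = p'.1 * p'.2.2 →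
      modelMap (c p) = modelMap (c p') := by
    intro p p' e0 e1
    refine funext (forall_idx ?_ ?_ (fun j => ?_) fun j => ?_)
    · simpa [c] using e0
    · simpa [c] using e1
    · simp [c]
    · simp [c]
  have hwc : w = c (ρ, w.2.1 (.inl 0), w.2.1 (.inl 1)) := by
    refine Prod.ext ?_ (Prod.ext ?_ (Prod.ext hθ rfl))
    · funext i
      rcases i with i | j
      · fin_cases i
        · exact ha0
        · exact ha1
      · rfl
    · funext i
      rcases i with i | j
      · fin_cases i <;> rfl
      · exact haξ j
  have hsec : coverMap (radialSection (r / 2) (radialMap w)) =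
      c (r / 2, ρ * w.2.1 (.inl 0) / (r / 2), ρ * w.2.1 (.inl 1) / (r / 2)) := by
    simp only [coverMap, radialSection, c, h0, h1, hwx, hI]
    refine Prod.ext rfl (Prod.ext rfl (Prod.ext ?_ rfl))
    funext j
    simp
  rw [hsec]
  refine (congrArg H hwc).trans ?_
  rcases hρ0.lt_or_eq with hpos | hzero
  · have hs : ∀ s ∈ Set.Icc ρ (r / 2), 0 < s := fun s hs => hpos.trans_le hs.1
    let g : ℝ → ℝ × ℝ × ℝ := fun s => (s, ρ * w.2.1 (.inl 0) / s, ρ * w.2.1 (.inl 1) / s)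
    have hg : ContinuousOn (fun s => c (g s)) (Set.Icc ρ (r / 2)) := by
      refine hcc.comp_continuousOn (continuousOn_id.prodMk (ContinuousOn.prodMk ?_ ?_))
      · exact continuousOn_const.div continuousOn_id fun s h => (hs s h).ne'
      · exact continuousOn_const.div continuousOn_id fun s h => (hs s h).ne'
    have := hH.eq_of_path (t := ρ) (t' := r / 2) isPreconnected_Icc hg (fun s h => ?_)
      (fun s h s' h' => ?_) ⟨le_rfl, hρr.le⟩ ⟨hρr.le, le_rfl⟩
    · have e : g ρ = (ρ, w.2.1 (.inl 0), w.2.1 (.inl 1)) := by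
        simp only [g]
        rw [mul_div_cancel_left₀ _ hpos.ne', mul_div_cancel_left₀ _ hpos.ne']
      rw [← e]; exact this
    · refine hcmem _ ?_ ?_
      · have := hs s h
        have := h.2
        change s ^ 2 < r ^ 2
        nlinarith
      · have h1 := hs s h
        have h2 : (ρ / s) ^ 2 ≤ 1 := by
          have : ρ / s ≤ 1 := (div_le_one h1).2 h.1
          have : 0 ≤ ρ / s := by positivity
          nlinarith
        change (ρ * w.2.1 (.inl 0) / s) ^ 2 + (ρ * w.2.1 (.inl 1) / s) ^ 2 < r ^ 2
        have e : (ρ * w.2.1 (.inl 0) / s) ^ 2 + (ρ * w.2.1 (.inl 1) / s) ^ 2 =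
          (ρ / s) ^ 2 * (w.2.1 (.inl 0) ^ 2 + w.2.1 (.inl 1) ^ 2) := by ring
        rw [e]
        have h3 : 0 ≤ w.2.1 (.inl 0) ^ 2 + w.2.1 (.inl 1) ^ 2 := by positivity
        nlinarith
    · have h1 := (hs s h).ne'
      have h2 := (hs s' h').ne'
      refine hcQ _ _ ?_ ?_ <;> simp only [g] <;> field_simp
  -- on the plane `x = 0` the path goes through the focus-focus point `x = ξ = 0`
  · rw [← hzero] at *
    have p1 := hH.eq_of_path (t := 1) (t' := 0) (s := Set.Icc 0 1)
      (c := fun s => c (0, s * w.2.1 (.inl 0), s * w.2.1 (.inl 1)))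
      isPreconnected_Icc (hcc.comp (by fun_prop)).continuousOn (fun s h =>
          hcmem _ (by simp; positivity) ?_)
      (fun s h s' h' => hcQ _ _ (by simp) (by simp)) (by simp) (by simp)
    · have p2 := hH.eq_of_path (t := 0) (t' := r / 2) (s := Set.Icc 0 (r / 2))
        (c := fun s => c (s, 0, 0))
        isPreconnected_Icc (hcc.comp (by fun_prop)).continuousOn (fun s h =>
            hcmem _ ?_ (by simp; positivity))
        (fun s h s' h' => hcQ _ _ (by simp) (by simp)) (by simp [hr2.le]) (by simp [hr2.le])
      · simp only [one_mul, zero_mul] at p1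
        simp only [zero_mul, zero_div]
        rw [p1, p2]
      · have := h.1
        have := h.2
        change s ^ 2 < r ^ 2
        nlinarith
    · have h1 : s ^ 2 ≤ 1 := by have := h.1; have := h.2; nlinarith
      have h3 : 0 ≤ w.2.1 (.inl 0) ^ 2 + w.2.1 (.inl 1) ^ 2 := by positivity
      change (s * w.2.1 (.inl 0)) ^ 2 + (s * w.2.1 (.inl 1)) ^ 2 < r ^ 2
      nlinarith

/-- A map that is smooth on a neighbourhood of the zero-torus and constant along the connected sets
in the fibres of the momentum map is, near the zero-torus, a smooth function of the momentum map.
Composed with the radial section it is a smooth function of the radial coordinates, even in the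
elliptic radii because the half-turn of an elliptic plane changes the sign of a radius. -/
theorem ConstOnFibrePaths.exists_contDiff {V : Set (LinearModel ke kx)} (hV : IsOpen V)
    (hV0 : zeroTorus ke kx ⊆ V) {N : ℕ} {H : LinearModel ke kx → Fin N → ℝ}
    (hsm : ContDiffOn ℝ ∞ (H ∘ coverMap) (coverMap ⁻¹' V)) (hH : ConstOnFibrePaths V H) :
    ∃ G : (Fin (ke + kx + 2) → ℝ) → Fin N → ℝ, ContDiff ℝ ∞ G ∧ ∃ r > 0, tube ke kx r ⊆ V ∧
      ∀ y ∈ tube ke kx r, H y = G (modelMap y) := by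
  classical
  obtain ⟨r, hr, hrV⟩ := exists_tube_subset hV hV0
  set s : Finset (Fin (ke + kx + 2)) := Finset.univ.image ellIdx with hs
  have hr2 : (0 : ℝ) < r / 2 := by positivity
  -- `ε` keeps `(r / 2, v / (r / 2))` in the tube of radius `r`
  obtain ⟨ε, hε, hεr, hεr2⟩ : ∃ ε > 0, ε ≤ r ∧ ε ≤ r ^ 2 / 4 :=
    ⟨min r (r ^ 2 / 4), by positivity, min_le_left _ _, min_le_right _ _⟩
  have hmem : ∀ v ∈ Metric.ball (0 : Fin (ke + kx + 2) → ℝ) ε,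
      coverMap (radialSection (r / 2) v) ∈ tube ke kx r := by
    intro v hv
    rw [mem_ball_zero_iff, pi_norm_lt_iff hε] at hv
    have hsq : ∀ i, v i ^ 2 < ε ^ 2 := fun i => sq_lt_sq' (abs_lt.1 (hv i)).1 (abs_lt.1 (hv i)).2
    have hdiv : ∀ i, (v i / (r / 2)) ^ 2 < r ^ 2 / 2 := by
      intro i
      rw [div_pow, div_lt_iff₀ (by positivity)]
      have := hsq i
      have : ε ^ 2 ≤ (r ^ 2 / 4) ^ 2 := by gcongr
      nlinarith [sq_nonneg (r ^ 2), pow_pos hr 4]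
    refine ⟨?_, ?_, fun j => ?_, fun j => ?_⟩
    · simp [coverMap, radialSection]; nlinarith
    · have := hdiv 0
      have := hdiv 1
      simp only [coverMap, radialSection, Sum.elim_inl, Matrix.cons_val_zero, Matrix.cons_val_one]
      linarith
    · have := hsq (ellIdx j)
      have : ε ^ 2 ≤ r ^ 2 := by gcongr
      simp [coverMap, radialSection]; linarith
    · exact (hv (actIdx j)).trans_le hεr
  have hcomp : ∀ i : Fin N, ∃ g : (Fin (ke + kx + 2) → ℝ) → ℝ, ContDiff ℝ ∞ g ∧ ∃ r' > 0,
      ∀ v ∈ Metric.ball 0 r', H (coverMap (radialSection (r / 2) v)) i =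
        g (fun k => if k ∈ s then v k ^ 2 else v k) := by
    intro i
    refine exists_contDiff_comp_sq_of_even (s := s) (r := ε)
      (h := fun v => H (coverMap (radialSection (r / 2) v)) i) hε ?_ ?_
    · have := hsm.comp (contDiff_radialSection (r / 2)).contDiffOn
        (s := Metric.ball (0 : Fin (ke + kx + 2) → ℝ) ε) fun v hv => hrV (hmem v hv)
      exact (contDiffOn_pi.1 this) i
    · intro j hj v hv
      obtain ⟨j, -, rfl⟩ := Finset.mem_image.1 hj
      have h1 := hH.torusRot_eq hrV (Pi.single (Fin.castAdd kx j).succ Real.pi) (hmem v hv)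
      have h2 : torusRot (Pi.single (Fin.castAdd kx j).succ Real.pi)
          (coverMap (radialSection (r / 2) v)) =
          coverMap (radialSection (r / 2) (Function.update v (ellIdx j) (-v (ellIdx j)))) := by
        have hz : (Pi.single (Fin.castAdd kx j).succ Real.pi : Fin (ke + kx + 1) → ℝ) 0 = 0 :=
          Pi.single_eq_of_ne (Fin.succ_ne_zero _).symm _
        have ha : ∀ l, (Pi.single (Fin.castAdd kx j).succ Real.pi : Fin (ke + kx + 1) → ℝ)
            (Fin.natAdd ke l).succ = 0 := fun l => by
          refine Pi.single_eq_of_ne (fun h => ?_) _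
          exact actIdx_ne_ellIdx l j (congrArg Fin.succ h)
        refine Prod.ext ?_ (Prod.ext ?_ (Prod.ext ?_ ?_))
        · funext k
          rcases k with k | l
          · fin_cases k <;> simp [torusRot, coverMap, radialSection]
          · by_cases hl : l = j
            · subst hl; simp [torusRot, coverMap, radialSection]
            · have h3 : (Fin.castAdd kx l).succ ≠ (Fin.castAdd kx j).succ := fun h =>
                hl (ellIdx_injective (congrArg Fin.succ h))
              have h4 : (ellIdx l : Fin (ke + kx + 2)) ≠ ellIdx j := fun h =>
                  hl (ellIdx_injective h)
              simp [torusRot, coverMap, radialSection, Pi.single_eq_of_ne h3, h4]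
        · funext k
          rcases k with k | l
          · fin_cases k <;> simp [torusRot, coverMap, radialSection,
              Function.update_of_ne (ellIdx_ne_zero j).symm, Function.update_of_ne
                  (ellIdx_ne_one j).symm]
          · by_cases hl : l = j
            · subst hl; simp [torusRot, coverMap, radialSection]
            · have h3 : (Fin.castAdd kx l).succ ≠ (Fin.castAdd kx j).succ := fun h =>
                hl (ellIdx_injective (congrArg Fin.succ h))
              simp [torusRot, coverMap, radialSection, Pi.single_eq_of_ne h3]
        · funext l; simp [torusRot, coverMap, radialSection, ha]
        · funext l; simp [torusRot, coverMap, radialSection]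
      rw [← h2, h1]
  choose g hg r' hr' hgr using hcomp
  obtain ⟨R, hR, hRr⟩ : ∃ R > 0, ∀ i, R ≤ r' i := by
    rcases isEmpty_or_nonempty (Fin N) with h | h
    · exact ⟨1, one_pos, fun i => isEmptyElim i⟩
    · obtain ⟨i, hi⟩ := Finite.exists_min r'
      exact ⟨r' i, hr' i, hi⟩
  let T : (Fin (ke + kx + 2) → ℝ) → Fin (ke + kx + 2) → ℝ := fun u k =>
      if k ∈ s then 2 * u k else u k
  have hT : ContDiff ℝ ∞ T := by
    refine contDiff_pi.2 fun k => ?_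
    by_cases hk : k ∈ s
    · simp only [T, if_pos hk]; fun_prop
    · simp only [T, if_neg hk]; fun_prop
  obtain ⟨t, ht, htr, ht1, htR⟩ : ∃ t > 0, t ≤ r / 2 ∧ t ≤ 1 ∧ t ≤ R / 2 :=
    ⟨min (r / 2) (min 1 (R / 2)), by positivity, min_le_left _ _,
      (min_le_right _ _).trans (min_le_left _ _), (min_le_right _ _).trans (min_le_right _ _)⟩
  refine ⟨fun u i => g i (T u), contDiff_pi.2 fun i => (hg i).comp hT, t, ht,
    (tube_mono ht (by linarith)).trans hrV, fun y hy => ?_⟩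
  rw [hH.eq_radialSection hr hrV (tube_mono ht htr hy)]
  funext i
  rw [hgr i _ (Metric.ball_subset_ball (hRr i) ?_)]
  · congr 1
    funext k
    by_cases hk : k ∈ s
    · obtain ⟨j, -, rfl⟩ := Finset.mem_image.1 hk
      simp only [T, if_pos hk]
      rw [radialMap_ellIdx, Real.sq_sqrt (by positivity), modelMap_ellIdx]
      ring
    · simp only [T, if_neg hk, radialMap]
      rw [if_neg hk]
  · obtain ⟨h1, h2, h3, h4⟩ := hy
    have htt : t ^ 2 ≤ R / 2 := by nlinarith
    rw [mem_ball_zero_iff, pi_norm_lt_iff hR]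
    refine forall_idx ?_ ?_ (fun j => ?_) fun j => ?_
    · rw [radialMap_zero, modelMap_zero, Real.norm_eq_abs, abs_lt]
      constructor <;> nlinarith [sq_nonneg (y.1 (.inl 0) - y.2.1 (.inl 0)),
        sq_nonneg (y.1 (.inl 0) + y.2.1 (.inl 0)), sq_nonneg (y.1 (.inl 1) - y.2.1 (.inl 1)),
        sq_nonneg (y.1 (.inl 1) + y.2.1 (.inl 1))]
    · rw [radialMap_one, modelMap_one, Real.norm_eq_abs, abs_lt]
      constructor <;> nlinarith [sq_nonneg (y.1 (.inl 0) - y.2.1 (.inl 1)),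
        sq_nonneg (y.1 (.inl 0) + y.2.1 (.inl 1)), sq_nonneg (y.1 (.inl 1) - y.2.1 (.inl 0)),
        sq_nonneg (y.1 (.inl 1) + y.2.1 (.inl 0))]
    · rw [radialMap_ellIdx, Real.norm_of_nonneg (Real.sqrt_nonneg _), Real.sqrt_lt' hR]
      have := h3 j
      have : t ^ 2 ≤ (R / 2) ^ 2 := by gcongr
      nlinarith
    · rw [radialMap_actIdx, Real.norm_eq_abs]
      exact (h4 j).trans_le (by linarith)

end Model

/-! ### Symplectic charts with values in the linear model -/

section SymplecticChart

variable {ke kx : ℕ}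

theorem stdForm_single {ι : Type*} [Fintype ι] [DecidableEq ι] (u : (ι → ℝ) × (ι → ℝ)) (i : ι) :
    stdForm u (Pi.single i 1, 0) = -u.2 i ∧ stdForm u (0, Pi.single i 1) = u.1 i := by
  constructor <;> simp [stdForm, Pi.single_apply]

theorem modelForm_nondegenerate {u : ModelCover ke kx} (h : ∀ v, modelForm u v = 0) : u = 0 := by
  have h0 : ∀ a : (FEIndex ke → ℝ) × (FEIndex ke → ℝ), stdForm a 0 = 0 := fun a => by simp [stdForm]
  have h0' : ∀ a : (Fin kx → ℝ) × (Fin kx → ℝ), stdForm a 0 = 0 := fun a => by simp [stdForm]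
  refine Prod.ext ?_ (Prod.ext ?_ (Prod.ext ?_ ?_))
  · funext i
    have := h (0, Pi.single i 1, 0)
    rw [modelForm, (stdForm_single _ i).2] at this
    simpa [h0'] using this
  · funext i
    have := h (Pi.single i 1, 0, 0)
    rw [modelForm, show ((Pi.single i 1, 0, 0) : ModelCover ke kx).2.2 = 0 from rfl, h0'] at this
    simpa [(stdForm_single _ i).1] using this
  · funext i
    have := h (0, 0, 0, Pi.single i 1)
    simp only [modelForm] at this
    rw [(stdForm_single _ i).2] at this
    simpa [stdForm] using this
  · funext i
    have := h (0, 0, Pi.single i 1, 0)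
    simp only [modelForm] at this
    rw [(stdForm_single _ i).1] at this
    simpa [stdForm] using this

theorem finrank_modelCover : Module.finrank ℝ (ModelCover ke kx) = 2 * (ke + kx + 2) := by
  simp [ModelCover, Module.finrank_prod]; ring

theorem continuous_coverMap : Continuous (coverMap : ModelCover ke kx → LinearModel ke kx) := by
  refine continuous_fst.prodMk ((continuous_fst.comp continuous_snd).prodMk
    (Continuous.prodMk (continuous_pi fun j => ?_) (by fun_prop)))
  exact (AddCircle.continuous_mk' _).comp (by fun_prop)

theorem coverMap_surjective : Function.Surjective (coverMap : ModelCover ke kx →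
    LinearModel ke kx) := by
  intro y
  choose τ hτ using fun j => QuotientAddGroup.mk_surjective (y.2.2.1 j)
  exact ⟨(y.1, y.2.1, τ, y.2.2.2), Prod.ext rfl (Prod.ext rfl (Prod.ext (funext hτ) rfl))⟩

variable {M : Type*} [TopologicalSpace M] {φ : OpenPartialHomeomorph M (LinearModel ke kx)}

variable (φ) in
/-- The inverse of a chart with values in the linear model, read on the universal cover. -/
def param (z : ModelCover ke kx) : M := φ.symm (coverMap z)

variable (φ) in
/-- The domain of `param φ`. -/
def paramDomain : Set (ModelCover ke kx) := coverMap ⁻¹' φ.target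

theorem isOpen_paramDomain : IsOpen (paramDomain φ) :=
  φ.open_target.preimage continuous_coverMap

variable [ChartedSpace (EuclideanSpace ℝ (Fin (2 * (ke + kx + 2)))) M]
  {Ω : SymplecticForm (ke + kx + 2) M}

variable (φ) in
/-- The differential of `param φ`; the tangent spaces of `M` are identified with the model space. -/
def paramDeriv (z : ModelCover ke kx) :
    ModelCover ke kx →L[ℝ] EuclideanSpace ℝ (Fin (2 * (ke + kx + 2))) :=
  mfderiv 𝓘(ℝ, ModelCover ke kx) (𝓡 (2 * (ke + kx + 2))) (param φ) z

theorem IsSymplecto.contMDiffAt (hφ : IsSymplecto Ω φ) {z : ModelCover ke kx}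
    (hz : z ∈ paramDomain φ) :
    ContMDiffAt 𝓘(ℝ, ModelCover ke kx) (𝓡 (2 * (ke + kx + 2))) ∞ (param φ) z :=
  hφ.1.contMDiffAt (isOpen_paramDomain.mem_nhds hz)

theorem IsSymplecto.paramDeriv_injective (hφ : IsSymplecto Ω φ) {z : ModelCover ke kx}
    (hz : z ∈ paramDomain φ) : Function.Injective (paramDeriv φ z) := by
  rw [injective_iff_map_eq_zero]
  intro u hu
  refine modelForm_nondegenerate fun v => ?_
  rw [← hφ.2 z hz u v]
  have : mfderiv 𝓘(ℝ, ModelCover ke kx) (𝓡 (2 * (ke + kx + 2))) (φ.symm ∘ coverMap) z u = 0 := hu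
  rw [this, map_zero]
  rfl

/-- The differential of `param φ` as an isomorphism. -/
theorem IsSymplecto.exists_paramDeriv_equiv (hφ : IsSymplecto Ω φ) {z : ModelCover ke kx}
    (hz : z ∈ paramDomain φ) :
    ∃ D : ModelCover ke kx ≃L[ℝ] EuclideanSpace ℝ (Fin (2 * (ke + kx + 2))),
      (D : ModelCover ke kx →L[ℝ] EuclideanSpace ℝ (Fin (2 * (ke + kx + 2)))) = paramDeriv φ z := by
  have hd : Module.finrank ℝ (ModelCover ke kx) =
      Module.finrank ℝ (EuclideanSpace ℝ (Fin (2 * (ke + kx + 2)))) := by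
    rw [finrank_modelCover, finrank_euclideanSpace_fin]
  let D := LinearEquiv.ofInjectiveOfFinrankEq ((paramDeriv φ z).toLinearMap)
    (hφ.paramDeriv_injective hz) hd
  refine ⟨D.toContinuousLinearEquiv, ?_⟩
  exact ContinuousLinearMap.ext fun u => rfl

/-- The parametrization read in a chart of `M`. -/
theorem IsSymplecto.hasStrictFDerivAt (hφ : IsSymplecto Ω φ) {z : ModelCover ke kx}
    (hz : z ∈ paramDomain φ) :
    ContDiffAt ℝ ∞ (chartAt (EuclideanSpace ℝ (Fin (2 * (ke + kx + 2)))) (param φ z) ∘ param φ) z ∧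
    fderiv ℝ (chartAt (EuclideanSpace ℝ (Fin (2 * (ke + kx + 2)))) (param φ z) ∘ param φ) z =
      paramDeriv φ z := by
  have h := hφ.contMDiffAt hz
  constructor
  · have := (contMDiffAt_iff_target.1 h).2
    exact this.contDiffAt
  · have h' := h.mdifferentiableAt (by simp)
    refine Eq.trans ?_ (MDifferentiableAt.mfderiv h').symm
    simp only [writtenInExtChartAt, mfld_simps, fderivWithin_univ]
    rfl

/-- A local inverse `κ` of the parametrization, read in a chart of `M`. -/
theorem IsSymplecto.exists_localInverse (hφ : IsSymplecto Ω φ) {z : ModelCover ke kx}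
    (hz : z ∈ paramDomain φ) :
    ∃ κ : EuclideanSpace ℝ (Fin (2 * (ke + kx + 2))) → ModelCover ke kx,
      ContDiffAt ℝ ∞ κ (chartAt _ (param φ z) (param φ z)) ∧
      κ (chartAt _ (param φ z) (param φ z)) = z ∧
      (paramDeriv φ z).comp (fderiv ℝ κ (chartAt _ (param φ z) (param φ z))) =
        ContinuousLinearMap.id ℝ _ ∧
      ∀ᶠ w in nhds (chartAt _ (param φ z) (param φ z)), κ w ∈ paramDomain φ ∧
        param φ (κ w) = (chartAt _ (param φ z)).symm w := by
  obtain ⟨hsm, hder⟩ := hφ.hasStrictFDerivAt hz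
  obtain ⟨D, hD⟩ := hφ.exists_paramDeriv_equiv hz
  have hD' : HasFDerivAt (chartAt (EuclideanSpace ℝ (Fin (2 * (ke + kx + 2)))) (param φ z)
      ∘ param φ)
      (D : ModelCover ke kx →L[ℝ] _) z := by
    rw [hD, ← hder]
    exact (hsm.differentiableAt (by simp)).hasFDerivAt
  have hstr := hsm.hasStrictFDerivAt' hD' (by simp)
  have hκ := hsm.to_localInverse hD' (by simp)
  have hκz : hsm.localInverse hD' (by simp) (chartAt _ (param φ z) (param φ z)) = z :=
    hsm.localInverse_apply_image hD' (by simp)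
  refine ⟨hsm.localInverse hD' (by simp), hκ, hκz, ?_, ?_⟩
  · have h1 : HasFDerivAt (hsm.localInverse hD' (by simp))
        (D.symm : _ →L[ℝ] ModelCover ke kx) (chartAt _ (param φ z) (param φ z)) :=
      hstr.to_localInverse.hasFDerivAt
    rw [h1.fderiv, ← hD]
    exact D.coe_comp_coe_symm
  · have hcont : Filter.Tendsto (hsm.localInverse hD' (by simp))
        (nhds (chartAt _ (param φ z) (param φ z))) (nhds z) := by
      have := hκ.continuousAt.tendsto
      rwa [show (hsm.localInverse hD' (by simp)) ((chartAt _ (param φ z) ∘ param φ) z) = z from hκz]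
        at this
    have hp : ContinuousAt (param φ) z := (hφ.contMDiffAt hz).continuousAt
    filter_upwards [hcont.eventually (isOpen_paramDomain.mem_nhds hz),
      hcont.eventually (hp.eventually ((chartAt (EuclideanSpace ℝ (Fin (2 * (ke + kx + 2))))
        (param φ z)).open_source.mem_nhds (mem_chart_source _ (param φ z)))),
            hstr.eventually_right_inverse] with w h1 h2 h3
    refine ⟨h1, ?_⟩
    rw [← (chartAt _ (param φ z)).left_inv h2]
    exact congrArg _ h3

theorem hasDerivAt_chart_comp {m : ℕ} {M : Type*} [TopologicalSpace M]
    [ChartedSpace (EuclideanSpace ℝ (Fin m)) M] {γ : ℝ → M} {t₀ : ℝ}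
    {v : TangentSpace (𝓡 m) (γ t₀)}
    (hγ : HasMFDerivAt 𝓘(ℝ, ℝ) (𝓡 m) γ t₀ ((1 : ℝ →L[ℝ] ℝ).smulRight v)) :
    HasDerivAt (chartAt (EuclideanSpace ℝ (Fin m)) (γ t₀) ∘ γ)
        (v : EuclideanSpace ℝ (Fin m)) t₀ := by
  have := hγ.2
  simp only [writtenInExtChartAt, mfld_simps] at this
  have h : HasFDerivAt (chartAt (EuclideanSpace ℝ (Fin m)) (γ t₀) ∘ γ)
      ((1 : ℝ →L[ℝ] ℝ).smulRight (v : EuclideanSpace ℝ (Fin m))) t₀ := hasFDerivWithinAt_univ.1 this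
  exact h.hasDerivAt.congr_deriv (one_smul ℝ _)

/-- A differentiable curve in `M` lifts locally, through the parametrization, to a differentiable
curve in the cover of the linear model. -/
theorem IsSymplecto.exists_lift (hφ : IsSymplecto Ω φ) {z₀ : ModelCover ke kx}
    (hz₀ : z₀ ∈ paramDomain φ) {γ : ℝ → M} {t₀ : ℝ} (hγ₀ : param φ z₀ = γ t₀)
    {v : EuclideanSpace ℝ (Fin (2 * (ke + kx + 2)))} (hcont : ContinuousAt γ t₀)
    (hγ : HasDerivAt (chartAt (EuclideanSpace ℝ (Fin (2 * (ke + kx + 2)))) (γ t₀) ∘ γ) v t₀) :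
    ∃ (z : ℝ → ModelCover ke kx) (w : ModelCover ke kx), z t₀ = z₀ ∧ HasDerivAt z w t₀ ∧
      paramDeriv φ z₀ w = v ∧ ∀ᶠ t in nhds t₀, coverMap (z t) = φ (γ t) := by
  obtain ⟨κ, hκ, hκz, hκD, hev⟩ := hφ.exists_localInverse hz₀
  rw [hγ₀] at hκ hκz hκD hev
  have hκ' := (hκ.differentiableAt (by simp)).hasFDerivAt
  have hz := HasFDerivAt.comp_hasDerivAt t₀
    (l := κ) (f := chartAt (EuclideanSpace ℝ (Fin (2 * (ke + kx + 2)))) (γ t₀) ∘ γ) hκ' hγ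
  refine ⟨_, _, ?_, hz, ?_, ?_⟩
  · exact hκz
  · exact DFunLike.congr_fun hκD v
  · have hsrc : ∀ᶠ t in nhds t₀, γ t ∈ (chartAt (EuclideanSpace ℝ (Fin (2 * (ke + kx + 2))))
      (γ t₀)).source :=
      hcont.eventually ((chartAt _ (γ t₀)).open_source.mem_nhds (mem_chart_source _ (γ t₀)))
    filter_upwards [hγ.continuousAt.eventually hev, hsrc] with t h1 h2
    obtain ⟨h3, h4⟩ := h1
    rw [Function.comp_apply, (chartAt _ (γ t₀)).left_inv h2] at h4
    rw [← h4]
    exact (φ.right_inv h3).symm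

/-- A vector `w` that the differential of the parametrization maps to the Hamiltonian vector field
of `f` is the Hamiltonian vector of `f ∘ param φ` for the model form. -/
theorem IsSymplecto.modelForm_eq_fderiv (hφ : IsSymplecto Ω φ) {z : ModelCover ke kx}
    (hz : z ∈ paramDomain φ) {f : M → ℝ}
    (hf : MDifferentiableAt (𝓡 (2 * (ke + kx + 2))) 𝓘(ℝ, ℝ) f (param φ z)) {w : ModelCover ke kx}
    (hw : paramDeriv φ z w = hamVF Ω f (param φ z)) (u : ModelCover ke kx) :
    modelForm w u = fderiv ℝ (f ∘ param φ) z u := by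
  rw [← hφ.2 z hz w u, ← mfderiv_eq_fderiv,
    mfderiv_comp z hf ((hφ.contMDiffAt hz).mdifferentiableAt (by simp))]
  have h := hamVF_spec Ω f (param φ z) (paramDeriv φ z u)
  rw [← hw] at h
  exact h

end SymplecticChart

/-! ### Hamiltonian flows of functions of the momentum map -/

section Flow

variable {ke kx : ℕ}

/-- The derivative at `z` in the direction `u` of the momentum map of the linear model. -/
def modelDiff (z u : ModelCover ke kx) : Fin (ke + kx + 2) → ℝ :=
  Matrix.vecCons
    ((u.1 (.inl 0) * z.2.1 (.inl 0) + z.1 (.inl 0) * u.2.1 (.inl 0)) +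
      (u.1 (.inl 1) * z.2.1 (.inl 1) + z.1 (.inl 1) * u.2.1 (.inl 1)))
    (Matrix.vecCons
      ((u.1 (.inl 0) * z.2.1 (.inl 1) + z.1 (.inl 0) * u.2.1 (.inl 1)) -
        (u.1 (.inl 1) * z.2.1 (.inl 0) + z.1 (.inl 1) * u.2.1 (.inl 0)))
      (Fin.append (fun j => z.1 (.inr j) * u.1 (.inr j) + z.2.1 (.inr j) * u.2.1 (.inr j)) u.2.2.2))

/-- The Hamiltonian vector at `z` of `∑ τₖ qₖ`. -/
def modelHamVec (τ : Fin (ke + kx + 2) → ℝ) (z : ModelCover ke kx) : ModelCover ke kx :=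
  (Sum.elim ![τ 0 * z.1 (.inl 0) - τ 1 * z.1 (.inl 1), τ 0 * z.1 (.inl 1) + τ 1 * z.1 (.inl 0)]
    (fun j => τ (ellIdx j) * z.2.1 (.inr j)),
   Sum.elim ![-τ 0 * z.2.1 (.inl 0) - τ 1 * z.2.1 (.inl 1),
      -τ 0 * z.2.1 (.inl 1) + τ 1 * z.2.1 (.inl 0)] (fun j => -τ (ellIdx j) * z.1 (.inr j)),
   fun j => τ (actIdx j), 0)

theorem sum_idx (f : Fin (ke + kx + 2) → ℝ) :
    ∑ k, f k = f 0 + (f 1 + (∑ j : Fin ke, f (ellIdx j) + ∑ j : Fin kx, f (actIdx j))) := by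
  rw [Fin.sum_univ_succ, Fin.sum_univ_succ, Fin.sum_univ_add]
  rfl

theorem modelDiff_zero (z u : ModelCover ke kx) : modelDiff z u 0 =
    (u.1 (.inl 0) * z.2.1 (.inl 0) + z.1 (.inl 0) * u.2.1 (.inl 0)) +
      (u.1 (.inl 1) * z.2.1 (.inl 1) + z.1 (.inl 1) * u.2.1 (.inl 1)) := rfl

theorem modelDiff_one (z u : ModelCover ke kx) : modelDiff z u 1 =
    (u.1 (.inl 0) * z.2.1 (.inl 1) + z.1 (.inl 0) * u.2.1 (.inl 1)) -
        (u.1 (.inl 1) * z.2.1 (.inl 0) + z.1 (.inl 1) * u.2.1 (.inl 0)) := rfl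

theorem modelDiff_ellIdx (z u : ModelCover ke kx) (j : Fin ke) : modelDiff z u (ellIdx j) =
    z.1 (.inr j) * u.1 (.inr j) + z.2.1 (.inr j) * u.2.1 (.inr j) := by
  simp [modelDiff, ellIdx]

theorem modelDiff_actIdx (z u : ModelCover ke kx) (j : Fin kx) :
    modelDiff z u (actIdx j) = u.2.2.2 j := by
  simp [modelDiff, actIdx]

/-- The defining property of the Hamiltonian vector, with the sign convention of `hamVF`. -/
theorem modelForm_modelHamVec (τ : Fin (ke + kx + 2) → ℝ) (z u : ModelCover ke kx) :
    modelForm (modelHamVec τ z) u = ∑ k, τ k * modelDiff z u k := by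
  rw [sum_idx, modelDiff_zero, modelDiff_one]
  simp only [modelDiff_ellIdx, modelDiff_actIdx, modelForm, stdForm, modelHamVec,
    Fintype.sum_sum_type, Fin.sum_univ_two, Sum.elim_inl, Sum.elim_inr, Matrix.cons_val_zero,
    Matrix.cons_val_one, Pi.zero_apply, zero_mul, sub_zero]
  have : ∑ j : Fin ke, (τ (ellIdx j) * z.2.1 (.inr j) * u.2.1 (.inr j) -
      -τ (ellIdx j) * z.1 (.inr j) * u.1 (.inr j)) = ∑ j : Fin ke, τ (ellIdx j) *
        (z.1 (.inr j) * u.1 (.inr j) + z.2.1 (.inr j) * u.2.1 (.inr j)) :=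
    Finset.sum_congr rfl fun j _ => by ring
  rw [this]
  ring

theorem modelDiff_modelHamVec (τ : Fin (ke + kx + 2) → ℝ) (z : ModelCover ke kx) :
    modelDiff z (modelHamVec τ z) = 0 := by
  refine funext (forall_idx ?_ ?_ (fun j => ?_) fun j => ?_)
  · rw [modelDiff_zero]; simp [modelHamVec]; ring
  · rw [modelDiff_one]; simp [modelHamVec]; ring
  · rw [modelDiff_ellIdx]; simp [modelHamVec]; ring
  · rw [modelDiff_actIdx]; simp [modelHamVec]

theorem contDiff_modelMap_coverMap :
    ContDiff ℝ ∞ fun z : ModelCover ke kx => modelMap (coverMap z) := by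
  refine contDiff_pi.2 (forall_idx ?_ ?_ (fun j => ?_) fun j => ?_)
  · simp only [modelMap_zero, coverMap]; fun_prop
  · simp only [modelMap_one, coverMap]; fun_prop
  · simp only [modelMap_ellIdx, coverMap]; fun_prop
  · simp only [modelMap_actIdx, coverMap]; fun_prop

theorem hasDerivAt_components {z : ℝ → ModelCover ke kx} {w : ModelCover ke kx} {t : ℝ}
    (h : HasDerivAt z w t) : (∀ i, HasDerivAt (fun s => (z s).1 i) (w.1 i) t) ∧
      (∀ i, HasDerivAt (fun s => (z s).2.1 i) (w.2.1 i) t) ∧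
      (∀ j, HasDerivAt (fun s => (z s).2.2.1 j) (w.2.2.1 j) t) ∧
      (∀ j, HasDerivAt (fun s => (z s).2.2.2 j) (w.2.2.2 j) t) := by
  have hfst : ∀ {E F : Type} [NormedAddCommGroup E] [NormedSpace ℝ E] [NormedAddCommGroup F]
      [NormedSpace ℝ F] {f : ℝ → E × F} {f' : E × F}, HasDerivAt f f' t →
      HasDerivAt (fun s => (f s).1) f'.1 t ∧ HasDerivAt (fun s => (f s).2) f'.2 t :=
    fun hf => ⟨hf.hasFDerivAt.fst.hasDerivAt.congr_deriv (by simp),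
      hf.hasFDerivAt.snd.hasDerivAt.congr_deriv (by simp)⟩
  obtain ⟨h1, h2⟩ := hfst h
  obtain ⟨h3, h4⟩ := hfst h2
  obtain ⟨h5, h6⟩ := hfst h4
  exact ⟨hasDerivAt_pi.1 h1, hasDerivAt_pi.1 h3, hasDerivAt_pi.1 h5, hasDerivAt_pi.1 h6⟩

theorem hasDerivAt_modelMap {z : ℝ → ModelCover ke kx} {w : ModelCover ke kx} {t : ℝ}
    (h : HasDerivAt z w t) :
    HasDerivAt (fun s => modelMap (coverMap (z s))) (modelDiff (z t) w) t := by
  obtain ⟨hx, hξ, -, hI⟩ := hasDerivAt_components h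
  refine hasDerivAt_pi.2 (forall_idx ?_ ?_ (fun j => ?_) fun j => ?_)
  · exact ((hx _).mul (hξ _)).add ((hx _).mul (hξ _))
  · exact ((hx _).mul (hξ _)).sub ((hx _).mul (hξ _))
  · simp only [modelMap_ellIdx, modelDiff_ellIdx, coverMap]
    refine ((((hx (.inr j)).pow 2).add ((hξ (.inr j)).pow 2)).div_const 2).congr_deriv ?_
    push_cast; ring
  · simp only [modelMap_actIdx, modelDiff_actIdx, coverMap]
    exact hI j

theorem fderiv_modelMap_coverMap (z u : ModelCover ke kx) :
    fderiv ℝ (fun z : ModelCover ke kx => modelMap (coverMap z)) z u = modelDiff z u := by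
  have hl : HasDerivAt (fun s : ℝ => z + s • u) u 0 := by
    simpa using ((hasDerivAt_id (0 : ℝ)).smul_const u).const_add z
  have h1 := hasDerivAt_modelMap hl
  have h2 := ((contDiff_modelMap_coverMap.differentiable (by simp))
      (z + (0 : ℝ) • u)).hasFDerivAt.comp_hasDerivAt
    (0 : ℝ) hl
  simpa using h2.unique h1

/-- The partial derivatives at `c` of a function of `n` variables. -/
def grad {n : ℕ} (g : (Fin n → ℝ) → ℝ) (c : Fin n → ℝ) (k : Fin n) : ℝ :=
    fderiv ℝ g c (Pi.single k 1)

theorem fderiv_eq_sum_grad {n : ℕ} (g : (Fin n → ℝ) → ℝ) (c v : Fin n → ℝ) :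
    fderiv ℝ g c v = ∑ k, grad g c k * v k := by
  conv_lhs => rw [pi_eq_sum_univ' v]
  rw [map_sum]
  refine Finset.sum_congr rfl fun k _ => ?_
  rw [map_smul, smul_eq_mul, mul_comm, grad]

/-- `Y` follows the Hamiltonian flow of the function with differential `∑ τₖ(q) dqₖ`, where `τ`
depends on the value of the momentum map. -/
def IsModelFlow (τ : (Fin (ke + kx + 2) → ℝ) → Fin (ke + kx + 2) → ℝ) (Y : ℝ → LinearModel ke kx) :
    Prop :=
  ∀ t₀, ∃ z : ℝ → ModelCover ke kx,
    HasDerivAt z (modelHamVec (τ (modelMap (Y t₀))) (z t₀)) t₀ ∧ ∀ᶠ t in nhds t₀,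
        coverMap (z t) = Y t

theorem IsModelFlow.modelMap_eq {τ : (Fin (ke + kx + 2) → ℝ) → Fin (ke + kx + 2) → ℝ}
    {Y : ℝ → LinearModel ke kx} (h : IsModelFlow τ Y) (t : ℝ) : modelMap (Y t) =
        modelMap (Y 0) := by
  have hd : ∀ t, HasDerivAt (fun t => modelMap (Y t)) 0 t := by
    intro t
    obtain ⟨z, hz, hzY⟩ := h t
    have := hasDerivAt_modelMap hz
    rw [modelDiff_modelHamVec] at this
    exact this.congr_of_eventuallyEq (hzY.mono fun s hs => by simp only [hs])
  exact is_const_of_deriv_eq_zero (fun t => (hd t).differentiableAt) (fun t => (hd t).deriv) t 0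

theorem eq_cexp_of_hasDerivAt {u : ℝ → ℂ} {l : ℂ} (h : ∀ t, HasDerivAt u (l * u t) t) (t : ℝ) :
    u t = Complex.exp (t * l) * u 0 := by
  have hd : ∀ t : ℝ, HasDerivAt (fun t : ℝ => Complex.exp (-(t * l)) * u t) 0 t := by
    intro t
    have h1 : HasDerivAt (fun t : ℝ => Complex.exp (-(t * l)))
        (Complex.exp (-(t * l)) * (-l)) t := by
      have := ((Complex.ofRealCLM.hasDerivAt (x := t)).mul_const l).neg.cexp
      simpa using this
    refine (h1.mul (h t)).congr_deriv ?_
    ring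
  have := is_const_of_deriv_eq_zero (fun t => (hd t).differentiableAt) (fun t => (hd t).deriv) t 0
  simp only [Complex.ofReal_zero, zero_mul, neg_zero, Complex.exp_zero, one_mul] at this
  rw [← this, ← mul_assoc, ← Complex.exp_add, add_neg_cancel, Complex.exp_zero, one_mul]

/-- The explicit form of a Hamiltonian flow in the linear model, in complex coordinates. -/
theorem IsModelFlow.explicit {τ : (Fin (ke + kx + 2) → ℝ) → Fin (ke + kx + 2) → ℝ}
    {Y : ℝ → LinearModel ke kx} (h : IsModelFlow τ Y) {a : Fin (ke + kx + 2) → ℝ}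
    (ha : τ (modelMap (Y 0)) = a) (t : ℝ) :
    ((Y t).1 (.inl 0) + (Y t).1 (.inl 1) * Complex.I : ℂ) =
      Complex.exp (t * (a 0 + a 1 * Complex.I)) * ((Y 0).1 (.inl 0) +
          (Y 0).1 (.inl 1) * Complex.I) ∧
    ((Y t).2.1 (.inl 0) + (Y t).2.1 (.inl 1) * Complex.I : ℂ) =
      Complex.exp (t * (-a 0 + a 1 * Complex.I)) *
        ((Y 0).2.1 (.inl 0) + (Y 0).2.1 (.inl 1) * Complex.I) ∧
    (∀ j, ((Y t).1 (.inr j) + (Y t).2.1 (.inr j) * Complex.I : ℂ) =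
      Complex.exp (t * (-(a (ellIdx j) * Complex.I))) *
        ((Y 0).1 (.inr j) + (Y 0).2.1 (.inr j) * Complex.I)) ∧
    (∀ j, (AddCircle.toCircle ((Y t).2.2.1 j) : ℂ) =
      Complex.exp (t * (a (actIdx j) * Complex.I)) * AddCircle.toCircle ((Y 0).2.2.1 j)) ∧
    (Y t).2.2.2 = (Y 0).2.2.2 := by
  have hz : ∀ t₀, ∃ z : ℝ → ModelCover ke kx, HasDerivAt z (modelHamVec a (z t₀)) t₀ ∧
      ∀ᶠ t in nhds t₀, coverMap (z t) = Y t := by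
    intro t₀
    have := h t₀
    rwa [h.modelMap_eq t₀, ha] at this
  have hreal : ∀ {u v : ℝ → ℝ} {u' v' s : ℝ}, HasDerivAt u u' s → HasDerivAt v v' s →
      HasDerivAt (fun s => (u s + v s * Complex.I : ℂ)) (u' + v' * Complex.I) s := fun hu hv =>
    hu.ofReal_comp.add (hv.ofReal_comp.mul_const _)
  have hx : ∀ t i, HasDerivAt (fun t => (Y t).1 i) ((modelHamVec a ((Y t).1, (Y t).2.1, 0, 0)).1
      i) t := by
    intro t i
    obtain ⟨z, hz, hzY⟩ := hz t
    have e := hzY.self_of_nhds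
    rw [← e]
    exact ((hasDerivAt_components hz).1 i).congr_of_eventuallyEq (hzY.mono fun s hs => by
      simp only [← hs, coverMap])
  have hξ : ∀ t i, HasDerivAt (fun t => (Y t).2.1 i)
      ((modelHamVec a ((Y t).1, (Y t).2.1, 0, 0)).2.1 i) t := by
    intro t i
    obtain ⟨z, hz, hzY⟩ := hz t
    have e := hzY.self_of_nhds
    rw [← e]
    exact ((hasDerivAt_components hz).2.1 i).congr_of_eventuallyEq (hzY.mono fun s hs => by
      simp only [← hs, coverMap])
  refine ⟨?_, ?_, fun j => ?_, fun j => ?_, ?_⟩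
  · refine eq_cexp_of_hasDerivAt (u := fun t =>
      ((Y t).1 (.inl 0) + (Y t).1 (.inl 1) * Complex.I : ℂ))
      (fun t => (hreal (hx t _) (hx t _)).congr_deriv ?_) t
    simp only [modelHamVec, Sum.elim_inl, Matrix.cons_val_zero, Matrix.cons_val_one]
    push_cast
    linear_combination (-(a 1 : ℂ) * (Y t).1 (.inl 1)) * Complex.I_sq
  · refine eq_cexp_of_hasDerivAt (u := fun t =>
      ((Y t).2.1 (.inl 0) + (Y t).2.1 (.inl 1) * Complex.I : ℂ))
      (fun t => (hreal (hξ t _) (hξ t _)).congr_deriv ?_) t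
    simp only [modelHamVec, Sum.elim_inl, Matrix.cons_val_zero, Matrix.cons_val_one]
    push_cast
    linear_combination (-(a 1 : ℂ) * (Y t).2.1 (.inl 1)) * Complex.I_sq
  · refine eq_cexp_of_hasDerivAt (u := fun t =>
      ((Y t).1 (.inr j) + (Y t).2.1 (.inr j) * Complex.I : ℂ))
      (fun t => (hreal (hx t _) (hξ t _)).congr_deriv ?_) t
    simp only [modelHamVec, Sum.elim_inr]
    push_cast
    linear_combination ((a (ellIdx j) : ℂ) * (Y t).2.1 (.inr j)) * Complex.I_sq
  · refine eq_cexp_of_hasDerivAt (u := fun t => (AddCircle.toCircle ((Y t).2.2.1 j) : ℂ))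
      (fun t => ?_) t
    obtain ⟨z, hz, hzY⟩ := hz t
    have hcirc : ∀ x : ℝ, (AddCircle.toCircle (x : AddCircle (2 * Real.pi)) : ℂ) =
        Complex.exp (x * Complex.I) := by
      intro x
      rw [AddCircle.toCircle_apply_mk, div_self (by positivity), one_mul, Circle.coe_exp]
    have e := hzY.self_of_nhds
    have h1 := (((hasDerivAt_components hz).2.2.1 j).ofReal_comp.mul_const Complex.I).cexp
    have h2 : HasDerivAt (fun t => (AddCircle.toCircle ((Y t).2.2.1 j) : ℂ)) _ t :=
      h1.congr_of_eventuallyEq (hzY.mono fun s hs => by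
        simp only [← hs, coverMap, hcirc])
    refine h2.congr_deriv ?_
    rw [← e]
    simp only [coverMap, hcirc, modelHamVec]
    ring
  · have hI : ∀ t, HasDerivAt (fun t => (Y t).2.2.2) 0 t := by
      intro t
      refine hasDerivAt_pi.2 fun j => ?_
      obtain ⟨z, hz, hzY⟩ := hz t
      exact ((hasDerivAt_components hz).2.2.2 j).congr_of_eventuallyEq (hzY.mono fun s hs => by
        simp only [← hs, coverMap])
    exact is_const_of_deriv_eq_zero (fun t => (hI t).differentiableAt) (fun t => (hI t).deriv) t 0

variable {M : Type*} [TopologicalSpace M]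
  [ChartedSpace (EuclideanSpace ℝ (Fin (2 * (ke + kx + 2)))) M]
  {Ω : SymplecticForm (ke + kx + 2) M} {φ : OpenPartialHomeomorph M (LinearModel ke kx)}

theorem modelForm_sub_left (u u' v : ModelCover ke kx) :
    modelForm (u - u') v = modelForm u v - modelForm u' v := by
  simp only [modelForm, stdForm, Prod.fst_sub, Prod.snd_sub, Pi.sub_apply, sub_mul,
    Finset.sum_sub_distrib]
  ring

theorem fderiv_comp_modelMap_coverMap {g : (Fin (ke + kx + 2) → ℝ) → ℝ} (hg : Differentiable ℝ g)
    (z u : ModelCover ke kx) : fderiv ℝ (fun z => g (modelMap (coverMap z))) z u =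
      ∑ k, grad g (modelMap (coverMap z)) k * modelDiff z u k := by
  have h := fderiv_comp z (hg (modelMap (coverMap z)))
    ((contDiff_modelMap_coverMap.differentiable (by simp)) z)
  rw [show (fun z => g (modelMap (coverMap z))) = g ∘ fun z : ModelCover ke kx =>
      modelMap (coverMap z)
    from rfl, h, ContinuousLinearMap.comp_apply, fderiv_modelMap_coverMap, fderiv_eq_sum_grad]

/-- Where `f` is a function `g` of the momentum map of the linear model, its Hamiltonian flow is
read in the linear model as the Hamiltonian flow of `g`. -/
theorem IsSymplecto.isModelFlow (hφ : IsSymplecto Ω φ) {f : M → ℝ}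
    (hf : MDifferentiable (𝓡 (2 * (ke + kx + 2))) 𝓘(ℝ, ℝ) f) {g : (Fin (ke + kx + 2) → ℝ) → ℝ}
    (hg : Differentiable ℝ g) {r : ℝ} (hr : tube ke kx r ⊆ φ.target)
    (hfg : ∀ y ∈ tube ke kx r, f (φ.symm y) = g (modelMap y)) {γ : ℝ → M}
    (hγ : IsMIntegralCurve (I := 𝓡 (2 * (ke + kx + 2))) γ (hamVF Ω f))
    (hmem : ∀ t, γ t ∈ φ.source ∧ φ (γ t) ∈ tube ke kx r) :
    IsModelFlow (grad g) fun t => φ (γ t) := by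
  intro t₀
  obtain ⟨z₀, hz₀⟩ := coverMap_surjective (φ (γ t₀))
  have hz₀d : z₀ ∈ paramDomain φ := by
    change coverMap z₀ ∈ φ.target
    rw [hz₀]; exact hr (hmem t₀).2
  have hp : param φ z₀ = γ t₀ := by rw [param, hz₀, φ.left_inv (hmem t₀).1]
  obtain ⟨z, w, hz, hzw, hw, hev⟩ := hφ.exists_lift hz₀d hp (hγ t₀).1
    (hasDerivAt_chart_comp (hγ t₀))
  refine ⟨z, ?_, hev⟩
  have hw' : paramDeriv φ z₀ w = hamVF Ω f (param φ z₀) := by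
    rw [hw]
    exact congrArg (fun p => (hamVF Ω f p : EuclideanSpace ℝ (Fin (2 * (ke + kx + 2))))) hp.symm
  have heq : w = modelHamVec (grad g (modelMap (φ (γ t₀)))) z₀ := by
    refine sub_eq_zero.1 (modelForm_nondegenerate fun u => ?_)
    rw [modelForm_sub_left, modelForm_modelHamVec, hφ.modelForm_eq_fderiv hz₀d (hf _) hw',
        sub_eq_zero,
      ← hz₀, ← fderiv_comp_modelMap_coverMap hg]
    have : f ∘ param φ =ᶠ[nhds z₀] fun z => g (modelMap (coverMap z)) := by
      have hz₀t : z₀ ∈ coverMap ⁻¹' tube ke kx r := by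
        change coverMap z₀ ∈ tube ke kx r; rw [hz₀]; exact (hmem t₀).2
      filter_upwards [((isOpen_tube r).preimage continuous_coverMap).mem_nhds hz₀t] with z hz
        using hfg _ hz
    rw [this.fderiv_eq]
  rw [hz, ← heq]
  exact hzw

end Flow

/-! ### The torus action near the critical orbit -/

section Torus

theorem exists_coe_mem_Icc {d : ℕ} (s : Fin d → AddCircle (2 * Real.pi)) :
    ∃ t : Fin d → ℝ, (∀ i, t i ∈ Set.Icc 0 (2 * Real.pi)) ∧ ∀ i, (t i : AddCircle (2 * Real.pi))
        = s i := by
  have : Fact (0 < 2 * Real.pi) := ⟨by positivity⟩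
  have h : ∀ i, ∃ t ∈ Set.Icc (0 : ℝ) (2 * Real.pi), (t : AddCircle (2 * Real.pi)) = s i := by
    intro i
    have : s i ∈ (QuotientAddGroup.mk : ℝ → AddCircle (2 * Real.pi)) '' Set.Icc 0
        (0 + 2 * Real.pi) := by
      rw [AddCircle.coe_image_Icc_eq]; trivial
    obtain ⟨t, ht, h⟩ := this
    exact ⟨t, by simpa using ht, h⟩
  choose t ht h using h
  exact ⟨t, ht, h⟩

/-- The `2π`-periodic flows of the last `d` components of `F` form the torus action `ρ`. -/
structure IsTorusAction {d : ℕ} {M : Type*} [TopologicalSpace M]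
    [ChartedSpace (EuclideanSpace ℝ (Fin (2 * (d + 1)))) M]
    (Ω : SymplecticForm (d + 1) M) (F : M → Fin (d + 1) → ℝ)
    (ρ : (Fin d → AddCircle (2 * Real.pi)) → M → M) : Prop where
  zero : ∀ p, ρ 0 p = p
  add : ∀ s t p, ρ (s + t) p = ρ s (ρ t p)
  smooth : ContMDiff (𝓘(ℝ, Fin d → ℝ).prod (𝓡 (2 * (d + 1)))) (𝓡 (2 * (d + 1))) ∞
    (fun z : (Fin d → ℝ) × M => ρ (fun i => (z.1 i : AddCircle (2 * Real.pi))) z.2)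
  flow : ∀ (i : Fin d) (p : M), IsMIntegralCurve (I := 𝓡 (2 * (d + 1)))
    (fun t : ℝ => ρ (Pi.single i (t : AddCircle (2 * Real.pi))) p) (hamVF Ω fun q => F q i.succ)

variable {d : ℕ} {M : Type*} [TopologicalSpace M]
    [ChartedSpace (EuclideanSpace ℝ (Fin (2 * (d + 1)))) M]
    {Ω : SymplecticForm (d + 1) M} {F : M → Fin (d + 1) → ℝ}
    {ρ : (Fin d → AddCircle (2 * Real.pi)) → M → M}

/-- Adding an angle to a torus element amounts to composing with the corresponding flow. -/
theorem IsTorusAction.sum_insert (hρ : IsTorusAction Ω F ρ) (t : Fin d → ℝ) (p : M) {i : Fin d}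
    {S : Finset (Fin d)} (hi : i ∉ S) :
    ρ (∑ j ∈ insert i S, Pi.single j (t j : AddCircle (2 * Real.pi))) p =
      ρ (Pi.single i (t i : AddCircle (2 * Real.pi)))
        (ρ (∑ j ∈ S, Pi.single j (t j : AddCircle (2 * Real.pi))) p) := by
  rw [Finset.sum_insert hi, hρ.add]

theorem IsTorusAction.mem_poissonOrbit (hρ : IsTorusAction Ω F ρ) (m : M)
    (s : Fin d → AddCircle (2 * Real.pi)) : ρ s m ∈ poissonOrbit Ω F m := by
  obtain ⟨t, -, ht⟩ := exists_coe_mem_Icc s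
  have key : ∀ S : Finset (Fin d), ρ (∑ j ∈ S, Pi.single j (t j : AddCircle (2 * Real.pi))) m ∈
      poissonOrbit Ω F m := by
    intro S
    induction S using Finset.induction_on with
    | empty =>
      rw [Finset.sum_empty, hρ.zero]
      exact Relation.ReflTransGen.refl
    | insert i S hi ih =>
      rw [hρ.sum_insert t m hi]
      refine Relation.ReflTransGen.tail ih ⟨i.succ, _, 0, t i,
        (hρ.flow i (ρ (∑ j ∈ S, Pi.single j (t j : AddCircle (2 * Real.pi)))
            m)).isMIntegralCurveOn _,
        ?_, rfl⟩
      simp [hρ.zero]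
  have := key Finset.univ
  rwa [Finset.univ_sum_single, funext ht] at this

/-- The points whose torus orbit stays in an open set form a neighbourhood, by compactness. -/
theorem IsTorusAction.eventually_mem (hρ : IsTorusAction Ω F ρ) {m : M} {U : Set M} (hU : IsOpen U)
    (h : ∀ s, ρ s m ∈ U) : ∀ᶠ p in nhds m, ∀ s, ρ s p ∈ U := by
  have hK : IsCompact (Set.univ.pi fun _ : Fin d => Set.Icc (0 : ℝ) (2 * Real.pi)) :=
    isCompact_univ_pi fun _ => isCompact_Icc
  obtain ⟨u, v, -, hv, hKu, hmv, huv⟩ := generalized_tube_lemma hK (isCompact_singleton (x := m))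
    (hU.preimage hρ.smooth.continuous) (by
      rintro ⟨t, p⟩ ⟨-, hp⟩
      rw [Set.mem_singleton_iff] at hp
      subst hp
      exact h _)
  filter_upwards [hv.mem_nhds (hmv rfl)] with p hp s
  obtain ⟨t, ht, hts⟩ := exists_coe_mem_Icc s
  have : (t, p) ∈ u ×ˢ v := ⟨hKu fun i _ => ht i, hp⟩
  have := huv this
  simp only [Set.mem_preimage, hts] at this
  exact this

end Torus

/-! ### Integrality of the frequencies -/

section Integrality

variable {ke kx : ℕ} {M : Type*} [TopologicalSpace M]
  [ChartedSpace (EuclideanSpace ℝ (Fin (2 * (ke + kx + 2)))) M]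

/-- Near the zero-torus, `F` is a smooth function `G` of the momentum map of the linear model; the
last components of `F` generate the torus action `ρ`. -/
structure IsLocalModel (Ω : SymplecticForm (ke + kx + 2) M) (F : M → Fin (ke + kx + 2) → ℝ)
    (φ : OpenPartialHomeomorph M (LinearModel ke kx))
    (ρ : (Fin (ke + kx + 1) → AddCircle (2 * Real.pi)) → M → M)
    (G : (Fin (ke + kx + 2) → ℝ) → Fin (ke + kx + 2) → ℝ) (r : ℝ) : Prop where
  symplecto : IsSymplecto Ω φ
  smooth_F : ContMDiff (𝓡 (2 * (ke + kx + 2))) 𝓘(ℝ, Fin (ke + kx + 2) → ℝ) ∞ F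
  action : IsTorusAction (d := ke + kx + 1) Ω F ρ
  smooth_G : ContDiff ℝ ∞ G
  tube_subset : tube ke kx r ⊆ φ.target
  eq : ∀ y ∈ tube ke kx r, F (φ.symm y) = G (modelMap y)

/-- The set of points whose orbit under `ρ` stays in the tube of radius `r`. -/
def orbitTube (φ : OpenPartialHomeomorph M (LinearModel ke kx))
    (ρ : (Fin (ke + kx + 1) → AddCircle (2 * Real.pi)) → M → M) (r : ℝ) : Set M :=
  {p | ∀ s, ρ s p ∈ φ.source ∧ φ (ρ s p) ∈ tube ke kx r}

variable {Ω : SymplecticForm (ke + kx + 2) M} {F : M → Fin (ke + kx + 2) → ℝ}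
  {φ : OpenPartialHomeomorph M (LinearModel ke kx)}
  {ρ : (Fin (ke + kx + 1) → AddCircle (2 * Real.pi)) → M → M}
  {G : (Fin (ke + kx + 2) → ℝ) → Fin (ke + kx + 2) → ℝ} {r : ℝ}

theorem IsLocalModel.differentiable_G (h : IsLocalModel Ω F φ ρ G r) (i : Fin (ke + kx + 2)) :
    Differentiable ℝ fun c => G c i :=
  (contDiff_pi.1 h.smooth_G i).differentiable (by simp)

theorem IsLocalModel.apply_mem_orbitTube (h : IsLocalModel Ω F φ ρ G r) {p : M}
    (hp : p ∈ orbitTube φ ρ r) (s : Fin (ke + kx + 1) → AddCircle (2 * Real.pi)) :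
    ρ s p ∈ orbitTube φ ρ r := fun t => by
  rw [← h.action.add]
  exact hp _

theorem IsLocalModel.isModelFlow (h : IsLocalModel Ω F φ ρ G r) {p : M}
    (hp : p ∈ orbitTube φ ρ r) (i : Fin (ke + kx + 1)) :
    IsModelFlow (grad fun c => G c i.succ)
      (fun t : ℝ => φ (ρ (Pi.single i (t : AddCircle (2 * Real.pi))) p)) := by
  refine h.symplecto.isModelFlow (f := fun q => F q i.succ) ?_ (h.differentiable_G i.succ)
      h.tube_subset
    (fun y hy => congrFun (h.eq y hy) i.succ) (h.action.flow i p) fun t => hp _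
  have := contMDiff_pi_space.1 h.smooth_F i.succ
  exact this.mdifferentiable (by simp)

theorem int_of_cexp_mul_eq {u l : ℂ} (hu : u ≠ 0)
    (h : u = Complex.exp (((2 * Real.pi : ℝ) : ℂ) * l) * u) : ∃ n : ℤ, l = n * Complex.I := by
  have h1 : Complex.exp (((2 * Real.pi : ℝ) : ℂ) * l) = 1 :=
    mul_right_cancel₀ hu (by rw [one_mul]; exact h.symm)
  obtain ⟨n, hn⟩ := Complex.exp_eq_one_iff.1 h1
  refine ⟨n, ?_⟩
  have hpi : ((2 * Real.pi : ℝ) : ℂ) ≠ 0 := by exact_mod_cast (by positivity : (2 * Real.pi) ≠ 0)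
  refine mul_left_cancel₀ hpi ?_
  rw [hn]; push_cast; ring

/-- At a point where the torus action of the linear model is free and the focus-focus component is
not on its stable manifold, the periodicity of the flow of `F_{i+1}` forces its frequencies: that of
`q₁`, whose flow is hyperbolic, is zero and the others are integers. -/
theorem IsLocalModel.grad_int_of_generic (h : IsLocalModel Ω F φ ρ G r) {p : M}
    (hp : p ∈ orbitTube φ ρ r) (h0 : (φ p).1 (.inl 0) ≠ 0) (he : ∀ j, (φ p).1 (.inr j) ≠ 0)
    (i : Fin (ke + kx + 1)) :
    grad (fun c => G c i.succ) (modelMap (φ p)) 0 = 0 ∧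
      ∀ k : Fin (ke + kx + 1), ∃ n : ℤ, grad (fun c => G c i.succ) (modelMap (φ p)) k.succ = n := by
  have hflow := h.isModelFlow hp i
  set a := grad (fun c => G c i.succ) (modelMap (φ p)) with ha
  have hY0 : φ (ρ (Pi.single i ((0 : ℝ) : AddCircle (2 * Real.pi))) p) = φ p := by
    simp [h.action.zero]
  have hYT : φ (ρ (Pi.single i ((2 * Real.pi : ℝ) : AddCircle (2 * Real.pi))) p) = φ p := by
    rw [AddCircle.coe_period]; simp [h.action.zero]
  obtain ⟨e1, -, e3, e4, -⟩ := hflow.explicit (a := a) (by rw [hY0]) (2 * Real.pi)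
  simp only [hY0, hYT] at e1 e3 e4
  have hne : ∀ {x y : ℝ}, x ≠ 0 → (x + y * Complex.I : ℂ) ≠ 0 := fun hx h => hx (by
    simpa using congrArg Complex.re h)
  obtain ⟨n, hn⟩ := int_of_cexp_mul_eq (hne h0) e1
  have hn0 : a 0 = 0 := by simpa using congrArg Complex.re hn
  have hn1 : a 1 = n := by simpa using congrArg Complex.im hn
  refine ⟨hn0, forall_idx_succ ⟨n, hn1⟩ (fun j => ?_) fun j => ?_⟩
  · obtain ⟨n, hn⟩ := int_of_cexp_mul_eq (hne (he j)) (e3 j)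
    refine ⟨-n, ?_⟩
    have := congrArg Complex.im hn
    simp at this
    push_cast
    change a (ellIdx j) = _
    linarith
  · obtain ⟨n, hn⟩ := int_of_cexp_mul_eq (Circle.coe_ne_zero _) (e4 j)
    refine ⟨n, ?_⟩
    have := congrArg Complex.im hn
    change a (actIdx j) = _
    simpa using this

/-- The frequencies are constant near a point of the zero-torus, by density and continuity. -/
theorem IsLocalModel.exists_int_matrix (h : IsLocalModel Ω F φ ρ G r) {z₀ : ModelCover ke kx}
    {δ : ℝ} (hB : ∀ z ∈ Metric.ball z₀ δ, z ∈ paramDomain φ ∧ param φ z ∈ orbitTube φ ρ r) :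
    ∃ A : Matrix (Fin (ke + kx + 1)) (Fin (ke + kx + 1)) ℤ, ∀ z ∈ Metric.ball z₀ δ, ∀ i,
      grad (fun c => G c i.succ) (modelMap (coverMap z)) 0 = 0 ∧
      ∀ k : Fin (ke + kx + 1), grad (fun c => G c i.succ) (modelMap (coverMap z)) k.succ =
          A i k := by
  have hcont : ∀ i k, Continuous fun z : ModelCover ke kx =>
      grad (fun c => G c i) (modelMap (coverMap z)) k := by
    intro i k
    have h1 : Continuous (fderiv ℝ fun c => G c i) :=
      (contDiff_pi.1 h.smooth_G i).continuous_fderiv (by simp)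
    exact (h1.comp contDiff_modelMap_coverMap.continuous).clm_apply continuous_const
  have hφz : ∀ z ∈ Metric.ball z₀ δ, φ (param φ z) = coverMap z := fun z hz =>
    φ.right_inv (hB z hz).1
  -- translating all `x`-coordinates by a small `ε > 0` makes them nonzero
  let T : ModelCover ke kx → ℝ → ModelCover ke kx := fun z ε => (fun i => z.1 i + ε, z.2)
  have hT : ∀ z, Filter.Tendsto (T z) (nhdsWithin 0 (Set.Ioi 0)) (nhds z) := by
    intro z
    have : Continuous (T z) := by
      refine Continuous.prodMk (continuous_pi fun i => ?_) continuous_const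
      fun_prop
    have h2 := this.tendsto 0
    have h3 : T z 0 = z := by simp [T]
    rw [h3] at h2
    exact h2.mono_left nhdsWithin_le_nhds
  have hgen : ∀ z ∈ Metric.ball z₀ δ, ∀ᶠ ε in nhdsWithin (0 : ℝ) (Set.Ioi 0),
      T z ε ∈ Metric.ball z₀ δ ∧ ∀ i, (T z ε).1 i ≠ 0 := by
    intro z hz
    refine ((hT z).eventually (Metric.isOpen_ball.mem_nhds hz)).and
      (Filter.eventually_all.2 fun i => ?_)
    rcases eq_or_ne (z.1 i) 0 with h0 | h0
    · filter_upwards [self_mem_nhdsWithin] with ε hε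
      simpa [T, h0] using ne_of_gt (Set.mem_Ioi.1 hε)
    · have hc : Filter.Tendsto (fun ε : ℝ => z.1 i + ε) (nhdsWithin 0 (Set.Ioi 0))
        (nhds (z.1 i)) := by
        have h1 : Continuous fun ε : ℝ => z.1 i + ε := by fun_prop
        have h2 := h1.tendsto 0
        rw [add_zero] at h2
        exact h2.mono_left nhdsWithin_le_nhds
      exact hc.eventually (isOpen_ne.mem_nhds h0)
  have hclosed : ∀ (i k) (S : Set ℝ), IsClosed S → (∀ z ∈ Metric.ball z₀ δ, (∀ i, z.1 i ≠ 0) →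
      grad (fun c => G c i) (modelMap (coverMap z)) k ∈ S) → ∀ z ∈ Metric.ball z₀ δ,
      grad (fun c => G c i) (modelMap (coverMap z)) k ∈ S := by
    intro i k S hS hdense z hz
    have hlim := ((hcont i k).tendsto z).comp (hT z)
    exact hS.mem_of_tendsto hlim ((hgen z hz).mono fun ε hε => hdense _ hε.1 hε.2)
  have hgeneric : ∀ z ∈ Metric.ball z₀ δ, (∀ i, z.1 i ≠ 0) → ∀ i : Fin (ke + kx + 1),
      grad (fun c => G c i.succ) (modelMap (coverMap z)) 0 = 0 ∧
      ∀ k : Fin (ke + kx + 1), ∃ n : ℤ,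
        grad (fun c => G c i.succ) (modelMap (coverMap z)) k.succ = n := by
    intro z hz hne i
    have := h.grad_int_of_generic (hB z hz).2 (by rw [hφz z hz]; exact hne _)
      (fun j => by rw [hφz z hz]; exact hne _) i
    rwa [hφz z hz] at this
  have hint : ∀ i k : Fin (ke + kx + 1), ∃ n : ℤ, ∀ z ∈ Metric.ball z₀ δ,
      grad (fun c => G c i.succ) (modelMap (coverMap z)) k.succ = n := by
    intro i k
    have hmaps : Set.MapsTo (fun z : ModelCover ke kx =>
        grad (fun c => G c i.succ) (modelMap (coverMap z)) k.succ) (Metric.ball z₀ δ)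
        (Set.range ((↑) : ℤ → ℝ)) := by
      refine hclosed i.succ k.succ _ Int.isClosedEmbedding_coe_real.isClosed_range ?_
      intro z hz hne
      obtain ⟨n, hn⟩ := (hgeneric z hz hne i).2 k
      exact ⟨n, hn.symm⟩
    have hdisc : IsDiscrete (Set.range ((↑) : ℤ → ℝ)) :=
      ⟨Int.isClosedEmbedding_coe_real.isEmbedding.toHomeomorph.symm.isEmbedding.discreteTopology⟩
    obtain ⟨_, ⟨n, rfl⟩, hn⟩ := (convex_ball z₀ δ).isPreconnected.eqOn_const_of_mapsTo hdisc
      (hcont i.succ k.succ).continuousOn hmaps ⟨_, 0, rfl⟩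
    exact ⟨n, hn⟩
  choose A hA using hint
  refine ⟨Matrix.of A, fun z hz i => ⟨?_, fun k => hA i k z hz⟩⟩
  exact hclosed i.succ 0 {0} isClosed_singleton (fun z hz hne => (hgeneric z hz hne i).1) z hz

/-- As their gradients are constant, the last components of `F` are affine functions of those of the
momentum map. -/
theorem IsLocalModel.eq_affine (h : IsLocalModel Ω F φ ρ G r) {z₀ : ModelCover ke kx}
    (hz₀ : modelMap (coverMap z₀) = 0) {δ : ℝ} (hδ : 0 < δ)
    {A : Matrix (Fin (ke + kx + 1)) (Fin (ke + kx + 1)) ℤ}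
    (hA : ∀ z ∈ Metric.ball z₀ δ, ∀ i,
      grad (fun c => G c i.succ) (modelMap (coverMap z)) 0 = 0 ∧
      ∀ k : Fin (ke + kx + 1), grad (fun c => G c i.succ) (modelMap (coverMap z)) k.succ = A i k) :
    ∀ z ∈ Metric.ball z₀ δ, ∀ i : Fin (ke + kx + 1), G (modelMap (coverMap z)) i.succ =
      ∑ k, (A i k : ℝ) * modelMap (coverMap z) k.succ + G 0 i.succ := by
  intro z hz i
  let g : (Fin (ke + kx + 2) → ℝ) → ℝ := fun c => G c i.succ - ∑ k, (A i k : ℝ) * c k.succ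
  let L : (Fin (ke + kx + 2) → ℝ) →L[ℝ] ℝ :=
    ∑ k : Fin (ke + kx + 1), (A i k : ℝ) • ContinuousLinearMap.proj (R := ℝ)
        (φ := fun _ => ℝ) k.succ
  have hL : ∀ c, L c = ∑ k : Fin (ke + kx + 1), (A i k : ℝ) * c k.succ := fun c => by
    simp [L]
  have hgd : Differentiable ℝ g := (h.differentiable_G i.succ).sub (by fun_prop)
  have hgrad : ∀ z ∈ Metric.ball z₀ δ, grad g (modelMap (coverMap z)) = 0 := by
    intro z hz
    funext k
    have h1 : fderiv ℝ g (modelMap (coverMap z)) =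
        fderiv ℝ (fun c => G c i.succ) (modelMap (coverMap z)) - L := by
      have : g = (fun c => G c i.succ) - ⇑L := by
        funext c; simp only [g, Pi.sub_apply, hL]
      rw [this, fderiv_sub (h.differentiable_G i.succ _) L.differentiableAt, L.fderiv]
    rw [grad, h1, sub_apply, hL, Pi.zero_apply, sub_eq_zero]
    refine Fin.cases ?_ (fun k => ?_) k
    · refine ((hA z hz i).1).trans (Finset.sum_eq_zero fun k _ => ?_).symm
      rw [Pi.single_eq_of_ne (Fin.succ_ne_zero k), mul_zero]
    · refine ((hA z hz i).2 k).trans ?_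
      rw [Finset.sum_eq_single k]
      · simp
      · intro l _ hl
        rw [Pi.single_eq_of_ne (fun e => hl (Fin.succ_injective _ e)), mul_zero]
      · simp
  have hd : Differentiable ℝ fun z : ModelCover ke kx => g (modelMap (coverMap z)) :=
    hgd.comp (contDiff_modelMap_coverMap.differentiable (by simp))
  have hconst := Metric.isOpen_ball.is_const_of_fderiv_eq_zero (𝕜 := ℝ)
    (convex_ball z₀ δ).isPreconnected hd.differentiableOn (fun z hz => by
      refine ContinuousLinearMap.ext fun u => ?_
      rw [fderiv_comp_modelMap_coverMap hgd, hgrad z hz]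
      simp) hz (Metric.mem_ball_self hδ)
  simp only [g, hz₀, Pi.zero_apply, mul_zero, Finset.sum_const_zero] at hconst
  linarith

end Integrality

/-! ### Smooth maps of finite order -/

section FiniteOrder

variable {k : ℕ} {M : Type*} [TopologicalSpace M] [ChartedSpace (EuclideanSpace ℝ (Fin k)) M]

theorem contDiffAt_chart_conj {h : M → M} (hh : ContMDiff (𝓡 k) (𝓡 k) ∞ h) {p : M} (hp : h p = p) :
    ContDiffAt ℝ ∞ (chartAt (EuclideanSpace ℝ (Fin k)) p ∘ h ∘
      (chartAt (EuclideanSpace ℝ (Fin k)) p).symm) (chartAt (EuclideanSpace ℝ (Fin k)) p p) := by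
  have := ((contMDiffAt_iff (I := 𝓡 k) (I' := 𝓡 k) (f := h) (x := p)).1 (hh p)).2
  simp only [hp, mfld_simps, contDiffWithinAt_univ] at this
  exact this

/-- A smooth map that is the identity near the points of a set has the identity as its differential
at the fixed points in the closure of this set. -/
theorem fderiv_chart_conj_eq_id {h : M → M} (hh : ContMDiff (𝓡 k) (𝓡 k) ∞ h) {p : M} (hp : h p = p)
    {S : Set M} (hS : ∀ q ∈ S, h =ᶠ[nhds q] id) (hpS : p ∈ closure S) :
    fderiv ℝ (chartAt (EuclideanSpace ℝ (Fin k)) p ∘ h ∘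
        (chartAt (EuclideanSpace ℝ (Fin k)) p).symm)
      (chartAt (EuclideanSpace ℝ (Fin k)) p p) = ContinuousLinearMap.id ℝ _ := by
  set c := chartAt (EuclideanSpace ℝ (Fin k)) p with hc
  have hps : p ∈ c.source := mem_chart_source _ p
  have hcd := contDiffAt_chart_conj hh hp
  have hcont : ContinuousAt (fderiv ℝ (c ∘ h ∘ c.symm)) (c p) :=
    (hcd.fderiv_right (m := 0) (by simp)).continuousAt
  have hlim : ContinuousAt (fun q => fderiv ℝ (c ∘ h ∘ c.symm) (c q)) p :=
    ContinuousAt.comp (g := fderiv ℝ (c ∘ h ∘ c.symm)) hcont (c.continuousAt hps)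
  have hval : ∀ q ∈ S ∩ c.source, fderiv ℝ (c ∘ h ∘ c.symm) (c q) = ContinuousLinearMap.id ℝ _ := by
    rintro q ⟨hq, hqs⟩
    have hsymm : Filter.Tendsto c.symm (nhds (c q)) (nhds q) := by
      have := c.continuousAt_symm (c.map_source hqs)
      rwa [ContinuousAt, c.left_inv hqs] at this
    have : c ∘ h ∘ c.symm =ᶠ[nhds (c q)] id := by
      filter_upwards [hsymm.eventually (hS q hq), c.open_target.mem_nhds (c.map_source hqs)]
          with x h1 h2
      simp only [Function.comp_apply, h1, id, c.right_inv h2]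
    rw [this.fderiv_eq, fderiv_id]
  have hpS' : p ∈ closure (S ∩ c.source) := by
    rw [Set.inter_comm]
    exact c.open_source.inter_closure ⟨hps, hpS⟩
  have := mem_closure_iff_nhdsWithin_neBot.1 hpS'
  refine tendsto_nhds_unique (hlim.tendsto.mono_left nhdsWithin_le_nhds) ?_
      (l := nhdsWithin p (S ∩ c.source))
  refine (tendsto_const_nhds).congr' ?_
  filter_upwards [self_mem_nhdsWithin] with q hq using (hval q hq).symm

/-- A smooth map of finite order `N` of a connected manifold that is the identity on a nonempty open
set is the identity. Near a limit of this set, the sum `Λ` over the iterates (in a chart) is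
invariant and has differential `N • id`, hence is injective. -/
theorem eq_id_of_iterate_eq_id [T2Space M] [ConnectedSpace M] {g : M → M}
    (hg : ContMDiff (𝓡 k) (𝓡 k) ∞ g) {N : ℕ} (hN : 0 < N) (hgN : g^[N] = id) {m : M}
    (hm : g =ᶠ[nhds m] id) : g = id := by
  let S : Set M := {p | g =ᶠ[nhds p] id}
  have hopen : IsOpen S := isOpen_iff_mem_nhds.2 fun p hp => hp.eventuallyEq_nhds
  have hfix : ∀ p ∈ S, g p = p := fun p hp => hp.self_of_nhds
  have hiter : ∀ j, ContMDiff (𝓡 k) (𝓡 k) ∞ g^[j] := by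
    intro j
    induction j with
    | zero => exact contMDiff_id
    | succ j ih => exact ih.comp hg
  have hiterS : ∀ j, ∀ q ∈ S, g^[j] =ᶠ[nhds q] id := by
    intro j q hq
    induction j with
    | zero => exact Filter.EventuallyEq.rfl
    | succ j ih =>
      filter_upwards [hq, ih] with x h1 h2
      rw [Function.iterate_succ_apply, h1, id, h2, id]
  have hclosed : IsClosed S := by
    refine isClosed_of_closure_subset fun p hp => ?_
    have hgp : g p = p := by
      have hcl : IsClosed {q | g q = q} := isClosed_eq hg.continuous continuous_id
      exact hcl.closure_subset_iff.2 hfix hp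
    have hgjp : ∀ j, g^[j] p = p := fun j => Function.iterate_fixed hgp j
    set c := chartAt (EuclideanSpace ℝ (Fin k)) p with hc
    have hps : p ∈ c.source := mem_chart_source _ p
    let Λ : EuclideanSpace ℝ (Fin k) → EuclideanSpace ℝ (Fin k) := fun x =>
      ∑ j ∈ Finset.range N, (c ∘ g^[j] ∘ c.symm) x
    have hstr : HasStrictFDerivAt Λ
        (((ContinuousLinearEquiv.smulLeft (Units.mk0 (N : ℝ) (by positivity)) :
          EuclideanSpace ℝ (Fin k) ≃L[ℝ] EuclideanSpace ℝ (Fin k)) :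
          EuclideanSpace ℝ (Fin k) →L[ℝ] EuclideanSpace ℝ (Fin k))) (c p) := by
      have h1 : HasStrictFDerivAt Λ (∑ j ∈ Finset.range N, ContinuousLinearMap.id ℝ
          (EuclideanSpace ℝ (Fin k))) (c p) := by
        refine HasStrictFDerivAt.fun_sum fun j _ => ?_
        have := (contDiffAt_chart_conj (hiter j) (hgjp j)).hasStrictFDerivAt (by simp)
        rwa [fderiv_chart_conj_eq_id (hiter j) (hgjp j) (hiterS j) hp] at this
      refine h1.congr_fderiv ?_
      refine ContinuousLinearMap.ext fun u => ?_
      simp only [Finset.sum_const, Finset.card_range]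
      exact (Nat.cast_smul_eq_nsmul ℝ N u).symm
    have hinj := (hstr.toOpenPartialHomeomorph Λ).injOn
    have hsrc := (hstr.toOpenPartialHomeomorph Λ).open_source.mem_nhds
        hstr.mem_toOpenPartialHomeomorph_source
    have hcp : Filter.Tendsto c (nhds p) (nhds (c p)) := c.continuousAt hps
    have hgt : Filter.Tendsto g (nhds p) (nhds p) := by
      have := hg.continuous.tendsto p
      rwa [hgp] at this
    have hsp := c.open_source.mem_nhds hps
    filter_upwards [hcp.eventually hsrc, (hcp.comp hgt).eventually hsrc, hsp, hgt.eventually hsp]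
      with q h1 h2 h3 h4
    have hΛ : Λ (c (g q)) = Λ (c q) := by
      simp only [Λ, Function.comp_apply, c.left_inv h3, c.left_inv h4,
          ← Function.iterate_succ_apply]
      have e1 := Finset.sum_range_succ (fun j => c (g^[j] q)) N
      have e2 := Finset.sum_range_succ' (fun j => c (g^[j] q)) N
      rw [e1, hgN] at e2
      exact (add_right_cancel e2).symm
    exact c.injOn h4 h3 (hinj h2 h1 hΛ)
  have huniv : S = Set.univ := IsClopen.eq_univ ⟨hclosed, hopen⟩ ⟨m, hm⟩
  funext p
  exact hfix p (huniv ▸ Set.mem_univ p)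

end FiniteOrder

/-! ### Effectiveness of the torus action -/

section Effective

variable {ke kx : ℕ}

theorem torusRot_torusRot (a b : Fin (ke + kx + 1) → ℝ) (y : LinearModel ke kx) :
    torusRot a (torusRot b y) = torusRot (a + b) y := by
  refine Prod.ext ?_ (Prod.ext ?_ (Prod.ext ?_ rfl))
  · funext i
    rcases i with i | j
    · fin_cases i <;> · simp [torusRot, Real.cos_add, Real.sin_add]; ring
    · simp [torusRot, Real.cos_add, Real.sin_add]; ring
  · funext i
    rcases i with i | j
    · fin_cases i <;> · simp [torusRot, Real.cos_add, Real.sin_add]; ring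
    · simp [torusRot, Real.cos_add, Real.sin_add]; ring
  · funext j
    simp [torusRot]
    abel

theorem torusRot_two_pi_mul_int (n : Fin (ke + kx + 1) → ℤ) (y : LinearModel ke kx) :
    torusRot (fun k => n k * (2 * Real.pi)) y = y := by
  have hs : ∀ k, Real.sin (n k * (2 * Real.pi)) = 0 := fun k => by
    rw [show (n k : ℝ) * (2 * Real.pi) = ((2 * n k : ℤ) : ℝ) * Real.pi by push_cast; ring]
    exact Real.sin_int_mul_pi _
  have hc : ∀ k, Real.cos (n k * (2 * Real.pi)) = 1 := fun k => Real.cos_int_mul_two_pi _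
  refine Prod.ext ?_ (Prod.ext ?_ (Prod.ext ?_ rfl))
  · funext i
    rcases i with i | j
    · fin_cases i <;> simp [torusRot, hs, hc]
    · simp [torusRot, hs, hc]
  · funext i
    rcases i with i | j
    · fin_cases i <;> simp [torusRot, hs, hc]
    · simp [torusRot, hs, hc]
  · funext j
    have : ((n (Fin.natAdd ke j).succ * (2 * Real.pi) : ℝ) : AddCircle (2 * Real.pi)) = 0 :=
      AddCircle.coe_eq_zero_iff _ |>.2 ⟨n (Fin.natAdd ke j).succ, by simp⟩
    change y.2.2.1 j +
      ((n (Fin.natAdd ke j).succ * (2 * Real.pi) : ℝ) : AddCircle (2 * Real.pi)) = y.2.2.1 j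
    rw [this, add_zero]

/-- A flow without `q₁`-component is a flow of the standard torus action. -/
theorem IsModelFlow.eq_torusRot {τ : (Fin (ke + kx + 2) → ℝ) → Fin (ke + kx + 2) → ℝ}
    {Y : ℝ → LinearModel ke kx} (h : IsModelFlow τ Y) (h0 : τ (modelMap (Y 0)) 0 = 0) (t : ℝ) :
    Y t = torusRot (fun k => t * τ (modelMap (Y 0)) k.succ) (Y 0) := by
  obtain ⟨e1, e2, e3, e4, e5⟩ := h.explicit (a := τ (modelMap (Y 0))) rfl t
  set a := τ (modelMap (Y 0)) with ha
  rw [h0] at e1 e2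
  have hrot : ∀ {b x y x' y' : ℝ}, (x + y * Complex.I : ℂ) =
      Complex.exp ((b : ℝ) * Complex.I) * (x' + y' * Complex.I) →
      x = Real.cos b * x' - Real.sin b * y' ∧ y = Real.sin b * x' + Real.cos b * y' := by
    intro b x y x' y' e
    rw [Complex.exp_mul_I, ← Complex.ofReal_cos, ← Complex.ofReal_sin] at e
    have er := congrArg Complex.re e
    have ei := congrArg Complex.im e
    simp only [Complex.add_re, Complex.add_im, Complex.mul_re, Complex.mul_im, Complex.ofReal_re,
      Complex.ofReal_im, Complex.I_re, Complex.I_im] at er ei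
    exact ⟨by linarith, by linarith⟩
  have f1 := hrot (b := t * a 1) (e1.trans (by congr 2; push_cast; ring))
  have f2 := hrot (b := t * a 1) (e2.trans (by congr 2; push_cast; ring))
  have f3 := fun j => hrot (b := -(t * a (ellIdx j)))
    ((e3 j).trans (by congr 2; push_cast; ring))
  refine Prod.ext ?_ (Prod.ext ?_ (Prod.ext ?_ e5))
  · funext i
    rcases i with i | j
    · fin_cases i
      · exact f1.1
      · exact f1.2
    · have := (f3 j).1
      rw [Real.cos_neg, Real.sin_neg] at this
      refine this.trans ?_
      simp only [torusRot, Sum.elim_inr]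
      change _ = Real.cos (t * a (ellIdx j)) * _ + Real.sin (t * a (ellIdx j)) * _
      ring
  · funext i
    rcases i with i | j
    · fin_cases i
      · exact f2.1
      · exact f2.2
    · have := (f3 j).2
      rw [Real.cos_neg, Real.sin_neg] at this
      refine this.trans ?_
      simp only [torusRot, Sum.elim_inr]
      change _ = Real.cos (t * a (ellIdx j)) * _ - Real.sin (t * a (ellIdx j)) * _
      ring
  · funext j
    refine AddCircle.injective_toCircle (by positivity : (2 * Real.pi) ≠ 0) (Circle.ext ?_)
    rw [e4 j]
    change _ = ((AddCircle.toCircle ((Y 0).2.2.1 j +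
      ((t * a (actIdx j) : ℝ) : AddCircle (2 * Real.pi))) : Circle) : ℂ)
    rw [AddCircle.toCircle_add, Circle.coe_mul, AddCircle.toCircle_apply_mk,
      div_self (by positivity), one_mul, Circle.coe_exp, mul_comm]
    congr 2; push_cast; ring

variable {M : Type*} [TopologicalSpace M]
  [ChartedSpace (EuclideanSpace ℝ (Fin (2 * (ke + kx + 2)))) M]
  {Ω : SymplecticForm (ke + kx + 2) M} {F : M → Fin (ke + kx + 2) → ℝ}
  {φ : OpenPartialHomeomorph M (LinearModel ke kx)}
  {ρ : (Fin (ke + kx + 1) → AddCircle (2 * Real.pi)) → M → M}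
  {G : (Fin (ke + kx + 2) → ℝ) → Fin (ke + kx + 2) → ℝ} {r : ℝ}

/-- The torus action is read in the linear model as the standard torus action precomposed with the
homomorphism of tori given by the matrix of the frequencies. -/
theorem IsLocalModel.apply_action (h : IsLocalModel Ω F φ ρ G r) {p : M}
    (hp : p ∈ orbitTube φ ρ r) {A : Matrix (Fin (ke + kx + 1)) (Fin (ke + kx + 1)) ℤ}
    (hA : ∀ i, grad (fun c => G c i.succ) (modelMap (φ p)) 0 = 0 ∧
      ∀ k : Fin (ke + kx + 1), grad (fun c => G c i.succ) (modelMap (φ p)) k.succ = A i k)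
    (t : Fin (ke + kx + 1) → ℝ) :
    φ (ρ (fun i => (t i : AddCircle (2 * Real.pi))) p) =
      torusRot (fun k => ∑ i, t i * A i k) (φ p) := by
  have key : ∀ S : Finset (Fin (ke + kx + 1)),
      φ (ρ (∑ j ∈ S, Pi.single j (t j : AddCircle (2 * Real.pi))) p) =
        torusRot (fun k => ∑ i ∈ S, t i * A i k) (φ p) := by
    intro S
    induction S using Finset.induction_on with
    | empty =>
      rw [Finset.sum_empty, h.action.zero]
      exact (torusRot_zero _).symm
    | insert i S hi ih =>
      rw [h.action.sum_insert t p hi]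
      set p' := ρ (∑ j ∈ S, Pi.single j (t j : AddCircle (2 * Real.pi))) p with hp'
      have hp'm : p' ∈ orbitTube φ ρ r := h.apply_mem_orbitTube hp _
      have hQ : modelMap (φ p') = modelMap (φ p) := by rw [ih, modelMap_torusRot]
      have h0 : φ (ρ (Pi.single i ((0 : ℝ) : AddCircle (2 * Real.pi))) p') = φ p' := by
        simp [h.action.zero]
      have := (h.isModelFlow hp'm i).eq_torusRot (by
        rw [h0, hQ]; exact (hA i).1) (t i)
      simp only [h0, hQ, (hA i).2] at this
      rw [this, ih, torusRot_torusRot]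
      congr 1
      funext k
      rw [Finset.sum_insert hi, Pi.add_apply]
  have := key Finset.univ
  rwa [Finset.univ_sum_single] at this

/-- Effectiveness: a rational torus element acting trivially near a point is trivial. -/
theorem IsTorusAction.int_of_eventually_eq {d : ℕ} {M : Type*} [TopologicalSpace M] [T2Space M]
    [ConnectedSpace M] [ChartedSpace (EuclideanSpace ℝ (Fin (2 * (d + 1)))) M]
    {Ω : SymplecticForm (d + 1) M} {F : M → Fin (d + 1) → ℝ}
    {ρ : (Fin d → AddCircle (2 * Real.pi)) → M → M} (hρ : IsTorusAction Ω F ρ)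
    (heff : ∀ t, (∀ p, ρ t p = p) → t = 0) {v : Fin d → ℝ} {N : ℕ} (hN : 0 < N)
    (hNv : ∀ i, ∃ l : ℤ, N * v i = l) {m : M}
    (hm : ∀ᶠ p in nhds m,
      ρ (fun i => ((v i * (2 * Real.pi) : ℝ) : AddCircle (2 * Real.pi))) p = p) :
    ∀ i, ∃ l : ℤ, v i = l := by
  set s : Fin d → AddCircle (2 * Real.pi) :=
    fun i => ((v i * (2 * Real.pi) : ℝ) : AddCircle (2 * Real.pi)) with hs
  have hNs : N • s = 0 := by
    funext i
    obtain ⟨l, hl⟩ := hNv i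
    rw [Pi.smul_apply, Pi.zero_apply, hs, ← AddCircle.coe_nsmul]
    refine (AddCircle.coe_eq_zero_iff _).2 ⟨l, ?_⟩
    rw [zsmul_eq_mul, nsmul_eq_mul, ← hl]; ring
  have hit : ∀ j : ℕ, ∀ p, (ρ s)^[j] p = ρ (j • s) p := by
    intro j p
    induction j with
    | zero => simp [hρ.zero]
    | succ j ih => rw [Function.iterate_succ_apply', ih, ← hρ.add, succ_nsmul']
  have hsm : ContMDiff (𝓡 (2 * (d + 1))) (𝓡 (2 * (d + 1))) ∞ (ρ s) := by
    have h1 : ContMDiff (𝓡 (2 * (d + 1))) (𝓘(ℝ, Fin d → ℝ).prod (𝓡 (2 * (d + 1)))) ∞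
        (fun p : M => ((fun i => v i * (2 * Real.pi)), p) : M → (Fin d → ℝ) × M) :=
      contMDiff_const.prodMk contMDiff_id
    exact hρ.smooth.comp h1
  have hid : ρ s = id := eq_id_of_iterate_eq_id hsm hN
    (funext fun p => by rw [hit, hNs, hρ.zero, id]) hm
  have hs0 := heff s fun p => congrFun hid p
  intro i
  have hsi : ((v i * (2 * Real.pi) : ℝ) : AddCircle (2 * Real.pi)) = 0 := congrFun hs0 i
  obtain ⟨l, hl⟩ := (AddCircle.coe_eq_zero_iff _).1 hsi
  refine ⟨l, ?_⟩
  rw [zsmul_eq_mul] at hl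
  exact (mul_right_cancel₀ (by positivity) hl).symm

/-- The parametrization maps neighbourhoods to neighbourhoods. -/
theorem IsSymplecto.eventually_exists_param (hφ : IsSymplecto Ω φ) {z₀ : ModelCover ke kx}
    (hz₀ : z₀ ∈ paramDomain φ) {B : Set (ModelCover ke kx)} (hB : B ∈ nhds z₀) :
    ∀ᶠ p in nhds (param φ z₀), ∃ z ∈ B, param φ z = p := by
  obtain ⟨κ, hκ, hκz, -, hev⟩ := hφ.exists_localInverse hz₀
  set c := chartAt (EuclideanSpace ℝ (Fin (2 * (ke + kx + 2)))) (param φ z₀) with hc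
  have hps : param φ z₀ ∈ c.source := mem_chart_source _ _
  have hκt : Filter.Tendsto κ (nhds (c (param φ z₀))) (nhds z₀) := by
    have := hκ.continuousAt.tendsto
    rwa [hκz] at this
  have hct : Filter.Tendsto c (nhds (param φ z₀)) (nhds (c (param φ z₀))) := c.continuousAt hps
  filter_upwards [hct.eventually (hκt.eventually hB), hct.eventually hev,
      c.open_source.mem_nhds hps]
    with p h1 h2 h3
  exact ⟨κ (c p), h1, by rw [h2.2, c.left_inv h3]⟩

/-- The matrix of the frequencies is invertible over the integers, since the torus action is
effective. -/
theorem IsLocalModel.isUnit_matrix [T2Space M] [ConnectedSpace M] (h : IsLocalModel Ω F φ ρ G r)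
    (heff : ∀ t, (∀ p, ρ t p = p) → t = 0) {z₀ : ModelCover ke kx} {δ : ℝ} (hδ : 0 < δ)
    (hB : ∀ z ∈ Metric.ball z₀ δ, z ∈ paramDomain φ ∧ param φ z ∈ orbitTube φ ρ r)
    {A : Matrix (Fin (ke + kx + 1)) (Fin (ke + kx + 1)) ℤ}
    (hA : ∀ z ∈ Metric.ball z₀ δ, ∀ i,
      grad (fun c => G c i.succ) (modelMap (coverMap z)) 0 = 0 ∧
      ∀ k : Fin (ke + kx + 1), grad (fun c => G c i.succ) (modelMap (coverMap z)) k.succ = A i k)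
    (hdet : A.det ≠ 0) : IsUnit A := by
  have hkey : ∀ v : Fin (ke + kx + 1) → ℝ, (∀ k, ∃ n : ℤ, ∑ i, v i * A i k = n) →
      (∃ N : ℕ, 0 < N ∧ ∀ i, ∃ l : ℤ, N * v i = l) → ∀ i, ∃ l : ℤ, v i = l := by
    rintro v hv ⟨N, hN, hNv⟩
    choose n hn using hv
    refine h.action.int_of_eventually_eq heff hN hNv (m := param φ z₀) ?_
    filter_upwards [h.symplecto.eventually_exists_param (hB z₀ (Metric.mem_ball_self hδ)).1
      (Metric.ball_mem_nhds z₀ hδ)] with p hp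
    obtain ⟨z, hz, rfl⟩ := hp
    have hφz : φ (param φ z) = coverMap z := φ.right_inv (hB z hz).1
    have hact := h.apply_action (hB z hz).2 (A := A) (by rw [hφz]; exact hA z hz)
      fun i => v i * (2 * Real.pi)
    have : (fun k => ∑ i, v i * (2 * Real.pi) * (A i k : ℝ)) = fun k => n k * (2 * Real.pi) := by
      funext k
      rw [← hn k, Finset.sum_mul]
      exact Finset.sum_congr rfl fun i _ => by ring
    rw [this, torusRot_two_pi_mul_int] at hact
    have h2 := (hB z hz).2
    refine φ.injOn (h2 _).1 ?_ hact
    have := (h2 0).1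
    rwa [h.action.zero] at this
  have hdet' : (A.det : ℝ) ≠ 0 := by exact_mod_cast hdet
  -- the rows of the inverse matrix satisfy the hypotheses of `hkey`, with `N = |det A|`
  have hint : ∀ i j, ∃ l : ℤ, (A.adjugate j i : ℝ) / A.det = l := by
    intro i j
    refine hkey (fun i => (A.adjugate j i : ℝ) / A.det) (fun k => ?_)
      ⟨A.det.natAbs, Int.natAbs_pos.2 hdet, fun i => ?_⟩ i
    · refine ⟨(1 : Matrix _ _ ℤ) j k, ?_⟩
      have h1 := congrFun (congrFun (Matrix.adjugate_mul A) j) k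
      rw [Matrix.mul_apply, Matrix.smul_apply, smul_eq_mul] at h1
      have h2 : (∑ i, (A.adjugate j i : ℝ) * (A i k : ℝ)) =
          A.det * ((1 : Matrix _ _ ℤ) j k : ℤ) := by
        exact_mod_cast h1
      rw [← mul_right_inj' hdet', ← h2, Finset.mul_sum]
      exact Finset.sum_congr rfl fun i _ => by field_simp
    · rcases Int.natAbs_eq A.det with e | e
      · refine ⟨A.adjugate j i, ?_⟩
        have : ((A.det.natAbs : ℕ) : ℝ) = A.det := by
          rw [← Int.cast_natCast (R := ℝ), ← e]
        rw [this]; field_simp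
      · refine ⟨-A.adjugate j i, ?_⟩
        have : ((A.det.natAbs : ℕ) : ℝ) = -A.det := by
          have : ((A.det.natAbs : ℕ) : ℤ) = -A.det := by omega
          rw [← Int.cast_natCast (R := ℝ), this, Int.cast_neg]
        rw [this, Int.cast_neg]; field_simp
  choose B hB' using hint
  refine IsUnit.of_mul_eq_one_right (Matrix.of fun j i => B i j) ?_
  ext j k
  have h1 := congrFun (congrFun (Matrix.adjugate_mul A) j) k
  rw [Matrix.mul_apply, Matrix.smul_apply, smul_eq_mul] at h1
  rw [Matrix.mul_apply]
  have h2 : ∀ i, (A.adjugate j i : ℝ) = A.det * (B i j : ℝ) := fun i => by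
    rw [← hB' i j]; field_simp
  have h3 : ∀ i, A.adjugate j i = A.det * B i j := fun i => by exact_mod_cast h2 i
  simp only [h3, mul_assoc, ← Finset.mul_sum] at h1
  exact mul_left_cancel₀ hdet h1

end Effective

/-! ### The Williamson type determines the rank of the differential of `G` -/

section Williamson

variable {n : ℕ} {M : Type*} [TopologicalSpace M]
  [ChartedSpace (EuclideanSpace ℝ (Fin (2 * n))) M]

/-- The functional `v ↦ ∑ aᵢ vᵢ`. -/
def dotCLM (a : Fin n → ℝ) : (Fin n → ℝ) →L[ℝ] ℝ :=
  ∑ i, a i • ContinuousLinearMap.proj (R := ℝ) (φ := fun _ : Fin n => ℝ) i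

theorem dotCLM_apply (a v : Fin n → ℝ) : dotCLM a v = ∑ i, a i * v i := by
  simp [dotCLM]

/-- In the chart at `p`, the differential of `F` at `p` is an ordinary derivative. -/
theorem contDiffAt_comp_chart_symm {F : M → Fin n → ℝ}
    {p : M} (hF : ContMDiffAt (𝓡 (2 * n)) 𝓘(ℝ, Fin n → ℝ) ∞ F p) :
    ContDiffAt ℝ ∞ (F ∘ (chartAt (EuclideanSpace ℝ (Fin (2 * n))) p).symm)
      (chartAt (EuclideanSpace ℝ (Fin (2 * n))) p p) ∧
    fderiv ℝ (F ∘ (chartAt (EuclideanSpace ℝ (Fin (2 * n))) p).symm)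
      (chartAt (EuclideanSpace ℝ (Fin (2 * n))) p p) = mfderiv (𝓡 (2 * n)) 𝓘(ℝ, Fin n → ℝ) F p := by
  constructor
  · have := (contMDiffAt_iff.1 hF).2
    simp only [mfld_simps] at this
    exact contDiffWithinAt_univ.1 this
  · have h' := hF.mdifferentiableAt (by simp)
    refine Eq.trans ?_ (MDifferentiableAt.mfderiv h').symm
    simp only [writtenInExtChartAt, mfld_simps, fderivWithin_univ]
    rfl

theorem diff_comb {F : M → Fin n → ℝ} {p : M}
    (hF : MDifferentiableAt (𝓡 (2 * n)) 𝓘(ℝ, Fin n → ℝ) F p) (a : Fin n → ℝ)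
    (v : TangentSpace (𝓡 (2 * n)) p) :
    diff n (comb F a) p v =
      dotCLM a (mfderiv (𝓡 (2 * n)) 𝓘(ℝ, Fin n → ℝ) F p v : Fin n → ℝ) := by
  have h1 : comb F a = dotCLM a ∘ F := by
    funext q; rw [Function.comp_apply, dotCLM_apply, comb]
  have h2 := ((dotCLM a).hasMFDerivAt.comp p hF.hasMFDerivAt).mfderiv
  rw [← h1] at h2
  exact DFunLike.congr_fun h2 v

theorem hess_comb {F : M → Fin n → ℝ} {p : M}
    (hF : ContMDiffAt (𝓡 (2 * n)) 𝓘(ℝ, Fin n → ℝ) ∞ F p) (a : Fin n → ℝ)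
    (u v : EuclideanSpace ℝ (Fin (2 * n))) :
    hess n (comb F a) p u v =
      dotCLM a (fderiv ℝ (fderiv ℝ (F ∘ (chartAt (EuclideanSpace ℝ (Fin (2 * n))) p).symm))
        (chartAt (EuclideanSpace ℝ (Fin (2 * n))) p p) u v) := by
  have hΦ := (contDiffAt_comp_chart_symm hF).1
  set Φ := F ∘ (chartAt (EuclideanSpace ℝ (Fin (2 * n))) p).symm with hΦd
  set e := chartAt (EuclideanSpace ℝ (Fin (2 * n))) p p
  have h1 : comb F a ∘ (chartAt (EuclideanSpace ℝ (Fin (2 * n))) p).symm = dotCLM a ∘ Φ := by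
    funext q; simp only [Function.comp_apply, dotCLM_apply, comb, hΦd]
  have h2 : fderiv ℝ (dotCLM a ∘ Φ) =ᶠ[nhds e] fun w => (dotCLM a).comp (fderiv ℝ Φ w) := by
    filter_upwards [(hΦ.of_le (show ((1 : ℕ) : WithTop ℕ∞) ≤ ∞ by exact_mod_cast le_top)).eventually
      (by simp)] with w hw
    rw [fderiv_comp w (dotCLM a).differentiableAt (hw.differentiableAt (by simp)),
      (dotCLM a).fderiv]
  have h3 : HasFDerivAt (fderiv ℝ Φ) (fderiv ℝ (fderiv ℝ Φ) e) e :=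
    ((hΦ.fderiv_right (m := ∞) (by simp)).differentiableAt (by simp)).hasFDerivAt
  have h4 := ((ContinuousLinearMap.compL ℝ (EuclideanSpace ℝ (Fin (2 * n))) (Fin n → ℝ) ℝ
    (dotCLM a)).hasFDerivAt.comp e h3).fderiv
  have h5 : fderiv ℝ (fderiv ℝ (comb F a ∘ (chartAt (EuclideanSpace ℝ (Fin (2 * n))) p).symm)) e =
      (ContinuousLinearMap.compL ℝ (EuclideanSpace ℝ (Fin (2 * n))) (Fin n → ℝ) ℝ (dotCLM a)).comp
        (fderiv ℝ (fderiv ℝ Φ) e) := by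
    rw [h1, h2.fderiv_eq]; exact h4
  exact congrArg (fun B => B u v) h5

/-- The annihilator of the range of `D` has the complementary dimension. -/
theorem finrank_ker_dot {V : Type*} [AddCommGroup V] [Module ℝ V] [FiniteDimensional ℝ V]
    (D : V →ₗ[ℝ] (Fin n → ℝ)) :
    ∃ K : Submodule ℝ (Fin n → ℝ), (∀ a, a ∈ K ↔ ∀ v, dotCLM a (D v) = 0) ∧
      Module.finrank ℝ K + Module.finrank ℝ (LinearMap.range D) = n := by
  let e : (Fin n → ℝ) ≃ₗ[ℝ] Module.Dual ℝ (Fin n → ℝ) := (Pi.basisFun ℝ (Fin n)).toDualEquiv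
  have he : ∀ a v, e a v = dotCLM a v := by
    intro a v
    rw [dotCLM_apply]
    conv_lhs => rw [← (Pi.basisFun ℝ (Fin n)).sum_repr a]
    rw [map_sum, LinearMap.sum_apply]
    refine Finset.sum_congr rfl fun i _ => ?_
    rw [map_smul, LinearMap.smul_apply, smul_eq_mul, Pi.basisFun_repr]
    exact congrArg _ (Module.Basis.toDual_apply_right _ _ _)
  refine ⟨LinearMap.ker (D.dualMap ∘ₗ e.toLinearMap), fun a => ?_, ?_⟩
  · rw [LinearMap.mem_ker, LinearMap.ext_iff]
    exact forall_congr' fun v => by rw [← he]; rfl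
  · have h := LinearMap.finrank_range_add_finrank_ker (D.dualMap ∘ₗ e.toLinearMap)
    rw [LinearEquiv.range_comp, LinearMap.finrank_range_dualMap_eq_finrank_range,
      Module.finrank_fin_fun] at h
    omega

theorem linearIndependent_elementaryForm {ke : ℕ} :
    LinearIndependent ℝ (elementaryForm (ke := ke) (kf := 1) (kh := 0)) := by
  classical
  rw [Fintype.linearIndependent_iff]
  intro g hg i
  have key : ∀ z, ∑ i, g i * elementaryForm (ke := ke) (kf := 1) (kh := 0) i z = 0 := fun z => by
    simpa using congrFun hg z
  rcases i with i | ⟨i, j⟩ | i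
  · simpa [Fintype.sum_sum_type, Fintype.sum_prod_type, elementaryForm, Pi.single_apply] using
      key (Pi.single (.inl i) 1, 0)
  · fin_cases i
    fin_cases j
    · simpa [Fintype.sum_sum_type, Fintype.sum_prod_type, elementaryForm, Pi.single_apply] using
        key (Pi.single (.inr (.inl (0, 0))) 1, Pi.single (.inr (.inl (0, 0))) 1)
    · simpa [Fintype.sum_sum_type, Fintype.sum_prod_type, elementaryForm, Pi.single_apply] using
        key (Pi.single (.inr (.inl (0, 0))) 1, Pi.single (.inr (.inl (0, 1))) 1)
  · exact i.elim0

/-- At a focus-focus point, a combination of the components which is critical to second order along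
the kernel of `dF` is zero: the `ke + 2` dimensions of critical combinations are all needed to
produce the `ke + 2` independent elementary quadratic forms. -/
theorem HasWilliamsonType.eq_zero_of_hess {ke kx : ℕ} (hn : n = ke + kx + 2)
    {Ω : SymplecticForm n M} {F : M → Fin n → ℝ} {m : M} (hm : HasWilliamsonType Ω F m ke 1 0 kx)
    (hF : ContMDiffAt (𝓡 (2 * n)) 𝓘(ℝ, Fin n → ℝ) ∞ F m) {a : Fin n → ℝ}
    (ha : diff n (comb F a) m = 0)
    (hh : ∀ u v : TangentSpace (𝓡 (2 * n)) m, mfderiv (𝓡 (2 * n)) 𝓘(ℝ, Fin n → ℝ) F m u = 0 →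
      hess n (comb F a) m u v = 0) : a = 0 := by
  obtain ⟨hrank, W, hW, S, -, hS⟩ := hm
  have : FiniteDimensional ℝ (TangentSpace (𝓡 (2 * n)) m) :=
    inferInstanceAs (FiniteDimensional ℝ (EuclideanSpace ℝ (Fin (2 * n))))
  have hFd := hF.mdifferentiableAt (by simp)
  obtain ⟨K, hK, hKd⟩ := finrank_ker_dot (n := n)
    (mfderiv (𝓡 (2 * n)) 𝓘(ℝ, Fin n → ℝ) F m).toLinearMap
  have hK' : ∀ a, a ∈ K ↔ diff n (comb F a) m = 0 := by
    intro a
    rw [hK, ContinuousLinearMap.ext_iff]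
    exact forall_congr' fun v => by rw [diff_comb hFd]; rfl
  -- the quadratic forms on the slice of the critical combinations
  let B := fderiv ℝ (fderiv ℝ (F ∘ (chartAt (EuclideanSpace ℝ (Fin (2 * n))) m).symm))
        (chartAt (EuclideanSpace ℝ (Fin (2 * n))) m m)
  have hB : ∀ a (w : W), hess n (comb F a) m w w = ∑ i, a i * B w.1 w.1 i := fun a w => by
    rw [← dotCLM_apply]; exact hess_comb hF a _ _
  let H : K →ₗ[ℝ] (W → ℝ) :=
    { toFun := fun a w => hess n (comb F a.1) m w w
      map_add' := fun a b => by
        funext w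
        simp only [hB, Pi.add_apply, Submodule.coe_add, add_mul, Finset.sum_add_distrib]
      map_smul' := fun c a => by
        funext w
        simp only [hB, Pi.smul_apply, Submodule.coe_smul, smul_eq_mul, mul_assoc, Finset.mul_sum,
          RingHom.id_apply] }
  have hle : (Submodule.span ℝ (Set.range (elementaryForm (ke := ke) (kf := 1) (kh := 0)))).map
      (LinearMap.funLeft ℝ ℝ S) ≤ LinearMap.range H := by
    rintro _ ⟨h, hh, rfl⟩
    have : LinearMap.funLeft ℝ ℝ S h ∈ {g : W → ℝ | ∃ h ∈ Submodule.span ℝ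
            (Set.range (elementaryForm (ke := ke) (kf := 1) (kh := 0))),
          ∀ w, g w = h (S w)} := ⟨h, hh, fun w => rfl⟩
    rw [← hS] at this
    obtain ⟨a, ha, hga⟩ := this
    exact ⟨⟨a, (hK' a).2 ha⟩, funext fun w => (hga w).symm⟩
  have hdim := Submodule.finrank_mono hle
  rw [← (Submodule.equivMapOfInjective _ (LinearMap.funLeft_injective_of_surjective ℝ ℝ S
      S.surjective)
      _).finrank_eq, finrank_span_eq_card linearIndependent_elementaryForm] at hdim
  have hcard : Fintype.card (WIndex ke 1 0) = ke + 2 := by simp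
  have hker : LinearMap.ker H = ⊥ := by
    rw [← Submodule.finrank_eq_zero (R := ℝ)]
    have := LinearMap.finrank_range_add_finrank_ker H
    have hKd' : Module.finrank ℝ K + kx = n := by rw [← hrank]; exact hKd
    rw [hcard] at hdim
    omega
  have h0 : (⟨a, (hK' a).2 ha⟩ : K) ∈ LinearMap.ker H := by
    refine LinearMap.mem_ker.2 (funext fun w => hh _ _ ?_)
    have : (w : TangentSpace (𝓡 (2 * n)) m) ∈ LinearMap.ker
        (mfderiv (𝓡 (2 * n)) 𝓘(ℝ, Fin n → ℝ) F m).toLinearMap := by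
      rw [← hW.2]; exact Submodule.mem_sup_right w.2
    exact this
  rw [hker, Submodule.mem_bot] at h0
  exact congrArg Subtype.val h0

/-- The second derivative of a composition, in a direction killed by the inner derivative. -/
theorem fderiv_fderiv_comp_of_fderiv_eq_zero {E V X : Type*} [NormedAddCommGroup E]
    [NormedSpace ℝ E] [NormedAddCommGroup V] [NormedSpace ℝ V] [NormedAddCommGroup X]
    [NormedSpace ℝ X] {G : V → X} {R : E → V} {e : E} (hG : ContDiff ℝ ∞ G)
    (hR : ContDiffAt ℝ ∞ R e) {u : E} (hu : fderiv ℝ R e u = 0) (v : E) :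
    fderiv ℝ (fderiv ℝ (G ∘ R)) e u v = fderiv ℝ G (R e) (fderiv ℝ (fderiv ℝ R) e u v) := by
  have h1 : fderiv ℝ (G ∘ R) =ᶠ[nhds e] fun w => (fderiv ℝ G (R w)).comp (fderiv ℝ R w) := by
    filter_upwards [(hR.of_le (show ((1 : ℕ) : WithTop ℕ∞) ≤ ∞ by exact_mod_cast le_top)).eventually
      (by simp)] with w hw
    exact fderiv_comp w (hG.differentiable (by simp) _) (hw.differentiableAt (by simp))
  have h2 : HasFDerivAt (fderiv ℝ R) (fderiv ℝ (fderiv ℝ R) e) e :=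
    ((hR.fderiv_right (m := ∞) (by simp)).differentiableAt (by simp)).hasFDerivAt
  have h3 : HasFDerivAt (fderiv ℝ G) (fderiv ℝ (fderiv ℝ G) (R e)) (R e) :=
    (((hG.fderiv_right (m := ∞) (by simp)).differentiable
      (by simp)) _).hasFDerivAt
  have h4 := h3.comp e (hR.differentiableAt (by simp)).hasFDerivAt
  have h5 := (h4.clm_comp h2).fderiv
  rw [h1.fderiv_eq]
  refine (congrArg (fun B => B u v) h5).trans ?_
  simp [hu]

end Williamson

section Rank

variable {ke kx : ℕ} {M : Type*} [TopologicalSpace M]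
  [ChartedSpace (EuclideanSpace ℝ (Fin (2 * (ke + kx + 2)))) M]
  {Ω : SymplecticForm (ke + kx + 2) M} {F : M → Fin (ke + kx + 2) → ℝ}
  {φ : OpenPartialHomeomorph M (LinearModel ke kx)}
  {ρ : (Fin (ke + kx + 1) → AddCircle (2 * Real.pi)) → M → M}
  {G : (Fin (ke + kx + 2) → ℝ) → Fin (ke + kx + 2) → ℝ} {r : ℝ}

theorem modelMap_of_mem_zeroTorus {y : LinearModel ke kx} (hy : y ∈ zeroTorus ke kx) :
    modelMap y = 0 := by
  obtain ⟨hx, hξ, hI⟩ := hy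
  exact funext (forall_idx (by simp [hx]) (by simp [hx]) (fun j => by simp [hx, hξ])
    fun j => by simp [hI])

/-- The rows of the differential of `G` at the origin are linearly independent: a combination of the
components of `F` that is killed by `dG(0)` is critical, and so is its Hessian on `ker dF`, whereas
the Williamson type leaves room for no such combination. -/
theorem IsLocalModel.eq_zero_of_dot_fderiv (h : IsLocalModel Ω F φ ρ G r) (hr : 0 < r)
    {z₀ : ModelCover ke kx} (hz₀ : coverMap z₀ ∈ zeroTorus ke kx)
    (hm : HasWilliamsonType Ω F (param φ z₀) ke 1 0 kx) {a : Fin (ke + kx + 2) → ℝ}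
    (ha : ∀ v, dotCLM a (fderiv ℝ G 0 v) = 0) : a = 0 := by
  have hz₀t : coverMap z₀ ∈ tube ke kx r := zeroTorus_subset_tube hr hz₀
  have hz₀d : z₀ ∈ paramDomain φ := h.tube_subset hz₀t
  have hFm := h.smooth_F (param φ z₀)
  obtain ⟨κ, hκ, hκz, -, hev⟩ := h.symplecto.exists_localInverse hz₀d
  obtain ⟨hΦ, hΦd⟩ := contDiffAt_comp_chart_symm hFm
  set c := chartAt (EuclideanSpace ℝ (Fin (2 * (ke + kx + 2)))) (param φ z₀) with hc
  set e := c (param φ z₀) with he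
  let R : EuclideanSpace ℝ (Fin (2 * (ke + kx + 2))) → Fin (ke + kx + 2) → ℝ :=
    (fun z : ModelCover ke kx => modelMap (coverMap z)) ∘ κ
  have hR : ContDiffAt ℝ ∞ R e := contDiff_modelMap_coverMap.contDiffAt.comp e hκ
  have hRe : R e = 0 := by
    simp only [R, Function.comp_apply, hκz, modelMap_of_mem_zeroTorus hz₀]
  have hRd : ∀ u, fderiv ℝ R e u = modelDiff z₀ (fderiv ℝ κ e u) := by
    intro u
    have := fderiv_comp e (g := fun z : ModelCover ke kx => modelMap (coverMap z))
      (contDiff_modelMap_coverMap.differentiable (by simp) _) (hκ.differentiableAt (by simp))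
    rw [show R = (fun z : ModelCover ke kx => modelMap (coverMap z)) ∘ κ from rfl, this, hκz,
      ContinuousLinearMap.comp_apply, fderiv_modelMap_coverMap]
  have hFR : F ∘ c.symm =ᶠ[nhds e] G ∘ R := by
    have hκt : Filter.Tendsto κ (nhds e) (nhds z₀) := by
      have := hκ.continuousAt.tendsto
      rwa [hκz] at this
    filter_upwards [hev, hκt.eventually
      (((isOpen_tube r).preimage continuous_coverMap).mem_nhds hz₀t)] with w h1 h2
    rw [Function.comp_apply, ← h1.2]
    exact h.eq _ h2
  have hGd : Differentiable ℝ G := h.smooth_G.differentiable (by simp)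
  have hdF : fderiv ℝ (F ∘ c.symm) e = (fderiv ℝ G 0).comp (fderiv ℝ R e) := by
    rw [hFR.fderiv_eq, fderiv_comp e (hGd _) (hR.differentiableAt (by simp)), hRe]
  -- the kernels of `dF` and of `dR` agree, by a dimension count
  have hrange : Module.finrank ℝ (LinearMap.range (fderiv ℝ R e).toLinearMap) ≤ kx := by
    let P : (Fin kx → ℝ) →ₗ[ℝ] (Fin (ke + kx + 2) → ℝ) :=
      { toFun := fun I => modelDiff z₀ (0, 0, 0, I)
        map_add' := fun I J => funext (forall_idx (by simp [modelDiff_zero])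
          (by simp [modelDiff_one]) (fun j => by simp [modelDiff_ellIdx])
          fun j => by simp [modelDiff_actIdx])
        map_smul' := fun s I => funext (forall_idx (by simp [modelDiff_zero])
          (by simp [modelDiff_one]) (fun j => by simp [modelDiff_ellIdx])
          fun j => by simp [modelDiff_actIdx]) }
    have hle : LinearMap.range (fderiv ℝ R e).toLinearMap ≤ LinearMap.range P := by
      rintro _ ⟨u, rfl⟩
      obtain ⟨hx, hξ, -⟩ := hz₀
      have hx' : z₀.1 = 0 := hx
      have hξ' : z₀.2.1 = 0 := hξ
      refine ⟨(fderiv ℝ κ e u).2.2.2, ?_⟩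
      refine Eq.trans ?_ (hRd u).symm
      exact funext (forall_idx (by simp [P, modelDiff_zero, hx', hξ'])
        (by simp [P, modelDiff_one, hx', hξ']) (fun j => by simp [P, modelDiff_ellIdx, hx', hξ'])
        fun j => by simp [P, modelDiff_actIdx])
    exact (Submodule.finrank_mono hle).trans ((LinearMap.finrank_range_le P).trans (by simp))
  have hrank : Module.finrank ℝ (LinearMap.range (fderiv ℝ (F ∘ c.symm) e).toLinearMap) = kx := by
    rw [hΦd]; exact hm.1
  have hkle : LinearMap.ker (fderiv ℝ R e).toLinearMap ≤
      LinearMap.ker (fderiv ℝ (F ∘ c.symm) e).toLinearMap := by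
    intro u hu
    have hu' : fderiv ℝ R e u = 0 := hu
    change fderiv ℝ (F ∘ c.symm) e u = 0
    rw [hdF, ContinuousLinearMap.comp_apply, hu', map_zero]
  have hkereq := Submodule.eq_of_le_of_finrank_le hkle (by
    have h1 := LinearMap.finrank_range_add_finrank_ker (fderiv ℝ R e).toLinearMap
    have h2 := LinearMap.finrank_range_add_finrank_ker (fderiv ℝ (F ∘ c.symm) e).toLinearMap
    omega)
  refine hm.eq_zero_of_hess rfl hFm ?_ fun u v hu => ?_
  · refine ContinuousLinearMap.ext fun v => ?_
    rw [diff_comb (hFm.mdifferentiableAt (by simp)), ← hΦd, hdF]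
    exact ha _
  · have hu1 : fderiv ℝ (F ∘ c.symm) e u = 0 := by rw [hΦd]; exact hu
    have hu2 : fderiv ℝ R e u = 0 := by
      have : u ∈ LinearMap.ker (fderiv ℝ (F ∘ c.symm) e).toLinearMap := hu1
      rw [← hkereq] at this
      exact this
    refine (hess_comb hFm a u v).trans ?_
    change dotCLM a (fderiv ℝ (fderiv ℝ (F ∘ c.symm)) e u v) = 0
    rw [hFR.fderiv.fderiv_eq]
    exact (congrArg (dotCLM a)
      (fderiv_fderiv_comp_of_fderiv_eq_zero h.smooth_G hR hu2 v)).trans (by rw [hRe]; exact ha _)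

end Rank

/-! ### Inversion of `G` -/

section Inversion

variable {n : ℕ}

theorem fderiv_apply_eq_sum_grad {G : (Fin n → ℝ) → Fin n → ℝ} (hG : Differentiable ℝ G)
    (c v : Fin n → ℝ) (i : Fin n) : fderiv ℝ G c v i = ∑ k, grad (fun c => G c i) c k * v k := by
  have := (hasFDerivAt_pi'.1 (hG c).hasFDerivAt i).fderiv
  rw [← fderiv_eq_sum_grad, this]
  rfl

/-- A smooth map whose differential at `c` has linearly independent rows restricts to a
diffeomorphism near `c`. -/
theorem exists_openPartialHomeomorph {G : (Fin n → ℝ) → Fin n → ℝ} (hG : ContDiff ℝ ∞ G)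
    {c : Fin n → ℝ} (hc : ∀ a, (∀ v, dotCLM a (fderiv ℝ G c v) = 0) → a = 0) :
    ∃ Γ : OpenPartialHomeomorph (Fin n → ℝ) (Fin n → ℝ), c ∈ Γ.source ∧ (∀ x, Γ x = G x) ∧
      ContDiffOn ℝ ∞ Γ.symm Γ.target := by
  have hGd : Differentiable ℝ G := hG.differentiable (by simp)
  have hsurj : Function.Surjective (fderiv ℝ G c) := by
    obtain ⟨K, hK, hKd⟩ := finrank_ker_dot (fderiv ℝ G c).toLinearMap
    have hK0 : K = ⊥ := (Submodule.eq_bot_iff _).2 fun a ha => hc a ((hK a).1 ha)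
    rw [hK0, finrank_bot, zero_add] at hKd
    exact LinearMap.range_eq_top.1 (Submodule.eq_top_of_finrank_eq (by
      rw [hKd, Module.finrank_fin_fun]))
  have hinj : Function.Injective (fderiv ℝ G c) :=
    (LinearMap.injective_iff_surjective (f := (fderiv ℝ G c).toLinearMap)).2 hsurj
  let D : (Fin n → ℝ) ≃L[ℝ] (Fin n → ℝ) :=
    (LinearEquiv.ofBijective (fderiv ℝ G c).toLinearMap ⟨hinj, hsurj⟩).toContinuousLinearEquiv
  have hD : (D : (Fin n → ℝ) →L[ℝ] (Fin n → ℝ)) = fderiv ℝ G c :=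
    ContinuousLinearMap.ext fun u => rfl
  have hD' : HasFDerivAt G (D : (Fin n → ℝ) →L[ℝ] (Fin n → ℝ)) c := by
    rw [hD]; exact (hGd c).hasFDerivAt
  -- the inverse is smooth where the differential stays invertible
  have hO : IsOpen {x | IsUnit (fderiv ℝ G x)} :=
    Units.isOpen.preimage (hG.continuous_fderiv (by simp))
  let Γ₀ := hG.contDiffAt.toOpenPartialHomeomorph G hD' (by simp)
  refine ⟨Γ₀.restrOpen _ hO, ⟨hG.contDiffAt.mem_toOpenPartialHomeomorph_source hD' (by simp), ?_⟩,
    fun x => rfl, fun y hy => ?_⟩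
  · exact ⟨ContinuousLinearEquiv.toUnit D, hD⟩
  · have hx := (Γ₀.restrOpen _ hO).map_target hy
    obtain ⟨U, hU⟩ : IsUnit (fderiv ℝ G ((Γ₀.restrOpen _ hO).symm y)) := hx.2
    refine ((Γ₀.restrOpen _ hO).contDiffAt_symm (f₀' := ContinuousLinearEquiv.ofUnit U) hy ?_
      hG.contDiffAt).contDiffWithinAt
    refine HasFDerivAt.congr_fderiv (hGd _).hasFDerivAt ?_
    rw [← hU]; rfl

end Inversion

/-! ### Leaves, orbits and frequencies -/

section Leaves

variable {ke kx : ℕ}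

/-- If `φ` maps leaves of `F` onto leaves of the model, `F ∘ φ.symm` is constant on connected sets
on which the momentum map is constant. -/
theorem constOnFibrePaths_of_leaf {M Y : Type*} [TopologicalSpace M] {F : M → Y}
    {φ : OpenPartialHomeomorph M (LinearModel ke kx)}
    (hleaf : ∀ p ∈ φ.source, φ '' leaf F φ.source p = leaf modelMap φ.target (φ p)) :
    ConstOnFibrePaths φ.target (F ∘ φ.symm) := by
  intro S hS hSc hSQ y hy y' hy'
  have hp := φ.map_target (hS hy)
  have hφp : φ (φ.symm y) = y := φ.right_inv (hS hy)
  have hmem : y' ∈ leaf modelMap φ.target (φ (φ.symm y)) := by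
    have hsub : S ⊆ φ.target ∩ modelMap ⁻¹' {modelMap y} := fun w hw => ⟨hS hw, hSQ w hw y hy⟩
    rw [hφp]
    exact hSc.subset_connectedComponentIn hy hsub hy'
  rw [← hleaf _ hp] at hmem
  obtain ⟨q, hq, rfl⟩ := hmem
  have hq' := connectedComponentIn_subset _ _ hq
  rw [Function.comp_apply, Function.comp_apply, φ.left_inv hq'.1]
  exact hq'.2.symm

theorem continuous_modelMap : Continuous (modelMap : LinearModel ke kx → _) := by
  refine continuous_pi (forall_idx ?_ ?_ (fun j => ?_) fun j => ?_)
  · simp only [modelMap_zero]; fun_prop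
  · simp only [modelMap_one]; fun_prop
  · simp only [modelMap_ellIdx]; fun_prop
  · simp only [modelMap_actIdx]; fun_prop

variable {M : Type*} [TopologicalSpace M]
  [ChartedSpace (EuclideanSpace ℝ (Fin (2 * (ke + kx + 2)))) M]
  {Ω : SymplecticForm (ke + kx + 2) M} {F : M → Fin (ke + kx + 2) → ℝ}
  {φ : OpenPartialHomeomorph M (LinearModel ke kx)}
  {ρ : (Fin (ke + kx + 1) → AddCircle (2 * Real.pi)) → M → M}
  {G : (Fin (ke + kx + 2) → ℝ) → Fin (ke + kx + 2) → ℝ} {r : ℝ}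

/-- The torus orbits near `m` stay in the tube, since that of `m` lies in the Poisson orbit, which
`φ` maps to the zero-torus. -/
theorem IsLocalModel.eventually_mem_orbitTube (h : IsLocalModel Ω F φ ρ G r) (hr : 0 < r) {m : M}
    (horbit : poissonOrbit Ω F m ⊆ φ.source)
    (htorus : φ '' poissonOrbit Ω F m = zeroTorus ke kx) :
    ∀ᶠ p in nhds m, p ∈ orbitTube φ ρ r := by
  refine h.action.eventually_mem (φ.isOpen_inter_preimage (isOpen_tube r)) fun s => ?_
  have hs := h.action.mem_poissonOrbit m s
  refine ⟨horbit hs, zeroTorus_subset_tube hr ?_⟩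
  rw [← htorus]
  exact Set.mem_image_of_mem _ hs

/-- The matrix of the frequencies is nonsingular, since the differential of `G` is. -/
theorem det_ne_zero_of_grad (hG : Differentiable ℝ G)
    (hinj : ∀ a, (∀ v, dotCLM a (fderiv ℝ G 0 v) = 0) → a = 0)
    {A : Matrix (Fin (ke + kx + 1)) (Fin (ke + kx + 1)) ℤ}
    (hA : ∀ i, grad (fun c => G c i.succ) 0 0 = 0 ∧
      ∀ k : Fin (ke + kx + 1), grad (fun c => G c i.succ) 0 k.succ = A i k) : A.det ≠ 0 := by
  intro hdet
  obtain ⟨v, hv, hvA⟩ := Matrix.exists_vecMul_eq_zero_iff.2 hdet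
  have h0 := hinj (Fin.cons 0 fun i => (v i : ℝ)) fun w => by
    have hrow : ∀ k, ∑ i, (v i : ℝ) * A i k = 0 := fun k => by
      have := congrFun hvA k
      simp only [Matrix.vecMul, dotProduct, Pi.zero_apply] at this
      exact_mod_cast this
    rw [dotCLM_apply, Fin.sum_univ_succ]
    simp only [Fin.cons_zero, Fin.cons_succ, zero_mul, zero_add, fderiv_apply_eq_sum_grad hG,
      Fin.sum_univ_succ (n := ke + kx + 1), (hA _).1, (hA _).2, Finset.mul_sum]
    rw [Finset.sum_comm]
    refine Finset.sum_eq_zero fun k _ => ?_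
    simp only [← mul_assoc, ← Finset.sum_mul, hrow, zero_mul]
  refine hv (funext fun i => ?_)
  have := congrFun h0 i.succ
  simpa using this

end Leaves

end SemitoricModel

end

/-! ### The normal form at a focus-focus critical point -/

theorem mainTheorem3 (ke kx : ℕ) {M : Type*} [TopologicalSpace M] [T2Space M] [ConnectedSpace M]
    [ChartedSpace (EuclideanSpace ℝ (Fin (2 * (ke + kx + 2)))) M]
    [IsManifold (𝓡 (2 * (ke + kx + 2))) ∞ M]
    (Ω : SemitoricModel.SymplecticForm (ke + kx + 2) M)
    (F : M → Fin (ke + kx + 2) → ℝ)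
    (hF : SemitoricModel.IsSemitoric (d := ke + kx + 1) Ω F)
    (m : M) (hm : SemitoricModel.HasWilliamsonType Ω F m ke 1 0 kx)
    (φ : OpenPartialHomeomorph M (SemitoricModel.LinearModel ke kx))
    (hφ : SemitoricModel.IsSymplecto Ω φ)
    (horbit : SemitoricModel.poissonOrbit Ω F m ⊆ φ.source)
    (htorus : φ '' SemitoricModel.poissonOrbit Ω F m = SemitoricModel.zeroTorus ke kx)
    (hleaf : ∀ p ∈ φ.source, φ '' SemitoricModel.leaf F φ.source p =
      SemitoricModel.leaf SemitoricModel.modelMap φ.target (φ p)) :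
    ∃ (G : OpenPartialHomeomorph (Fin (ke + kx + 2) → ℝ) (Fin (ke + kx + 2) → ℝ))
      (A : Matrix.GeneralLinearGroup (Fin (ke + kx + 1)) ℤ)
      (W : Set (SemitoricModel.LinearModel ke kx)),
      ContDiffOn ℝ ∞ G G.source ∧ ContDiffOn ℝ ∞ G.symm G.target ∧
      IsOpen W ∧ SemitoricModel.zeroTorus ke kx ⊆ W ∧ W ⊆ φ.target ∧
      SemitoricModel.modelMap '' W ⊆ G.source ∧
      (∀ y ∈ W, F (φ.symm y) = G (SemitoricModel.modelMap y)) ∧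
      (∀ y ∈ W, (fun i : Fin (ke + kx + 1) => F (φ.symm y) i.succ) =
        ((A : Matrix (Fin (ke + kx + 1)) (Fin (ke + kx + 1)) ℤ).map (Int.cast : ℤ → ℝ)) *ᵥ
            (fun i : Fin (ke + kx + 1) => SemitoricModel.modelMap y i.succ) +
          fun i : Fin (ke + kx + 1) => F m i.succ) := by
  open SemitoricModel in
  have hmO : m ∈ poissonOrbit Ω F m := Relation.ReflTransGen.refl
  have hmφ : m ∈ φ.source := horbit hmO
  have hmT : φ m ∈ zeroTorus ke kx := htorus ▸ Set.mem_image_of_mem φ hmO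
  have hT : zeroTorus ke kx ⊆ φ.target := by
    rw [← htorus, Set.image_subset_iff]
    exact fun p hp => φ.map_source (horbit hp)
  obtain ⟨ρ, hρ0, hρa, hρs, hρf, heff⟩ := hF.torus_action
  -- `F` descends to a smooth function of the momentum map
  obtain ⟨G, hG, r, hr, hrt, hFG⟩ := (constOnFibrePaths_of_leaf hleaf).exists_contDiff
    φ.open_target hT (contMDiffOn_iff_contDiffOn.1 (hF.smooth.comp_contMDiffOn hφ.1))
  have h : IsLocalModel Ω F φ ρ G r := ⟨hφ, hF.smooth, ⟨hρ0, hρa, hρs, hρf⟩, hG, hrt, hFG⟩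
  have hGd : Differentiable ℝ G := hG.differentiable (by simp)
  obtain ⟨z₀, hz₀⟩ := coverMap_surjective (φ m)
  have hz₀T : coverMap z₀ ∈ zeroTorus ke kx := hz₀ ▸ hmT
  have hz₀Q : modelMap (coverMap z₀) = 0 := modelMap_of_mem_zeroTorus hz₀T
  have hz₀m : param φ z₀ = m := by rw [param, hz₀, φ.left_inv hmφ]
  have hz₀d : z₀ ∈ paramDomain φ := hT hz₀T
  have hinj : ∀ a, (∀ v, dotCLM a (fderiv ℝ G 0 v) = 0) → a = 0 := fun a ha =>
    h.eq_zero_of_dot_fderiv hr hz₀T (hz₀m ▸ hm) ha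
  obtain ⟨Γ, hΓ0, hΓ, hΓs⟩ := exists_openPartialHomeomorph hG hinj
  -- the last components of `F` are affine
  obtain ⟨δ, hδ, hB⟩ : ∃ δ > 0, ∀ z ∈ Metric.ball z₀ δ,
      z ∈ paramDomain φ ∧ param φ z ∈ orbitTube φ ρ r := by
    have h1 := (hφ.contMDiffAt hz₀d).continuousAt.tendsto
    rw [hz₀m] at h1
    exact Metric.eventually_nhds_iff_ball.1 ((isOpen_paramDomain.eventually_mem hz₀d).and
      (h1.eventually (h.eventually_mem_orbitTube hr horbit htorus)))
  obtain ⟨A, hA⟩ := h.exists_int_matrix hB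
  have hA0 := hA z₀ (Metric.mem_ball_self hδ)
  rw [hz₀Q] at hA0
  obtain ⟨A', hA'⟩ := h.isUnit_matrix heff hδ hB hA (det_ne_zero_of_grad hGd hinj hA0)
  have haff := h.eq_affine hz₀Q hδ hA
  have hG0 : G 0 = F m := by
    rw [← modelMap_of_mem_zeroTorus hmT, ← hFG _ (zeroTorus_subset_tube hr hmT),
      Function.comp_apply, φ.left_inv hmφ]
  -- the angles play no role for the momentum map, so they can be moved to those of `z₀`
  let s : LinearModel ke kx → ModelCover ke kx := fun y => (y.1, y.2.1, z₀.2.2.1, y.2.2.2)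
  have hs : Continuous s := by fun_prop
  refine ⟨Γ, A', tube ke kx r ∩ (s ⁻¹' Metric.ball z₀ δ ∩ modelMap ⁻¹' Γ.source),
    hG.contDiffOn.congr fun x _ => hΓ x, hΓs, (isOpen_tube r).inter
        ((Metric.isOpen_ball.preimage hs).inter
      (Γ.open_source.preimage continuous_modelMap)), fun y hy =>
          ⟨zeroTorus_subset_tube hr hy, ?_, ?_⟩,
    fun y hy => hrt hy.1, ?_, fun y hy => ?_, fun y hy => ?_⟩
  · have : s y = z₀ := by
      obtain ⟨h1, h2, h3⟩ := hy
      obtain ⟨h1', h2', h3'⟩ := hz₀T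
      exact Prod.ext (h1.trans h1'.symm) (Prod.ext (h2.trans h2'.symm)
        (Prod.ext rfl (h3.trans h3'.symm)))
    rw [Set.mem_preimage, this]
    exact Metric.mem_ball_self hδ
  · rw [Set.mem_preimage, modelMap_of_mem_zeroTorus hy]
    exact hΓ0
  · rintro _ ⟨y, hy, rfl⟩
    exact hy.2.2
  · rw [hΓ]
    exact hFG y hy.1
  · funext i
    have h1 := haff _ hy.2.1 i
    have h2 : modelMap (coverMap (s y)) = modelMap y := rfl
    have h3 : F (φ.symm y) = G (modelMap y) := hFG y hy.1
    rw [h2, hG0] at h1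
    rw [h3, h1, hA']
    rfl
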